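/- Let $N\ge 1$ and $k\in\mathbb{Z}$, write $\tau=u+iv\in\mathbb{H}$, and let $f$ be a meromorphic modular form of weight $k$ on $\Gamma_0(N)$ (meromorphic on $\mathbb{H}$ and at all cusps) that has neither a zero nor a pole at any cusp; put $f(i\infty)=\lim_{\operatorname{Im}\tau\to\infty}f(\tau)$. For even $\kappa$ and $\operatorname{Re}(s)>1$ let $$E_{N,\kappa}(\tau,s)=\sum_{\gamma\in\Gamma_0(N)_\infty\backslash\Gamma_0(N)} v^{s-\kappa/2}\big|_\kappa\gamma ,$$ where $\Gamma_0(N)_\infty$ is the stabilizer of $i\infty$. For every $\tau$, both $E_{N,2}(\tau,s)$ and $E_{N,0}(\tau,s)$ continue meromorphically to a neighbourhood of $s=1$; the first is holomorphic there and the second has at most a simple pole. Let $g(\tau)$ be the coefficient of $(s-1)^1$ in the Taylor expansion of $E_{N,2}(\tau,s)$ at $s=1$, and $\xi_2 g=2i\,v^2\,\overline{\partial g/\partial\overline{\tau}}$. Then $g$ is (real) differentiable and $\xi_2 g(\tau)$ equals the constant term of the Laurent expansion of $E_{N,0}(\tau,s)$ at $s=1$. Let $\mathcal{F}$ be a closed,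 locally finite fundamental domain for $\Gamma_0(N)$ acting on $\mathbb{H}\cup\mathbb{Q}\cup\{i\infty\}$, with boundary of measure zero and with finitely many cusps $\rho_1,\dots,\rho_n$. For $\varepsilon,y>0$ let $\mathcal{F}^{\varepsilon,y}$ be the set obtained from $\mathcal{F}$ by removing the Euclidean discs of radius $\varepsilon$ around the singularities of $\varphi,\psi$ in $\mathcal{F}$ and the horoballs $\{\sigma_{\rho_j}\tau:\operatorname{Im}\tau>y\}$, where $\sigma_{\rho_j}\in\mathrm{SL}_2(\mathbb{Z})$ and $\sigma_{\rho_j}i\infty=\rho_j$; and for $\Gamma_0(N)$-invariant $\varphi,\psi$ with finitely many singularities in $\mathcal{F}$ let $$\langle\varphi,\psi\rangle^{\mathrm{reg}}=\lim_{\varepsilon\to0}\lim_{y\to\infty}\int_{\mathcal{F}^{\varepsilon,y}}\varphi(\tau)\overline{\psi(\tau)}\,\frac{du\,dv}{v^2}.$$ Then $f(i\infty)$ exists and is non-zero, only finitely many $z\in\Gamma_0(N)\backslash\mathbb{H}$ have $\mathrm{ord}_z(f)\neq0$, the regularized inner product $\langle 1,\log(v^{k/2}|f|)\rangle^{\mathrm{reg}}$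 exists, and $$-\frac{1}{\mathrm{vol}(\Gamma_0(N)\backslash\mathbb{H})}\,\langle 1,\log(v^{k/2}|f|)\rangle^{\mathrm{reg}}=-2\pi\sum_{z\in\Gamma_0(N)\backslash\mathbb{H}}\frac{\mathrm{ord}_z(f)}{\omega_z}\,\xi_2 g(z)+\frac{k}{2}-\log|f(i\infty)| .$$ Here $\omega_z$ is the order of the stabilizer of $z$ in $\Gamma_0(N)/\{\pm I\}$, and $\mathrm{vol}$ is the volume for $du\,dv/v^2$. -/

import Mathlib

open UpperHalfPlane Filter Topology MeasureTheory CongruenceSubgroup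
open scoped MatrixGroups ModularForm ContDiff ComplexConjugate

noncomputable section

namespace Rohrlich

/-! ### Cusps and meromorphic modular forms -/

/-- The width of the cusp `σ ∞` of `Γ₀(N)` : the least `ℓ > 0` with `σ Tˡ σ⁻¹ ∈ Γ₀(N)`, where
`T = (1 1; 0 1)`. (As `-1 ∈ Γ₀(N)`, the stabilizer of `∞` in `σ⁻¹ Γ₀(N) σ` is `{± T^(nℓ)}`.) -/
def cuspWidth (N : ℕ) (σ : SL(2, ℤ)) : ℕ :=
  sInf {l : ℕ | 0 < l ∧ σ * ModularGroup.T ^ l * σ⁻¹ ∈ Gamma0 N}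

/-- The function `F` of `q^(1/ℓ) = exp (2 π i τ / ℓ)` with `(f ∣[k] σ) τ = F (q^(1/ℓ))`,
`ℓ` being the width of the cusp `σ ∞`. -/
def expansionAtCusp (N : ℕ) (k : ℤ) (f : ℍ → ℂ) (σ : SL(2, ℤ)) : ℂ → ℂ :=
  UpperHalfPlane.cuspFunction (cuspWidth N σ : ℝ) (f ∣[k] σ)

/-- The order of `f` at the cusp `σ ∞`, i.e. the exponent of the leading term of the expansion of
`f ∣[k] σ` in powers of `q^(1/ℓ)` (it is `⊤` if that expansion vanishes). -/
def cuspOrder (N : ℕ) (k : ℤ) (f : ℍ → ℂ) (σ : SL(2, ℤ)) : WithTop ℤ :=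
  meromorphicOrderAt (expansionAtCusp N k f σ) 0

/-- Meromorphic modular forms of weight `k` on `Γ₀(N)`. A meromorphic function on `ℍ` is represented
by its normal form: its value is the limit where that is finite, and `0` at the poles. Every cusp
of `Γ₀(N)` is `σ ∞` for some `σ ∈ SL(2, ℤ)`. -/
structure IsMeromorphicModularForm (N : ℕ) (k : ℤ) (f : ℍ → ℂ) : Prop where
  meromorphic : MeromorphicNFOn (f ∘ ofComplex) {z : ℂ | 0 < z.im}
  slash_eq : ∀ γ ∈ Gamma0 N, f ∣[k] γ = f
  meromorphic_cusps : ∀ σ : SL(2, ℤ), MeromorphicAt (expansionAtCusp N k f σ) 0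

/-- `ord_z f` for a point `z` of the upper half plane. -/
def ordAt (f : ℍ → ℂ) (z : ℍ) : ℤ :=
  (meromorphicOrderAt (f ∘ ofComplex) (z : ℂ)).untop₀

/-- `ω_z`, the order of the stabilizer of `z` in `Γ₀(N) / {± 1}`
(the center of `SL(2, ℤ)` is `{± 1}`). -/
def ellipticOrder (N : ℕ) (z : ℍ) : ℕ :=
  Nat.card ((Gamma0 N ⊓ MulAction.stabilizer SL(2, ℤ) z).map
    (QuotientGroup.mk' (Subgroup.center SL(2, ℤ))))

/-! ### Fundamental domains and the regularized Petersson inner product -/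

/-- The horoball `{σ τ : Im τ > y}` at the cusp `ρ = σ ∞`, with `σ ∈ SL(2, ℤ)`. It does not
depend on the choice of `σ`. -/
def horoball (ρ : OnePoint ℚ) (y : ℝ) : Set ℍ :=
  {τ | ∃ σ : SL(2, ℤ), Matrix.SpecialLinearGroup.mapGL ℚ σ • (OnePoint.infty : OnePoint ℚ) = ρ ∧
    y < (σ⁻¹ • τ).im}

/-- The cusps of a domain `F`: the points `ρ` of `ℚ ∪ {∞}` such that `F` meets every horoball at
`ρ`. -/
def cuspsOf (F : Set ℍ) : Set (OnePoint ℚ) :=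
  {ρ | ∀ y : ℝ, 0 < y → (horoball ρ y ∩ F).Nonempty}

/-- `F`, together with its finitely many cusps, is a closed (locally finite) fundamental domain for
the action of `Γ₀(N)` on `ℍ ∪ ℚ ∪ {∞}`. The measure on `ℍ` is `du dv / v²`. -/
structure IsClosedFundamentalDomain (N : ℕ) (F : Set ℍ) : Prop where
  isClosed : IsClosed F
  covers : ∀ τ : ℍ, ∃ γ ∈ Gamma0 N, γ • τ ∈ F
  disjoint_interior : ∀ γ ∈ Gamma0 N, γ ≠ 1 → γ ≠ -1 → ∀ τ ∈ interior F, γ • τ ∉ interior F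
  null_frontier : volume (frontier F) = 0
  locally_finite : ∀ K : Set ℍ, IsCompact K →
    {γ : SL(2, ℤ) | γ ∈ Gamma0 N ∧ ∃ τ ∈ K, γ • τ ∈ F}.Finite
  finite_cusps : (cuspsOf F).Finite
  covers_cusps : ∀ ρ : OnePoint ℚ, ∃ γ ∈ Gamma0 N,
    Matrix.SpecialLinearGroup.mapGL ℚ γ • ρ ∈ cuspsOf F

/-- The volume of `Γ₀(N) \ ℍ` for `du dv / v²`, computed on a fundamental domain `F`. -/
def quotientVolume (F : Set ℍ) : ℝ := (volume F).toReal

/-- The punctured fundamental domain: the `ε`-neighborhoods (for the Euclidean distance) of the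
points of `Z` and the `y`-neighborhoods of the cusps of `F` are removed. -/
def puncturedDomain (F Z : Set ℍ) (ε y : ℝ) : Set ℍ :=
  F \ ((⋃ z ∈ Z, {τ : ℍ | ‖(τ : ℂ) - (z : ℂ)‖ < ε}) ∪ ⋃ ρ ∈ cuspsOf F, horoball ρ y)

/-- The singularities of a function on `ℍ`: the points at which it is not smooth. -/
def singularities (φ : ℍ → ℂ) : Set ℍ :=
  {z | ¬ ContDiffAt ℝ ∞ (φ ∘ ofComplex) (z : ℂ)}

/-- The points of `F` at which `φ` or `ψ` is singular. -/
def singularPoints (F : Set ℍ) (φ ψ : ℍ → ℂ) : Set ℍ :=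
  F ∩ (singularities φ ∪ singularities ψ)

/-- The regularized Petersson inner product `⟨φ, ψ⟩` of two `Γ₀(N)`-invariant functions, computed
on the fundamental domain `F`, exists and is equal to `P`: there are finitely many singularities in
`F`, and `P` is the limit for `ε → 0` of the limit for `y → ∞` of the integrals of `φ * conj ψ` over
the punctured domains. -/
def HasRegularizedInnerProduct (F : Set ℍ) (φ ψ : ℍ → ℂ) (P : ℂ) : Prop :=
  (singularPoints F φ ψ).Finite ∧
  ∃ J : ℝ → ℂ,
    (∀ᶠ ε in 𝓝[>] (0 : ℝ),
      (∀ᶠ y in atTop, IntegrableOn (fun τ => φ τ * conj (ψ τ))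
        (puncturedDomain F (singularPoints F φ ψ) ε y) volume) ∧
      Tendsto (fun y : ℝ => ∫ τ in puncturedDomain F (singularPoints F φ ψ) ε y, φ τ * conj (ψ τ))
        atTop (𝓝 (J ε))) ∧
    Tendsto J (𝓝[>] (0 : ℝ)) (𝓝 P)

/-! ### Eisenstein series and their Laurent coefficients at `s = 1` -/

/-- The stabilizer of `∞` in `Γ₀(N)`. -/
def gammaInfty (N : ℕ) : Subgroup (Gamma0 N) :=
  ((MulAction.stabilizer (GL (Fin 2) ℚ) (OnePoint.infty : OnePoint ℚ)).comap
    (Matrix.SpecialLinearGroup.mapGL ℚ)).subgroupOf (Gamma0 N)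

/-- The Eisenstein series `E_{N,k}(τ, s) = ∑ (v^(s - k/2)) ∣[k] γ`, the sum being over
`γ ∈ Γ₀(N)_∞ \ Γ₀(N)`, for even `k` and `Re s > 1`. -/
def eisenstein (N : ℕ) (k : ℤ) (τ : ℍ) (s : ℂ) : ℂ :=
  ∑' c : Quotient (QuotientGroup.rightRel (gammaInfty N)),
    ((fun z : ℍ => (z.im : ℂ) ^ (s - (k : ℂ) / 2)) ∣[k] (c.out : SL(2, ℤ))) τ

/-- The function `Φ`, given on `Re s > 1`, has a meromorphic continuation to a neighborhood of
`s = 1`, with Laurent expansion `∑_{m ≥ -1} a m * (s - 1) ^ m` there. -/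
def HasLaurentExpansionAtOne (Φ : ℂ → ℂ) (a : ℤ → ℂ) : Prop :=
  (∀ m < -1, a m = 0) ∧
  ∃ Ψ : ℂ → ℂ, MeromorphicAt Ψ 1 ∧
    (∀ᶠ s in 𝓝[{s : ℂ | 1 < s.re}] 1, Ψ s = Φ s) ∧
    ∀ᶠ s in 𝓝[≠] (1 : ℂ), HasSum (fun m : ℤ => a m * (s - 1) ^ m) (Ψ s)

open Classical in
/-- The coefficient of `(s - 1) ^ m` in the Laurent expansion at `s = 1` of the meromorphic
continuation of `Φ`; it is used only where such an expansion exists, which is then unique. -/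
def laurentCoeffAtOne (Φ : ℂ → ℂ) (m : ℤ) : ℂ :=
  if h : ∃ a, HasLaurentExpansionAtOne Φ a then h.choose m else 0

/-- The function `g`, the coefficient of `(s - 1) ^ 1` of `E_{N,2}(τ, s)` at `s = 1`. -/
def gFun (N : ℕ) (τ : ℍ) : ℂ := laurentCoeffAtOne (eisenstein N 2 τ) 1

/-- The operator `∂/∂(conj τ) = (∂/∂u + i ∂/∂v) / 2` for `τ = u + i v`. -/
def dbar (φ : ℍ → ℂ) (τ : ℍ) : ℂ :=
  (fderiv ℝ (φ ∘ ofComplex) (τ : ℂ) 1 + Complex.I * fderiv ℝ (φ ∘ ofComplex) (τ : ℂ) Complex.I) / 2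

/-- The operator `ξ_k φ = 2 i v^k conj (∂φ/∂(conj τ))`. -/
def xi (k : ℤ) (φ : ℍ → ℂ) (τ : ℍ) : ℂ :=
  2 * Complex.I * (τ.im : ℂ) ^ k * conj (dbar φ τ)

/-- The `Γ₀(N)`-invariant function `log (v^(k/2) |f|)`. -/
def logNorm (k : ℤ) (f : ℍ → ℂ) (τ : ℍ) : ℂ :=
  ((Real.log (τ.im ^ ((k : ℝ) / 2) * ‖f τ‖) : ℝ) : ℂ)

end Rohrlich

end

noncomputable section

namespace Rohrlich

/-! ### Laurent expansions at `s = 1` -/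

/-! The formula results from integrating the invariant function φ = log(v^(k/2)|f|) over the
fundamental domain against the weight-zero Eisenstein series and letting s tend to 1, where that
series has residue 1/vol. Unfolding turns the integral into ∫ v^(s-2) ∫₀¹ φ(u + iv) du dv. By
Jensen's formula in the disc with coordinate q = exp(2πiτ), the inner integral is (k/2) log v +
log|f(i∞)| + 2π ∑ ord_w(f) (Im w - v), summed over the zeros and poles w of the strip 0 ≤ Re < 1
lying above the line (`integral_log_norm`). Since ∫₀^y v^(s-2) (y - v) dv = y^s / (s(s-1)), the
points of one orbit add up to E_{N,0}(z, s) / (ω_z s(s-1)) (`integral_heightSum`). The divisor of f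
thus reproduces the Eisenstein series, and comparison of the asymptotics at s = 1
(`eq_of_asymptotics`) gives the constant terms; the polar terms give the valence formula.

To keep the limit under control, the series is truncated: only the terms of height at most T are
kept. The truncation does not change the residue (`tendsto_eisTrunc`), it makes s - 1 times the
series bounded uniformly in τ as s decreases to 1 (`exists_bound_eisTrunc`), and it cuts the
unfolded integral at v = T. Dominated convergence then needs only the integrability of φ on the
domain. That holds because log|f| has logarithmic singularities and φ grows at the cusps like log v;
a comparison with finitely many copies of a standard box makes this independent of the shape of the
domain (`exists_lintegral_le`, `integrableOn_logAbs`). Consequently the regularized inner product is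
an ordinary integral. The case φ = 1 identifies the residue with 1/vol (`eisRes_mul_volume`).

The continuation in s is explicit. Cosets correspond to primitive pairs up to sign, hence, after
division by ∑ g^(-2s) over g prime to N, to full lattice sums of q(z)|z|^(-2s) over z = mτ + n + r/N
with m ≠ 0. Here q = 1 in weight 0 and q = conj z / z in weight 2. First-order Euler-Maclaurin
summation in n splits such a sum into a kernel sum holomorphic for Re s > 1/2 and an explicit
multiple of ζ(2s-1) (`hasSum_wFun`). In weight 2 that multiple contains the factor 1 - s, which
cancels the pole (`betaInt_qTwo`).

Finally, the linear coefficient g in weight 2 and the constant term in weight 0 are written in terms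
of kernel sums at s = 1. The weight-two kernel is holomorphic in τ there, and the conjugate
derivative of its s-derivative is i/(2v) times the difference of the weight-zero and weight-two
kernels (`hasWirt_kerSum_kFunDeriv_two`). The weight-two sums cancel in ∂g/∂(conj τ), which becomes
i/(2v²) times the constant term (`hasWirt_gVal`, `xi_gFun`). -/

lemma hasSum_of_forall_eq {ι : Type*} {f g : ι → ℂ} {a : ℂ} (h : HasSum f a)
    (e : ∀ n, g n = f n) : HasSum g a := by
  rwa [funext e]

lemma halfPlane_nhdsWithin_le : 𝓝[{s : ℂ | 1 < s.re}] (1 : ℂ) ≤ 𝓝[≠] 1 :=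
  nhdsWithin_mono _ fun s hs h => by
    simp only [Set.mem_ofPred_eq] at hs
    rw [Set.mem_singleton_iff.mp h] at hs
    simp at hs

instance halfPlane_nhdsWithin_neBot : (𝓝[{s : ℂ | 1 < s.re}] (1 : ℂ)).NeBot := by
  rw [← mem_closure_iff_nhdsWithin_neBot, Complex.closure_setOfPred_lt_re]
  simp

/-- Two meromorphic continuations agree on a half-plane accumulating at 1, so they agree on a
punctured neighbourhood of 1. No exponent is below -1, so s - 1 times the difference of the
expansions is a power series, with a shift of the index by one, and its sum vanishes off the centre.
-/
lemma hasLaurent_unique {Φ : ℂ → ℂ} {a b : ℤ → ℂ} (ha : HasLaurentExpansionAtOne Φ a)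
    (hb : HasLaurentExpansionAtOne Φ b) : a = b := by
  obtain ⟨ha0, Ψ₁, hm₁, he₁, hs₁⟩ := ha
  obtain ⟨hb0, Ψ₂, hm₂, he₂, hs₂⟩ := hb
  have hz : ∀ᶠ s in 𝓝[≠] (1 : ℂ), (Ψ₁ - Ψ₂) s = 0 := by
    rcases (hm₁.sub hm₂).eventually_eq_zero_or_eventually_ne_zero with h | h
    · exact h
    · exfalso
      have h' := halfPlane_nhdsWithin_le h
      obtain ⟨s, h1, h2, h3⟩ := ((he₁.and (he₂.and h')).exists)
      exact h3 (by simp [h1, h2])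
  set d : ℕ → ℂ := fun n => a (n - 1) - b (n - 1) with hd
  set p : FormalMultilinearSeries ℂ ℂ ℂ := FormalMultilinearSeries.ofScalars ℂ d with hp
  have hpc : ∀ n, p.coeff n = d n := fun n => FormalMultilinearSeries.coeff_ofScalars
  -- The sum is known to vanish only off the centre; at s = 1 the series returns its constant
  -- coefficient. The principle of isolated zeros later shows that this value is 0 too.
  set f : ℂ → ℂ := fun s => if s = 1 then d 0 else 0 with hf
  have key : HasFPowerSeriesAt f p 1 := by
    rw [hasFPowerSeriesAt_iff]
    have h1 : ∀ᶠ s in 𝓝[≠] (1 : ℂ), HasSum (fun n : ℕ => (s - 1) ^ n • p.coeff n) (f s) := by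
      filter_upwards [hs₁, hs₂, hz, self_mem_nhdsWithin] with s h1 h2 h3 h4
      have h4' : s - 1 ≠ 0 := sub_ne_zero.mpr h4
      have h5 := (h1.sub h2).mul_left (s - 1)
      have h6 : (s - 1) * (Ψ₁ s - Ψ₂ s) = f s := by
        have : Ψ₁ s - Ψ₂ s = 0 := h3
        simp [hf, show s ≠ 1 from h4, this]
      rw [h6] at h5
      have hinj : Function.Injective (fun n : ℕ => (n : ℤ) - 1) := fun x y h => by
        simpa using h
      rw [← hinj.hasSum_iff] at h5
      · refine hasSum_of_forall_eq h5 fun n => ?_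
        simp only [hpc, hd, Function.comp, smul_eq_mul]
        rw [zpow_sub₀ h4', zpow_natCast, zpow_one]
        field_simp
      · intro m hm
        have : m < -1 := by
          by_contra hcon
          exact hm ⟨(m + 1).toNat, by simp only; omega⟩
        simp [ha0 m this, hb0 m this]
    have h2 : HasSum (fun n : ℕ => ((1 : ℂ) - 1) ^ n • p.coeff n) (f 1) := by
      have := hasSum_single (f := fun n : ℕ => ((1 : ℂ) - 1) ^ n • p.coeff n) 0
        (fun n hn => by simp [hn])
      simpa [hf, hpc] using this
    have h3 : ∀ᶠ s in 𝓝 (1 : ℂ), HasSum (fun n : ℕ => (s - 1) ^ n • p.coeff n) (f s) := by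
      rw [eventually_nhdsWithin_iff] at h1
      filter_upwards [h1] with s hs
      by_cases h : s = 1
      · rw [h]; exact h2
      · exact hs h
    have h4 : Tendsto (fun z : ℂ => 1 + z) (𝓝 0) (𝓝 1) := by
      have : Continuous fun z : ℂ => 1 + z := by fun_prop
      simpa using this.tendsto 0
    filter_upwards [h4.eventually h3] with z hz
    simpa using hz
  have hf0 : f =ᶠ[𝓝 1] 0 := by
    have hev : ∀ᶠ s in 𝓝[≠] (1 : ℂ), f s = 0 := by
      filter_upwards [self_mem_nhdsWithin] with s hs
      simp [hf, show s ≠ 1 from hs]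
    rcases key.analyticAt.eventually_eq_zero_or_eventually_ne_zero with h | h
    · exact h
    · obtain ⟨s, h1, h2⟩ := (hev.and h).exists
      exact absurd h1 h2
  have hp0 : p = 0 := (key.congr hf0).eq_zero
  have hdz : ∀ n, d n = 0 := fun n => by rw [← hpc, hp0]; rfl
  funext m
  by_cases hm : m < -1
  · rw [ha0 m hm, hb0 m hm]
  · have := hdz (m + 1).toNat
    simp only [hd] at this
    rw [show (((m + 1).toNat : ℕ) : ℤ) - 1 = m by omega] at this
    exact sub_eq_zero.mp this

lemma laurentCoeffAtOne_eq {Φ : ℂ → ℂ} {a : ℤ → ℂ} (ha : HasLaurentExpansionAtOne Φ a) (m : ℤ) :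
    laurentCoeffAtOne Φ m = a m := by
  have h : ∃ a, HasLaurentExpansionAtOne Φ a := ⟨a, ha⟩
  rw [laurentCoeffAtOne, dif_pos h, hasLaurent_unique h.choose_spec ha]

lemma exists_hasSum_of_analyticAt {h : ℂ → ℂ} (hh : AnalyticAt ℂ h 1) :
    ∃ a : ℤ → ℂ, (∀ m < 0, a m = 0) ∧ a 0 = h 1 ∧ a 1 = deriv h 1 ∧
      ∀ᶠ s in 𝓝[≠] (1 : ℂ), HasSum (fun m : ℤ => a m * (s - 1) ^ m) (h s) := by
  obtain ⟨p, hp⟩ := hh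
  refine ⟨fun m => if m < 0 then 0 else p.coeff m.toNat, fun m hm => by simp [hm], ?_, ?_, ?_⟩
  · have := hp.coeff_zero (1 : Fin 0 → ℂ)
    simp only [lt_self_iff_false, if_false, Int.toNat_zero]
    exact this
  · have := hp.deriv
    simp only [show ¬ (1 : ℤ) < 0 by norm_num, if_false, Int.toNat_one]
    exact this.symm
  · refine nhdsWithin_le_nhds ?_
    have h4 : Tendsto (fun s : ℂ => s - 1) (𝓝 1) (𝓝 0) := by
      have : Continuous fun s : ℂ => s - 1 := by fun_prop
      simpa using this.tendsto 1
    filter_upwards [h4.eventually (hasFPowerSeriesAt_iff.mp hp)] with s hs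
    have hinj : Function.Injective (fun n : ℕ => (n : ℤ)) := Nat.cast_injective
    rw [← hinj.hasSum_iff]
    · rw [add_sub_cancel] at hs
      refine hasSum_of_forall_eq hs fun n => ?_
      simp [mul_comm]
    · intro m hm
      have : m < 0 := by
        by_contra hcon
        exact hm ⟨m.toNat, by simp only; omega⟩
      simp [this]

lemma exists_hasLaurent_of_analyticAt {Φ h : ℂ → ℂ} (hh : AnalyticAt ℂ h 1)
    (hΦ : ∀ᶠ s in 𝓝[{s : ℂ | 1 < s.re}] 1, h s = Φ s) :
    ∃ a : ℤ → ℂ, HasLaurentExpansionAtOne Φ a ∧ a (-1) = 0 ∧ a 1 = deriv h 1 := by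
  obtain ⟨a, h1, -, h3, h4⟩ := exists_hasSum_of_analyticAt hh
  exact ⟨a, ⟨fun m hm => h1 m (by omega), h, hh.meromorphicAt, hΦ, h4⟩, h1 _ (by norm_num), h3⟩

/-- Division by s - 1 shifts the Taylor coefficients of H by one place, so the residue and the
constant term are a value and a first derivative. -/
lemma exists_hasLaurent_of_pole {Φ H : ℂ → ℂ} (hH : AnalyticAt ℂ H 1)
    (hΦ : ∀ᶠ s in 𝓝[{s : ℂ | 1 < s.re}] 1, H s / (s - 1) = Φ s) :
    ∃ a : ℤ → ℂ, HasLaurentExpansionAtOne Φ a ∧ a (-1) = H 1 ∧ a 0 = deriv H 1 := by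
  obtain ⟨a, h1, h2, h3, h4⟩ := exists_hasSum_of_analyticAt hH
  refine ⟨fun m => a (m + 1), ⟨fun m hm => h1 _ (by omega), fun s => H s / (s - 1), ?_, hΦ, ?_⟩,
    by simpa using h2, by simpa using h3⟩
  · exact hH.meromorphicAt.div (by fun_prop)
  · filter_upwards [h4, self_mem_nhdsWithin] with s hs hne
    have hne' : s - 1 ≠ 0 := sub_ne_zero.mpr hne
    have := hs.div_const (s - 1)
    rw [← (Equiv.addRight (1 : ℤ)).hasSum_iff] at this
    refine hasSum_of_forall_eq this fun m => ?_
    simp only [Function.comp, Equiv.coe_addRight]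
    rw [zpow_add₀ hne', zpow_one]
    field_simp

/-! ### Kernel integrals over a lattice -/

/-- Differentiation under the integral sign for holomorphic integrands with a common bound. -/
lemma hasDerivAt_integral_of_norm_le {X : Type*} [MeasurableSpace X] {μ : Measure X}
    {F F' : ℂ → X → ℂ} {b : X → ℝ} {s₀ : ℂ} {r : ℝ} (hr : 0 < r)
    (hF : ∀ᵐ x ∂μ, ∀ s ∈ Metric.ball s₀ r, HasDerivAt (fun s => F s x) (F' s x) s)
    (hFm : ∀ s, AEStronglyMeasurable (F s) μ) (hFm' : AEStronglyMeasurable (F' s₀) μ)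
    (hb : ∀ᵐ x ∂μ, ∀ s ∈ Metric.ball s₀ r, ‖F s x‖ ≤ b x) (hbi : Integrable b μ) :
    HasDerivAt (fun s => ∫ x, F s x ∂μ) (∫ x, F' s₀ x ∂μ) s₀ := by
  -- Cauchy's estimate on discs of radius r/4 centred in the ball of radius r/2 bounds the
  -- derivative by b / (r/4); these discs stay inside the ball of radius r.
  have hr4 : 0 < r / 4 := by positivity
  refine (hasDerivAt_integral_of_dominated_loc_of_deriv_le (bound := fun x => b x / (r / 4))
    (F' := F') (s := Metric.ball s₀ (r / 2)) (Metric.ball_mem_nhds _ (by positivity))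
    (Eventually.of_forall hFm) ?_ hFm' ?_ (hbi.div_const _) ?_).2
  · refine hbi.mono' (hFm s₀) ?_
    filter_upwards [hb] with x hx using hx s₀ (Metric.mem_ball_self hr)
  · filter_upwards [hF, hb] with x h1 h2 s hs
    have hsub : Metric.closedBall s (r / 4) ⊆ Metric.ball s₀ r := by
      intro z hz
      simp only [Metric.mem_closedBall, Metric.mem_ball] at *
      linarith [dist_triangle z s s₀]
    have hs' : s ∈ Metric.ball s₀ r := hsub (Metric.mem_closedBall_self hr4.le)
    rw [← (h1 s hs').deriv]
    refine Complex.norm_deriv_le_of_forall_mem_sphere_norm_le hr4 ?_ fun z hz =>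
      h2 z (hsub (Metric.sphere_subset_closedBall hz))
    refine DifferentiableOn.diffContOnCl fun z hz => ?_
    rw [closure_ball _ hr4.ne'] at hz
    exact (h1 z (hsub hz)).differentiableAt.differentiableWithinAt
  · filter_upwards [hF] with x h1 s hs
    exact h1 s (Metric.ball_subset_ball (by linarith) hs)

/-- The pairs `(m, n)` with `m ≠ 0`. -/
abbrev LatIdx := {p : ℤ × ℤ // p.1 ≠ 0}

/-- The point `m τ + n + α + t`. -/
def latPt (α : ℝ) (τ : ℂ) (x : LatIdx × ℝ) : ℂ := (x.1.1.1 : ℂ) * τ + (x.1.1.2 : ℂ) + α + x.2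

/-- The product of the counting measure and the Lebesgue measure of the unit interval. -/
def latMeasure : Measure (LatIdx × ℝ) := Measure.count.prod (volume.restrict (Set.Ioc 0 1))

/-- The integral `∑ ∫₀¹ (t - 1) G (m τ + n + α + t) dt`. -/
def kerSum (G : ℂ → ℂ) (α : ℝ) (τ : ℂ) : ℂ :=
  ∫ x, ((x.2 - 1 : ℝ) : ℂ) * G (latPt α τ x) ∂latMeasure

lemma ae_latMeasure : ∀ᵐ x ∂latMeasure, x.2 ∈ Set.Ioc (0 : ℝ) 1 := by
  have h : latMeasure = (Measure.count.prod volume).restrict (Set.univ ×ˢ Set.Ioc (0 : ℝ) 1) := by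
    rw [← Measure.prod_restrict, Measure.restrict_univ, latMeasure]
  rw [h]
  filter_upwards [ae_restrict_mem (MeasurableSet.univ.prod measurableSet_Ioc)] with x hx using hx.2

lemma latPt_im (α : ℝ) (τ : ℂ) (x : LatIdx × ℝ) : (latPt α τ x).im = x.1.1.1 * τ.im := by
  simp [latPt]

lemma latPt_im_ne_zero (α : ℝ) {τ : ℂ} (hτ : 0 < τ.im) (x : LatIdx × ℝ) :
    (latPt α τ x).im ≠ 0 := by
  rw [latPt_im]
  exact mul_ne_zero (Int.cast_ne_zero.mpr x.1.2) hτ.ne'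

lemma abs_mul_im_le_norm_latPt (α : ℝ) {τ : ℂ} (hτ : 0 < τ.im) (x : LatIdx × ℝ) :
    |(x.1.1.1 : ℝ)| * τ.im ≤ ‖latPt α τ x‖ := by
  have := Complex.abs_im_le_norm (latPt α τ x)
  rwa [latPt_im, abs_mul, abs_of_pos hτ] at this

lemma one_le_abs_fst (p : LatIdx) : (1 : ℝ) ≤ |(p.1.1 : ℝ)| := by
  have := Int.one_le_abs p.2
  exact_mod_cast this

lemma one_le_norm_latIdx (p : LatIdx) : 1 ≤ ‖p.1‖ := by
  refine (one_le_abs_fst p).trans ?_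
  rw [Prod.norm_def, Int.norm_eq_abs]
  exact le_max_left _ _

lemma im_le_norm_latPt (α : ℝ) {τ : ℂ} (hτ : 0 < τ.im) (x : LatIdx × ℝ) :
    τ.im ≤ ‖latPt α τ x‖ := by
  refine le_trans ?_ (abs_mul_im_le_norm_latPt α hτ x)
  nlinarith [one_le_abs_fst x.1]

/-- The imaginary part mv of the lattice point controls m, and then n is recovered by subtracting mτ
and the bounded shift α + t. This reduces all convergence questions to sums over ℤ × ℤ. -/
lemma norm_latIdx_le {α : ℝ} (hα : α ∈ Set.Icc (0 : ℝ) 1) {τ : ℂ} (hτ : 0 < τ.im)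
    {x : LatIdx × ℝ} (hx : x.2 ∈ Set.Icc (0 : ℝ) 1) :
    ‖x.1.1‖ ≤ (1 + (‖τ‖ + 3) / τ.im) * ‖latPt α τ x‖ := by
  have h1 := abs_mul_im_le_norm_latPt α hτ x
  have h2 := one_le_abs_fst x.1
  set z := latPt α τ x with hz
  have h3 : |(x.1.1.1 : ℝ)| ≤ ‖z‖ / τ.im := by rwa [le_div_iff₀ hτ]
  have h4 : |(x.1.1.2 : ℝ)| ≤ ‖z‖ + |(x.1.1.1 : ℝ)| * ‖τ‖ + 2 := by
    have e : ((x.1.1.2 : ℝ) : ℂ) = z - ((x.1.1.1 : ℝ) : ℂ) * τ - (α + x.2 : ℝ) := by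
      rw [hz, latPt]; push_cast; ring
    have := norm_sub_le (z - ((x.1.1.1 : ℝ) : ℂ) * τ) ((α + x.2 : ℝ) : ℂ)
    have h5 := norm_sub_le z (((x.1.1.1 : ℝ) : ℂ) * τ)
    rw [norm_mul, Complex.norm_real, Real.norm_eq_abs] at h5
    rw [← e, Complex.norm_real, Complex.norm_real, Real.norm_eq_abs, Real.norm_eq_abs,
      abs_of_nonneg (add_nonneg hα.1 hx.1)] at this
    linarith [hα.2, hx.2]
  have h5 : (1 + (‖τ‖ + 3) / τ.im) * ‖z‖ = ‖z‖ + (‖z‖ / τ.im) * (‖τ‖ + 3) := by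
    field_simp
  have h6 : |(x.1.1.1 : ℝ)| * (‖τ‖ + 3) ≤ (‖z‖ / τ.im) * (‖τ‖ + 3) := by gcongr
  rw [Prod.norm_def, Int.norm_eq_abs, Int.norm_eq_abs, max_le_iff, h5]
  constructor <;> nlinarith [norm_nonneg z, norm_nonneg τ]

/-- The constant of `norm_latIdx_le` is continuous in τ, hence locally bounded; the extra 1 in K is
the room needed for a neighbourhood. Differentiation under the integral sign in τ uses this
uniformity. -/
lemma exists_latPt_bound {α : ℝ} (hα : α ∈ Set.Icc (0 : ℝ) 1) {τ₀ : ℂ} (hτ₀ : 0 < τ₀.im) :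
    ∃ K > 0, ∀ᶠ τ in 𝓝 τ₀, 0 < τ.im ∧ τ₀.im / 2 ≤ τ.im ∧ ∀ x : LatIdx × ℝ,
      x.2 ∈ Set.Icc (0 : ℝ) 1 → τ₀.im / 2 ≤ ‖latPt α τ x‖ ∧ ‖x.1.1‖ ≤ K * ‖latPt α τ x‖ := by
  have hc : ContinuousAt (fun τ : ℂ => 1 + (‖τ‖ + 3) / τ.im) τ₀ := by
    refine continuousAt_const.add (ContinuousAt.div ?_ ?_ hτ₀.ne')
    · fun_prop
    · exact Complex.continuous_im.continuousAt
  refine ⟨1 + (‖τ₀‖ + 3) / τ₀.im + 1, by positivity, ?_⟩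
  filter_upwards [hc.eventually_lt_const (lt_add_one _),
    Complex.continuous_im.continuousAt.eventually_const_lt (half_lt_self hτ₀)] with τ h1 h2
  have h3 : 0 < τ.im := by linarith
  refine ⟨h3, h2.le, fun x hx => ⟨h2.le.trans (im_le_norm_latPt α h3 x), ?_⟩⟩
  refine (norm_latIdx_le hα h3 hx).trans ?_
  gcongr

lemma summable_norm_latIdx {a : ℝ} (ha : 2 < a) : Summable fun p : LatIdx => ‖p.1‖ ^ (-a) := by
  have h := EisensteinSeries.summable_one_div_norm_rpow ha
  rw [← (finTwoArrowEquiv ℤ).symm.summable_iff] at h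
  have h2 : Summable fun p : ℤ × ℤ => ‖p‖ ^ (-a) := by
    refine h.congr fun p => ?_
    simp only [Function.comp, finTwoArrowEquiv_symm_apply]
    congr 1
    rw [EisensteinSeries.norm_eq_max_natAbs, Prod.norm_def, Int.norm_eq_abs, Int.norm_eq_abs]
    simp
  exact h2.comp_injective Subtype.val_injective

lemma integrable_norm_latIdx {a : ℝ} (ha : 2 < a) :
    Integrable (fun x : LatIdx × ℝ => ‖x.1.1‖ ^ (-a)) latMeasure := by
  refine Integrable.comp_fst (f := fun p : LatIdx => ‖p.1‖ ^ (-a)) ?_ _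
  rw [integrable_count_iff]
  exact (summable_norm_latIdx ha).norm

lemma norm_rpow_neg_le {K a : ℝ} (hK : 0 < K) (ha : 0 ≤ a) {p : LatIdx} {z : ℂ}
    (h : ‖p.1‖ ≤ K * ‖z‖) : ‖z‖ ^ (-a) ≤ K ^ a * ‖p.1‖ ^ (-a) := by
  have h1 := one_le_norm_latIdx p
  have h2 : ‖p.1‖ / K ≤ ‖z‖ := by rwa [div_le_iff₀' hK]
  calc ‖z‖ ^ (-a) ≤ (‖p.1‖ / K) ^ (-a) :=
        Real.rpow_le_rpow_of_nonpos (by positivity) h2 (by linarith)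
    _ = K ^ a * ‖p.1‖ ^ (-a) := by
        rw [Real.div_rpow (norm_nonneg _) hK.le, Real.rpow_neg hK.le]
        field_simp

lemma continuous_latPt (α : ℝ) (τ : ℂ) : Continuous (latPt α τ) := by
  unfold latPt
  have h1 : Continuous fun x : LatIdx × ℝ => ((x.1.1.1 : ℂ)) :=
    (continuous_of_discreteTopology (f := fun p : LatIdx => (p.1.1 : ℂ))).comp continuous_fst
  have h2 : Continuous fun x : LatIdx × ℝ => ((x.1.1.2 : ℂ)) :=
    (continuous_of_discreteTopology (f := fun p : LatIdx => (p.1.2 : ℂ))).comp continuous_fst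
  fun_prop

lemma continuous_kernel {E : Type*} [TopologicalSpace E] {G : ℂ → E}
    (hG : ContinuousOn G {z | z.im ≠ 0}) (α : ℝ) {τ : ℂ} (hτ : 0 < τ.im) :
    Continuous fun x => G (latPt α τ x) :=
  hG.comp_continuous (continuous_latPt α τ) fun x => latPt_im_ne_zero α hτ x

instance : OpensMeasurableSpace (LatIdx × ℝ) := Prod.opensMeasurableSpace

lemma aestronglyMeasurable_kernel {G : ℂ → ℂ} (hG : ContinuousOn G {z | z.im ≠ 0}) (α : ℝ) {τ : ℂ}
    (hτ : 0 < τ.im) :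
    AEStronglyMeasurable (fun x => ((x.2 - 1 : ℝ) : ℂ) * G (latPt α τ x)) latMeasure := by
  refine Continuous.aestronglyMeasurable ?_
  exact (Complex.continuous_ofReal.comp (continuous_snd.sub continuous_const)).mul
    (continuous_kernel hG α hτ)

lemma norm_sub_one_le {t : ℝ} (ht : t ∈ Set.Ioc (0 : ℝ) 1) : ‖((t - 1 : ℝ) : ℂ)‖ ≤ 1 := by
  rw [Complex.norm_real, Real.norm_eq_abs, abs_le]
  constructor <;> linarith [ht.1, ht.2]

/-- `G` decays like `|z| ^ (-a)` away from the origin. -/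
def DecaysWith (a : ℝ) {E : Type*} [Norm E] (G : ℂ → E) : Prop :=
  ∀ δ > 0, ∃ C ≥ 0, ∀ z : ℂ, δ ≤ ‖z‖ → z.im ≠ 0 → ‖G z‖ ≤ C * ‖z‖ ^ (-a)

lemma integrable_kernel {a : ℝ} (ha : 2 < a) {G : ℂ → ℂ} (hG : ContinuousOn G {z | z.im ≠ 0})
    (hd : DecaysWith a G) {α : ℝ} (hα : α ∈ Set.Icc (0 : ℝ) 1) {τ : ℂ} (hτ : 0 < τ.im) :
    Integrable (fun x => ((x.2 - 1 : ℝ) : ℂ) * G (latPt α τ x)) latMeasure := by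
  obtain ⟨K, hK, hKe⟩ := exists_latPt_bound hα hτ
  obtain ⟨C, hC, hCb⟩ := hd _ (half_pos hτ)
  refine ((integrable_norm_latIdx ha).const_mul (C * K ^ a)).mono'
    (aestronglyMeasurable_kernel hG α hτ) ?_
  filter_upwards [ae_latMeasure] with x hx
  obtain ⟨h1, h2⟩ := hKe.self_of_nhds.2.2 x ⟨hx.1.le, hx.2⟩
  rw [norm_mul]
  calc _ ≤ 1 * (C * ‖latPt α τ x‖ ^ (-a)) := by
        gcongr
        · exact norm_sub_one_le hx
        · exact hCb _ h1 (latPt_im_ne_zero α hτ x)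
    _ ≤ 1 * (C * (K ^ a * ‖x.1.1‖ ^ (-a))) := by
        gcongr
        exact norm_rpow_neg_le hK (by linarith) h2
    _ = _ := by ring

/-- Real differentiability of kernel integrals in `τ`, with the resulting value of `∂/∂(conj τ)`. -/
lemma hasFDerivAt_kerSum {a b : ℝ} (ha : 2 < a) (hb : 3 < b) {G : ℂ → ℂ} {G' : ℂ → ℂ →L[ℝ] ℂ}
    (hG : ∀ z : ℂ, z.im ≠ 0 → HasFDerivAt G (G' z) z) (hG' : ContinuousOn G' {z | z.im ≠ 0})
    (hd : DecaysWith a G) (hd' : DecaysWith b G') {α : ℝ} (hα : α ∈ Set.Icc (0 : ℝ) 1) {τ₀ : ℂ}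
    (hτ₀ : 0 < τ₀.im) :
    ∃ L : ℂ →L[ℝ] ℂ, HasFDerivAt (kerSum G α) L τ₀ ∧
      L 1 + Complex.I * L Complex.I =
        ∫ x, ((x.2 - 1 : ℝ) : ℂ) * (x.1.1.1 * (G' (latPt α τ₀ x) 1 +
          Complex.I * G' (latPt α τ₀ x) Complex.I)) ∂latMeasure := by
  have hGc : ContinuousOn G {z | z.im ≠ 0} := fun z hz =>
    (hG z hz).continuousAt.continuousWithinAt
  obtain ⟨K, hK, hKe⟩ := exists_latPt_bound hα hτ₀
  obtain ⟨C, hC, hCb⟩ := hd' _ (half_pos hτ₀)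
  set F' : ℂ → LatIdx × ℝ → ℂ →L[ℝ] ℂ := fun τ x =>
    (((x.2 - 1) * x.1.1.1 : ℝ)) • G' (latPt α τ x) with hF'
  have hm : AEStronglyMeasurable (F' τ₀) latMeasure := by
    refine Continuous.aestronglyMeasurable ?_
    have h1 := continuous_kernel hG' α hτ₀
    have h2 : Continuous fun x : LatIdx × ℝ => ((x.1.1.1 : ℝ)) :=
      (continuous_of_discreteTopology (f := fun p : LatIdx => (p.1.1 : ℝ))).comp continuous_fst
    exact ((continuous_snd.sub continuous_const).mul h2).smul h1
  -- The chain rule produces a factor m, which is at most a multiple of |z| and so costs one power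
  -- of decay. Hence the derivative must decay with an exponent above 3, while 2 suffices for the
  -- function.
  have hbd : ∀ᵐ x ∂latMeasure, ∀ τ ∈ {τ : ℂ | 0 < τ.im ∧ τ₀.im / 2 ≤ τ.im ∧ ∀ x : LatIdx × ℝ,
      x.2 ∈ Set.Icc (0 : ℝ) 1 → τ₀.im / 2 ≤ ‖latPt α τ x‖ ∧ ‖x.1.1‖ ≤ K * ‖latPt α τ x‖},
      ‖F' τ x‖ ≤ C / (τ₀.im / 2) * K ^ (b - 1) * ‖x.1.1‖ ^ (-(b - 1)) := by
    filter_upwards [ae_latMeasure] with x hx τ hτ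
    obtain ⟨h1, h2⟩ := hτ.2.2 x ⟨hx.1.le, hx.2⟩
    have h0 : 0 < ‖latPt α τ x‖ := lt_of_lt_of_le (half_pos hτ₀) h1
    have h3 : |(x.1.1.1 : ℝ)| ≤ ‖latPt α τ x‖ / (τ₀.im / 2) := by
      rw [le_div_iff₀ (half_pos hτ₀)]
      refine le_trans ?_ (abs_mul_im_le_norm_latPt α hτ.1 x)
      gcongr
      exact hτ.2.1
    simp only [hF']
    rw [norm_smul, norm_mul]
    have h4 : ‖x.2 - 1‖ ≤ 1 := by
      rw [Real.norm_eq_abs, abs_le]; constructor <;> linarith [hx.1, hx.2]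
    calc _ ≤ 1 * (‖latPt α τ x‖ / (τ₀.im / 2)) * (C * ‖latPt α τ x‖ ^ (-b)) := by
          gcongr
          · exact h3
          · exact hCb _ h1 (latPt_im_ne_zero α hτ.1 x)
      _ = C / (τ₀.im / 2) * ‖latPt α τ x‖ ^ (-(b - 1)) := by
          rw [show -(b - 1) = 1 + -b by ring, Real.rpow_add h0, Real.rpow_one]
          ring
      _ ≤ C / (τ₀.im / 2) * (K ^ (b - 1) * ‖x.1.1‖ ^ (-(b - 1))) := by
          gcongr
          exact norm_rpow_neg_le hK (by linarith) h2
      _ = _ := by ring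
  have hbi := (integrable_norm_latIdx (a := b - 1) (by linarith)).const_mul
    (C / (τ₀.im / 2) * K ^ (b - 1))
  have hF'i : Integrable (F' τ₀) latMeasure := hbi.mono' hm (by
    filter_upwards [hbd] with x hx using hx τ₀ hKe.self_of_nhds)
  have hmain : HasFDerivAt (kerSum G α) (∫ x, F' τ₀ x ∂latMeasure) τ₀ := by
    refine hasFDerivAt_integral_of_dominated_of_fderiv_le hKe ?_ ?_ hm hbd hbi ?_
    · filter_upwards [hKe] with τ hτ using aestronglyMeasurable_kernel hGc α hτ.1
    · exact integrable_kernel ha hGc hd hα hτ₀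
    · refine Eventually.of_forall fun x τ hτ => ?_
      have h1 : HasFDerivAt (fun τ => latPt α τ x)
          ((x.1.1.1 : ℝ) • ContinuousLinearMap.id ℝ ℂ) τ := by
        have : (fun τ => latPt α τ x) =
            fun τ => (x.1.1.1 : ℝ) • τ + ((x.1.1.2 : ℂ) + α + x.2) := by
          funext τ; simp [latPt]; ring
        rw [this]
        exact ((hasFDerivAt_id τ).const_smul (x.1.1.1 : ℝ)).add_const _
      have h2 := ((hG _ (latPt_im_ne_zero α hτ.1 x)).comp τ h1).const_mul ((x.2 - 1 : ℝ) : ℂ)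
      refine h2.congr_fderiv (ContinuousLinearMap.ext fun z => ?_)
      change ((x.2 - 1 : ℝ) : ℂ) * G' (latPt α τ x) ((x.1.1.1 : ℝ) • z) =
        ((x.2 - 1) * x.1.1.1 : ℝ) • G' (latPt α τ x) z
      rw [map_smul, Complex.real_smul, Complex.real_smul]
      push_cast
      ring
  refine ⟨_, hmain, ?_⟩
  have happ : ∀ v : ℂ, (∫ x, F' τ₀ x ∂latMeasure) v = ∫ x, F' τ₀ x v ∂latMeasure := fun v =>
    ContinuousLinearMap.integral_apply hF'i v
  rw [happ, happ, ← integral_const_mul, ← integral_add (hF'i.apply_continuousLinearMap _)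
    ((hF'i.apply_continuousLinearMap _).const_mul _)]
  refine integral_congr_ae (Eventually.of_forall fun x => ?_)
  simp [hF']
  ring

/-! ### Homogeneous summands -/

/-- `|z| ^ (-2 s)`. -/
def normPow (s z : ℂ) : ℂ := Complex.exp (-2 * s * Real.log ‖z‖)

/-- `q` is homogeneous of degree zero, and `A` is its derivative in the real direction. -/
structure IsAngularFactor (q A : ℂ → ℂ) : Prop where
  norm_le : ∀ z, ‖q z‖ ≤ 1
  real_mul : ∀ r : ℝ, r ≠ 0 → ∀ z, q (r * z) = q z
  hasDerivAt : ∀ z : ℂ, z.im ≠ 0 → ∀ t : ℝ, HasDerivAt (fun t : ℝ => q (z + t)) (A (z + t)) t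
  continuousOn : ContinuousOn q {z | z.im ≠ 0}
  continuousOn_deriv : ContinuousOn A {z | z.im ≠ 0}
  norm_deriv_le : ∀ z, ‖A z‖ ≤ 2 * ‖z‖⁻¹

/-- The summand `q z * |z| ^ (-2 s)`. -/
def wFun (q : ℂ → ℂ) (s z : ℂ) : ℂ := q z * normPow s z

/-- The derivative of `wFun q s` in the real direction. -/
def kFun (q A : ℂ → ℂ) (s z : ℂ) : ℂ :=
  normPow s z * (A z - s * (q z * (z⁻¹ + (conj z)⁻¹)))

/-- The derivative of `kFun q A s` in `s`. -/
def kFunDeriv (q A : ℂ → ℂ) (s z : ℂ) : ℂ :=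
  normPow s z * (-(q z * (z⁻¹ + (conj z)⁻¹)) -
    2 * Real.log ‖z‖ * (A z - s * (q z * (z⁻¹ + (conj z)⁻¹))))

lemma norm_normPow (s : ℂ) {z : ℂ} (hz : z ≠ 0) : ‖normPow s z‖ = ‖z‖ ^ (-(2 * s.re)) := by
  rw [normPow, Complex.norm_exp, Real.rpow_def_of_pos (norm_pos_iff.mpr hz)]
  congr 1
  simp [Complex.mul_re]
  ring

lemma normPow_real_mul (s : ℂ) {r : ℝ} (hr : r ≠ 0) {z : ℂ} (hz : z ≠ 0) :
    normPow s (r * z) = Complex.exp (-2 * s * Real.log |r|) * normPow s z := by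
  rw [normPow, normPow, ← Complex.exp_add, norm_mul, Complex.norm_real, Real.norm_eq_abs,
    Real.log_mul (abs_ne_zero.mpr hr) (norm_ne_zero_iff.mpr hz)]
  push_cast
  ring_nf

lemma ne_zero_of_im_ne_zero {z : ℂ} (hz : z.im ≠ 0) : z ≠ 0 := by
  rintro rfl
  simp at hz

lemma continuousOn_normPow (s : ℂ) : ContinuousOn (normPow s) {z | z.im ≠ 0} := by
  intro z hz
  have h0 : ‖z‖ ≠ 0 := norm_ne_zero_iff.mpr (ne_zero_of_im_ne_zero hz)
  refine ContinuousAt.continuousWithinAt ?_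
  have h1 : ContinuousAt (fun z : ℂ => Real.log ‖z‖) z := continuous_norm.continuousAt.log h0
  unfold normPow
  exact (continuousAt_const.mul (Complex.continuous_ofReal.continuousAt.comp h1)).cexp

lemma hasDerivAt_log_norm {z : ℂ} (hz : z.im ≠ 0) (t : ℝ) :
    HasDerivAt (fun t : ℝ => ((2 * Real.log ‖z + t‖ : ℝ) : ℂ)) ((z + t)⁻¹ + (conj (z + t))⁻¹) t := by
  have hN : ∀ t : ℝ, 2 * Real.log ‖z + t‖ = Real.log ((z.re + t) ^ 2 + z.im ^ 2) := by
    intro t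
    have : ‖z + t‖ ^ 2 = (z.re + t) ^ 2 + z.im ^ 2 := by
      rw [← Complex.normSq_eq_norm_sq, Complex.normSq_apply]
      simp; ring
    rw [← this, Real.log_pow]
    norm_num
  simp only [hN]
  have hp : 0 < (z.re + t) ^ 2 + z.im ^ 2 := by positivity
  have h1 : HasDerivAt (fun t : ℝ => (z.re + t) ^ 2 + z.im ^ 2) (2 * (z.re + t)) t := by
    have := (((hasDerivAt_id t).const_add z.re).pow 2).add_const (z.im ^ 2)
    simpa using! this
  have h2 := (h1.log hp.ne').ofReal_comp
  convert h2 using 1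
  have h3 : (z + t) ≠ 0 := by
    apply ne_zero_of_im_ne_zero; simpa using hz
  have h4 : conj (z + t) ≠ 0 := (map_ne_zero _).mpr h3
  have h5 : (z + t) * conj (z + t) = (((z.re + t) ^ 2 + z.im ^ 2 : ℝ) : ℂ) := by
    rw [Complex.mul_conj, Complex.normSq_apply]; simp; ring
  have h6 : (z + t) + conj (z + t) = ((2 * (z.re + t) : ℝ) : ℂ) := by
    rw [Complex.add_conj]; simp
  rw [Complex.ofReal_div, ← h5, ← h6]
  field_simp
  ring

lemma hasDerivAt_normPow (s : ℂ) {z : ℂ} (hz : z.im ≠ 0) (t : ℝ) :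
    HasDerivAt (fun t : ℝ => normPow s (z + t))
      (normPow s (z + t) * (-s * ((z + t)⁻¹ + (conj (z + t))⁻¹))) t := by
  have h := ((hasDerivAt_log_norm hz t).const_mul (-s)).cexp
  have e : ∀ t : ℝ, normPow s (z + t) = Complex.exp (-s * ((2 * Real.log ‖z + t‖ : ℝ) : ℂ)) := by
    intro t; rw [normPow]; push_cast; ring_nf
  simp only [e]
  exact h

variable {q A : ℂ → ℂ}

lemma hasDerivAt_wFun (hq : IsAngularFactor q A) (s : ℂ) {z : ℂ} (hz : z.im ≠ 0) (t : ℝ) :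
    HasDerivAt (fun t : ℝ => wFun q s (z + t)) (kFun q A s (z + t)) t := by
  have h := (hq.hasDerivAt z hz t).mul (hasDerivAt_normPow s hz t)
  refine h.congr_deriv ?_
  rw [kFun]
  ring

lemma continuousOn_wFun (hq : IsAngularFactor q A) (s : ℂ) :
    ContinuousOn (wFun q s) {z | z.im ≠ 0} :=
  hq.continuousOn.mul (continuousOn_normPow s)

lemma continuousOn_inv_add_conj_inv :
    ContinuousOn (fun z : ℂ => z⁻¹ + (conj z)⁻¹) {z | z.im ≠ 0} := by
  intro z hz
  have h0 := ne_zero_of_im_ne_zero hz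
  refine ContinuousAt.continuousWithinAt ?_
  exact (continuousAt_inv₀ h0).add (Complex.continuous_conj.continuousAt.inv₀ (by simpa using h0))

lemma continuousOn_kFun (hq : IsAngularFactor q A) (s : ℂ) :
    ContinuousOn (kFun q A s) {z | z.im ≠ 0} :=
  (continuousOn_normPow s).mul (hq.continuousOn_deriv.sub
    (continuousOn_const.mul (hq.continuousOn.mul continuousOn_inv_add_conj_inv)))

lemma continuousOn_kFunDeriv (hq : IsAngularFactor q A) (s : ℂ) :
    ContinuousOn (kFunDeriv q A s) {z | z.im ≠ 0} := by
  have hl : ContinuousOn (fun z : ℂ => (2 * Real.log ‖z‖ : ℂ)) {z | z.im ≠ 0} := by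
    intro z hz
    have h0 : ‖z‖ ≠ 0 := norm_ne_zero_iff.mpr (ne_zero_of_im_ne_zero hz)
    refine ContinuousAt.continuousWithinAt ?_
    exact continuousAt_const.mul (Complex.continuous_ofReal.continuousAt.comp
      (continuous_norm.continuousAt.log h0))
  have h1 := hq.continuousOn.mul continuousOn_inv_add_conj_inv
  exact (continuousOn_normPow s).mul (h1.neg.sub
    (hl.mul (hq.continuousOn_deriv.sub (continuousOn_const.mul h1))))

lemma norm_inv_add_conj_inv_le (z : ℂ) : ‖z⁻¹ + (conj z)⁻¹‖ ≤ 2 * ‖z‖⁻¹ := by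
  refine (norm_add_le _ _).trans ?_
  rw [norm_inv, norm_inv, RCLike.norm_conj]
  linarith

/-- Differentiating a homogeneous function lowers its degree by one. This single extra power of
decay moves convergence over the lattice from Re s > 1 to Re s > 1/2. -/
lemma norm_kFun_le (hq : IsAngularFactor q A) (s : ℂ) {z : ℂ} (hz : z ≠ 0) :
    ‖kFun q A s z‖ ≤ (2 + 2 * ‖s‖) * ‖z‖ ^ (-(2 * s.re + 1)) := by
  have h0 : 0 < ‖z‖ := norm_pos_iff.mpr hz
  rw [kFun, norm_mul, norm_normPow s hz, neg_add, Real.rpow_add h0, Real.rpow_neg_one]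
  have h1 : ‖A z - s * (q z * (z⁻¹ + (conj z)⁻¹))‖ ≤ 2 * ‖z‖⁻¹ + ‖s‖ * (1 * (2 * ‖z‖⁻¹)) := by
    refine (norm_sub_le _ _).trans ?_
    rw [norm_mul, norm_mul]
    gcongr
    · exact hq.norm_deriv_le z
    · exact hq.norm_le z
    · exact norm_inv_add_conj_inv_le z
  calc _ ≤ ‖z‖ ^ (-(2 * s.re)) * (2 * ‖z‖⁻¹ + ‖s‖ * (1 * (2 * ‖z‖⁻¹))) := by gcongr
    _ = _ := by ring

lemma rpow_neg_le_of_le {δ x e E : ℝ} (hδ : 0 < δ) (hx : δ ≤ x) (he : 0 ≤ e) (hE : e ≤ E) :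
    x ^ (-e) ≤ (max 1 δ⁻¹) ^ E := by
  have hx0 : 0 < x := hδ.trans_le hx
  have h1 : x⁻¹ ≤ max 1 δ⁻¹ := (inv_anti₀ hδ hx).trans (le_max_right _ _)
  rw [Real.rpow_neg hx0.le, ← Real.inv_rpow hx0.le]
  calc x⁻¹ ^ e ≤ (max 1 δ⁻¹) ^ e := Real.rpow_le_rpow (by positivity) h1 he
    _ ≤ _ := Real.rpow_le_rpow_of_exponent_le (le_max_left _ _) hE

lemma norm_wFun_le (hq : IsAngularFactor q A) (s : ℂ) {z : ℂ} (hz : z ≠ 0) :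
    ‖wFun q s z‖ ≤ ‖z‖ ^ (-(2 * s.re)) := by
  rw [wFun, norm_mul, norm_normPow s hz]
  have := hq.norm_le z
  have h2 : 0 ≤ ‖z‖ ^ (-(2 * s.re)) := by positivity
  nlinarith

lemma decaysWith_kFun (hq : IsAngularFactor q A) (s : ℂ) :
    DecaysWith (2 * s.re + 1) (kFun q A s) := fun _ _ =>
  ⟨2 + 2 * ‖s‖, by positivity, fun _ _ hz => norm_kFun_le hq s (ne_zero_of_im_ne_zero hz)⟩

lemma hasDerivAt_kFun (s z : ℂ) :
    HasDerivAt (fun s => kFun q A s z) (kFunDeriv q A s z) s := by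
  have h1 : HasDerivAt (fun s : ℂ => normPow s z) (normPow s z * (-2 * Real.log ‖z‖)) s := by
    have := (((hasDerivAt_id s).const_mul (-2)).mul_const (Real.log ‖z‖ : ℂ)).cexp
    simpa [normPow] using! this
  have h2 : HasDerivAt (fun s : ℂ => A z - s * (q z * (z⁻¹ + (conj z)⁻¹)))
      (-(q z * (z⁻¹ + (conj z)⁻¹))) s := by
    have := ((hasDerivAt_id s).mul_const (q z * (z⁻¹ + (conj z)⁻¹))).const_sub (A z)
    simpa using! this
  refine (h1.mul h2).congr_deriv ?_
  rw [kFunDeriv]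
  ring

/-- With r half the distance from s₀ to the line Re s = 1/2, all exponents on the ball exceed 2σ₁ +
1 > 2. The surplus exponent lies between 0 and 4r and is absorbed into the constant M, since the
lattice points stay away from 0 although their norm may be below 1. -/
lemma hasDerivAt_kerSum_kFun (hq : IsAngularFactor q A) {α : ℝ} (hα : α ∈ Set.Icc (0 : ℝ) 1) {τ : ℂ}
    (hτ : 0 < τ.im) {s₀ : ℂ} (hs₀ : 1 / 2 < s₀.re) :
    HasDerivAt (fun s => kerSum (kFun q A s) α τ) (kerSum (kFunDeriv q A s₀) α τ) s₀ := by
  obtain ⟨K, hK, hKe⟩ := exists_latPt_bound hα hτ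
  set r : ℝ := (s₀.re - 1 / 2) / 2 with hr
  have hr0 : 0 < r := by rw [hr]; linarith
  set σ₁ : ℝ := s₀.re - r with hσ₁
  have hσ : 1 / 2 < σ₁ := by rw [hσ₁, hr]; linarith
  set M : ℝ := (2 + 2 * (‖s₀‖ + r)) * (max 1 (τ.im / 2)⁻¹) ^ (4 * r) with hM
  refine hasDerivAt_integral_of_norm_le (F := fun s x => ((x.2 - 1 : ℝ) : ℂ) *
    kFun q A s (latPt α τ x)) (F' := fun s x => ((x.2 - 1 : ℝ) : ℂ) *
    kFunDeriv q A s (latPt α τ x)) hr0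
    (b := fun x => M * (K ^ (2 * σ₁ + 1) * ‖x.1.1‖ ^ (-(2 * σ₁ + 1)))) ?_
    (fun s => aestronglyMeasurable_kernel (continuousOn_kFun hq s) α hτ)
    (aestronglyMeasurable_kernel (continuousOn_kFunDeriv hq s₀) α hτ) ?_
    (((integrable_norm_latIdx (by linarith)).const_mul _).const_mul _)
  · exact Eventually.of_forall fun x s _ => (hasDerivAt_kFun s _).const_mul _
  · filter_upwards [ae_latMeasure] with x hx s hs
    obtain ⟨h1, h2⟩ := hKe.self_of_nhds.2.2 x ⟨hx.1.le, hx.2⟩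
    have hz0 : latPt α τ x ≠ 0 := ne_zero_of_im_ne_zero (latPt_im_ne_zero α hτ x)
    have hzp : 0 < ‖latPt α τ x‖ := norm_pos_iff.mpr hz0
    rw [Metric.mem_ball, dist_eq_norm] at hs
    have hre : |s.re - s₀.re| < r := by
      have := Complex.abs_re_le_norm (s - s₀)
      rw [Complex.sub_re] at this
      linarith
    have hsn : ‖s‖ ≤ ‖s₀‖ + r := by
      have := norm_add_le s₀ (s - s₀)
      rw [add_sub_cancel] at this
      linarith
    rw [abs_lt] at hre
    rw [norm_mul]
    calc _ ≤ 1 * ((2 + 2 * ‖s‖) * ‖latPt α τ x‖ ^ (-(2 * s.re + 1))) := by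
          gcongr
          · exact norm_sub_one_le hx
          · exact norm_kFun_le hq s hz0
      _ = (2 + 2 * ‖s‖) * (‖latPt α τ x‖ ^ (-(2 * (s.re - σ₁))) *
            ‖latPt α τ x‖ ^ (-(2 * σ₁ + 1))) := by
          rw [← Real.rpow_add hzp, one_mul]
          congr 2
          ring
      _ ≤ (2 + 2 * (‖s₀‖ + r)) * ((max 1 (τ.im / 2)⁻¹) ^ (4 * r) *
            (K ^ (2 * σ₁ + 1) * ‖x.1.1‖ ^ (-(2 * σ₁ + 1)))) := by
          gcongr
          · exact rpow_neg_le_of_le (half_pos hτ) h1 (by rw [hσ₁]; linarith) (by rw [hσ₁]; linarith)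
          · exact norm_rpow_neg_le hK (by linarith) h2
      _ = _ := by rw [hM]; ring

/-! ### The integral over the real line -/

/-- `∫ q (x + i) |x + i| ^ (-2 s) dx`. -/
def betaInt (q : ℂ → ℂ) (s : ℂ) : ℂ := ∫ x : ℝ, wFun q s (Complex.I + x)

lemma norm_I_add_real (x : ℝ) : ‖Complex.I + x‖ = (1 + x ^ 2) ^ (1 / 2 : ℝ) := by
  rw [← Real.sqrt_eq_rpow, Complex.norm_def, Complex.normSq_apply]
  simp
  ring_nf

lemma norm_I_add_real_rpow (x e : ℝ) : ‖Complex.I + x‖ ^ (-e) = (1 + ‖x‖ ^ 2) ^ (-e / 2) := by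
  rw [norm_I_add_real, ← Real.rpow_mul (by positivity), Real.norm_eq_abs, sq_abs]
  ring_nf

lemma I_add_real_im (x : ℝ) : (Complex.I + x).im ≠ 0 := by simp

lemma integrable_norm_I_add_real {e : ℝ} (he : 1 < e) :
    Integrable fun x : ℝ => ‖Complex.I + x‖ ^ (-e) := by
  simp only [norm_I_add_real_rpow]
  exact integrable_rpow_neg_one_add_norm_sq (by simpa using he)

lemma aestronglyMeasurable_wFun_I (hq : IsAngularFactor q A) (s : ℂ) :
    AEStronglyMeasurable (fun x : ℝ => wFun q s (Complex.I + x)) volume :=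
  ((continuousOn_wFun hq s).comp_continuous (by fun_prop) I_add_real_im).aestronglyMeasurable

lemma integrable_wFun_I (hq : IsAngularFactor q A) {s : ℂ} (hs : 1 / 2 < s.re) :
    Integrable fun x : ℝ => wFun q s (Complex.I + x) := by
  refine (integrable_norm_I_add_real (e := 2 * s.re) (by linarith)).mono'
    (aestronglyMeasurable_wFun_I hq s) (Eventually.of_forall fun x => ?_)
  exact norm_wFun_le hq s (ne_zero_of_im_ne_zero (I_add_real_im x))

lemma one_le_norm_I_add_real (x : ℝ) : 1 ≤ ‖Complex.I + x‖ := by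
  have := Complex.abs_im_le_norm (Complex.I + x)
  simpa using this

lemma differentiableAt_betaInt (hq : IsAngularFactor q A) {s₀ : ℂ} (hs₀ : 1 / 2 < s₀.re) :
    DifferentiableAt ℂ (betaInt q) s₀ := by
  set r : ℝ := (s₀.re - 1 / 2) / 2 with hr
  have hr0 : 0 < r := by rw [hr]; linarith
  set σ₁ : ℝ := s₀.re - r with hσ₁
  have hσ : 1 / 2 < σ₁ := by rw [hσ₁, hr]; linarith
  refine (hasDerivAt_integral_of_norm_le (F := fun s (x : ℝ) => wFun q s (Complex.I + x))
    (F' := fun s (x : ℝ) => wFun q s (Complex.I + x) * (-2 * Real.log ‖Complex.I + x‖)) hr0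
    (b := fun x : ℝ => ‖Complex.I + x‖ ^ (-(2 * σ₁))) ?_ (aestronglyMeasurable_wFun_I hq) ?_ ?_
    (integrable_norm_I_add_real (by linarith))).differentiableAt
  · refine Eventually.of_forall fun x s _ => ?_
    have := ((((hasDerivAt_id s).const_mul (-2)).mul_const
      (Real.log ‖Complex.I + x‖ : ℂ)).cexp).const_mul (q (Complex.I + x))
    refine this.congr_deriv ?_
    simp [wFun, normPow]
    ring
  · refine (aestronglyMeasurable_wFun_I hq s₀).mul ?_
    refine Continuous.aestronglyMeasurable ?_
    have : Continuous fun x : ℝ => Real.log ‖Complex.I + x‖ :=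
      Continuous.log (by fun_prop) fun x =>
        norm_ne_zero_iff.mpr (ne_zero_of_im_ne_zero (I_add_real_im x))
    fun_prop
  · refine Eventually.of_forall fun x s hs => ?_
    refine (norm_wFun_le hq s (ne_zero_of_im_ne_zero (I_add_real_im x))).trans ?_
    refine Real.rpow_le_rpow_of_exponent_le (one_le_norm_I_add_real x) ?_
    rw [Metric.mem_ball, dist_eq_norm] at hs
    have := (abs_lt.mp ((Complex.abs_re_le_norm (s - s₀)).trans_lt hs)).1
    rw [Complex.sub_re] at this
    rw [hσ₁]
    linarith

/-- Scaling by mv carries the horizontal line through i to the one through mτ, and homogeneity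
extracts the power of |mv|. All line integrals thus reduce to `betaInt`. -/
lemma wFun_shift (hq : IsAngularFactor q A) (s : ℂ) {τ : ℂ} (hτ : 0 < τ.im) {m : ℤ} (hm : m ≠ 0)
    (x : ℝ) : wFun q s (m * τ + x) = Complex.exp (-2 * s * Real.log |m * τ.im|) *
      wFun q s (Complex.I + ((((m * τ.im)⁻¹ * (x + m * τ.re)) : ℝ) : ℂ)) := by
  have hm' : (m : ℝ) ≠ 0 := Int.cast_ne_zero.mpr hm
  have ha : (m : ℝ) * τ.im ≠ 0 := mul_ne_zero hm' hτ.ne'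
  have e : (m * τ + x : ℂ) = ((m * τ.im : ℝ) : ℂ) *
      (Complex.I + ((((m * τ.im)⁻¹ * (x + m * τ.re)) : ℝ) : ℂ)) := by
    apply Complex.ext
    · simp; field_simp; ring
    · simp
  rw [e, wFun, wFun, hq.real_mul _ ha, normPow_real_mul s ha
    (ne_zero_of_im_ne_zero (I_add_real_im _))]
  ring

lemma integrable_wFun_line (hq : IsAngularFactor q A) {s : ℂ} (hs : 1 / 2 < s.re) {τ : ℂ}
    (hτ : 0 < τ.im) {m : ℤ} (hm : m ≠ 0) : Integrable fun x : ℝ => wFun q s (m * τ + x) := by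
  have ha : (m : ℝ) * τ.im ≠ 0 := mul_ne_zero (Int.cast_ne_zero.mpr hm) hτ.ne'
  simp only [wFun_shift hq s hτ hm]
  refine Integrable.const_mul ?_ _
  exact ((integrable_wFun_I hq hs).comp_mul_left' (inv_ne_zero ha)).comp_add_right (m * τ.re)

lemma integral_wFun_line (hq : IsAngularFactor q A) (s : ℂ) {τ : ℂ}
    (hτ : 0 < τ.im) {m : ℤ} (hm : m ≠ 0) :
    ∫ x : ℝ, wFun q s (m * τ + x) =
      Complex.exp ((1 - 2 * s) * Real.log |(m : ℝ)|) *
        (Complex.exp ((1 - 2 * s) * Real.log τ.im) * betaInt q s) := by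
  have hm' : (m : ℝ) ≠ 0 := Int.cast_ne_zero.mpr hm
  have ha : (m : ℝ) * τ.im ≠ 0 := mul_ne_zero hm' hτ.ne'
  simp only [wFun_shift hq s hτ hm]
  rw [integral_const_mul,
    integral_add_right_eq_self (fun x => wFun q s (Complex.I + (((m * τ.im)⁻¹ * x : ℝ) : ℂ))),
    Measure.integral_comp_mul_left (fun x : ℝ => wFun q s (Complex.I + x)), inv_inv,
    ← betaInt, Complex.real_smul, ← mul_assoc, ← mul_assoc, ← Complex.exp_add]
  congr 1
  have h2 : 0 < |(m : ℝ) * τ.im| := abs_pos.mpr ha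
  rw [← Real.exp_log h2, Complex.ofReal_exp, Real.log_exp, ← Complex.exp_add, abs_mul,
    abs_of_pos hτ, Real.log_mul (abs_ne_zero.mpr hm') hτ.ne']
  push_cast
  ring_nf

lemma hasSum_abs_int {s : ℂ} (hs : 1 < s.re) :
    HasSum (fun m : {m : ℤ // m ≠ 0} => Complex.exp ((1 - 2 * s) * Real.log |((m : ℤ) : ℝ)|))
      (2 * riemannZeta (2 * s - 1)) := by
  have h1 : 1 < (2 * s - 1).re := by simp; linarith
  have key : ∀ n : ℕ, Complex.exp ((1 - 2 * s) * Real.log ((n : ℝ) + 1)) =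
      1 / ((n : ℂ) + 1) ^ (2 * s - 1) := by
    intro n
    have hn : (n : ℂ) + 1 ≠ 0 := by exact_mod_cast n.succ_ne_zero
    rw [Complex.cpow_def_of_ne_zero hn, one_div, ← Complex.exp_neg, Complex.ofReal_log (by positivity)]
    push_cast
    ring_nf
  have hz : HasSum (fun n : ℕ => Complex.exp ((1 - 2 * s) * Real.log ((n : ℝ) + 1)))
      (riemannZeta (2 * s - 1)) := by
    simp only [key]
    rw [zeta_eq_tsum_one_div_nat_add_one_cpow h1]
    refine Summable.hasSum ?_
    have := (summable_nat_add_iff 1).mpr (Complex.summable_one_div_nat_cpow.mpr h1)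
    simpa using this
  set f : ℤ → ℂ := fun m => if m = 0 then 0 else
    Complex.exp ((1 - 2 * s) * Real.log |(m : ℝ)|) with hf
  have hsum : HasSum f (2 * riemannZeta (2 * s - 1)) := by
    rw [two_mul]
    refine HasSum.of_nat_of_neg_add_one ?_ ?_
    · rw [← hasSum_nat_add_iff' 1]
      simp only [Finset.range_one, Finset.sum_singleton, Nat.cast_zero, hf, if_true, sub_zero]
      refine hasSum_of_forall_eq hz fun n => ?_
      rw [if_neg (by omega)]
      push_cast
      rw [abs_of_nonneg (by positivity)]
    · refine hasSum_of_forall_eq hz fun n => ?_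
      simp only [hf]
      rw [if_neg (by omega)]
      push_cast
      rw [abs_of_nonpos (by linarith [n.cast_nonneg (α := ℝ)])]
      ring_nf
  rw [← Function.Injective.hasSum_iff (Subtype.val_injective (p := fun m : ℤ => m ≠ 0))] at hsum
  · refine hasSum_of_forall_eq hsum fun m => ?_
    simp [hf, m.2]
  · intro m hm
    have : m = 0 := by simpa using hm
    simp [hf, this]

/-! ### Continuation of the lattice sums -/

lemma hasSum_integral_count {f : LatIdx → ℂ} (hf : Integrable f Measure.count) :
    HasSum f (∫ p, f p ∂Measure.count) := by
  rw [integral_countable hf]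
  have : Summable f := (integrable_count_iff.mp hf).of_norm
  simpa [Measure.real] using this.hasSum

lemma summable_wFun {q A : ℂ → ℂ} (hq : IsAngularFactor q A) {s : ℂ} (hs : 1 < s.re) {α : ℝ}
    (hα : α ∈ Set.Icc (0 : ℝ) 1) {τ : ℂ} (hτ : 0 < τ.im) :
    Summable fun p : LatIdx => ‖wFun q s (latPt α τ (p, 0))‖ := by
  obtain ⟨K, hK, hKe⟩ := exists_latPt_bound hα hτ
  refine Summable.of_nonneg_of_le (fun _ => norm_nonneg _) (fun p => ?_)
    ((summable_norm_latIdx (a := 2 * s.re) (by linarith)).mul_left (K ^ (2 * s.re)))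
  obtain ⟨h1, h2⟩ := hKe.self_of_nhds.2.2 (p, 0) ⟨le_rfl, zero_le_one⟩
  refine (norm_wFun_le hq s (ne_zero_of_im_ne_zero (latPt_im_ne_zero α hτ _))).trans ?_
  exact norm_rpow_neg_le hK (by linarith) h2

lemma latPt_add (α : ℝ) (τ : ℂ) (p : LatIdx) (t : ℝ) : latPt α τ (p, t) = latPt α τ (p, 0) + t := by
  simp [latPt]

/-- First-order Euler-Maclaurin on a unit interval: integrate by parts against t - 1, which is 0 at
t = 1 and -1 at t = 0, so only the left endpoint survives. -/
lemma integral_kFun_unit {q A : ℂ → ℂ} (hq : IsAngularFactor q A) (s : ℂ) {z : ℂ} (hz : z.im ≠ 0) :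
    wFun q s z = (∫ t in (0 : ℝ)..1, ((t - 1 : ℝ) : ℂ) * kFun q A s (z + t)) +
      ∫ t in (0 : ℝ)..1, wFun q s (z + t) := by
  have him : ∀ t : ℝ, (z + t).im ≠ 0 := fun t => by simpa using hz
  have hc1 : Continuous fun t : ℝ => kFun q A s (z + t) :=
    (continuousOn_kFun hq s).comp_continuous (by fun_prop) him
  have hc2 : Continuous fun t : ℝ => wFun q s (z + t) :=
    (continuousOn_wFun hq s).comp_continuous (by fun_prop) him
  have hc3 : Continuous fun t : ℝ => ((t - 1 : ℝ) : ℂ) * kFun q A s (z + t) :=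
    (Complex.continuous_ofReal.comp (continuous_id.sub continuous_const)).mul hc1
  have hd : ∀ t : ℝ, HasDerivAt (fun t : ℝ => ((t - 1 : ℝ) : ℂ) * wFun q s (z + t))
      (((t - 1 : ℝ) : ℂ) * kFun q A s (z + t) + wFun q s (z + t)) t := by
    intro t
    have h1 : HasDerivAt (fun t : ℝ => ((t - 1 : ℝ) : ℂ)) 1 t := by
      simpa using! ((hasDerivAt_id t).sub_const 1).ofReal_comp
    refine (h1.mul (hasDerivAt_wFun hq s hz t)).congr_deriv ?_
    ring
  have := intervalIntegral.integral_eq_sub_of_hasDerivAt (a := 0) (b := 1) (fun t _ => hd t)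
    ((hc3.add hc2).intervalIntegrable _ _)
  rw [intervalIntegral.integral_add (hc3.intervalIntegrable _ _) (hc2.intervalIntegrable _ _)]
    at this
  rw [this]
  simp

/-- For fixed m the unit intervals of the Euler-Maclaurin identity tile the real line; the resulting
line integral is |m|^(1-2s) times a factor free of m, and summing over m ≠ 0 gives 2ζ(2s-1). The
right-hand side is the continuation: its kernel part converges for Re s > 1/2. -/
theorem hasSum_wFun {q A : ℂ → ℂ} (hq : IsAngularFactor q A) {s : ℂ} (hs : 1 < s.re) {α : ℝ}
    (hα : α ∈ Set.Icc (0 : ℝ) 1) {τ : ℂ} (hτ : 0 < τ.im) :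
    HasSum (fun p : LatIdx => wFun q s (latPt α τ (p, 0)))
      (kerSum (kFun q A s) α τ + 2 * riemannZeta (2 * s - 1) *
        (Complex.exp ((1 - 2 * s) * Real.log τ.im) * betaInt q s)) := by
  have hinteg := integrable_kernel (a := 2 * s.re + 1) (by linarith) (continuousOn_kFun hq s)
    (decaysWith_kFun hq s) hα hτ
  have h1 := hasSum_integral_count hinteg.integral_prod_left
  rw [← integral_prod _ hinteg] at h1
  change HasSum _ (kerSum (kFun q A s) α τ) at h1
  have h1' : HasSum (fun p : LatIdx => ∫ t in (0 : ℝ)..1, ((t - 1 : ℝ) : ℂ) *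
      kFun q A s (latPt α τ (p, 0) + t)) (kerSum (kFun q A s) α τ) := by
    refine hasSum_of_forall_eq h1 fun p => ?_
    rw [intervalIntegral.integral_of_le zero_le_one]
    simp only [fun t : ℝ => (latPt_add α τ p t).symm]
  have hw := (summable_wFun hq hs hα hτ).of_norm
  have hs2 : Summable fun p : LatIdx => ∫ t in (0 : ℝ)..1, wFun q s (latPt α τ (p, 0) + t) := by
    refine (hw.sub h1'.summable).congr fun p => ?_
    rw [integral_kFun_unit hq s (latPt_im_ne_zero α hτ (p, 0))]
    ring
  let e : {m : ℤ // m ≠ 0} × ℤ ≃ LatIdx :=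
    { toFun := fun x => ⟨(x.1.1, x.2), x.1.2⟩
      invFun := fun p => (⟨p.1.1, p.2⟩, p.1.2)
      left_inv := fun _ => rfl
      right_inv := fun _ => rfl }
  have hs3 := hs2.hasSum
  rw [← e.hasSum_iff] at hs3
  have hfib := hs3.prod_fiberwise (g := fun m : {m : ℤ // m ≠ 0} =>
    ∫ x : ℝ, wFun q s ((m : ℤ) * τ + x)) (fun m => by
      have h := (integrable_wFun_line hq (by linarith : 1 / 2 < s.re) hτ m.2).hasSum_intervalIntegral α
      refine hasSum_of_forall_eq h fun n => ?_
      simp only [Function.comp]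
      have h2 := intervalIntegral.integral_comp_add_right (a := 0) (b := 1)
        (fun x : ℝ => wFun q s ((m : ℤ) * τ + x)) (α + n)
      rw [zero_add, add_comm (1 : ℝ)] at h2
      rw [← h2]
      refine intervalIntegral.integral_congr fun t _ => ?_
      simp only [e, Equiv.coe_fn_mk, latPt]
      congr 1
      push_cast
      ring)
  have hz := (hasSum_abs_int hs).mul_right
    (Complex.exp ((1 - 2 * s) * Real.log τ.im) * betaInt q s)
  have heq := (hasSum_of_forall_eq hz fun m : {m : ℤ // m ≠ 0} =>
    integral_wFun_line hq s hτ m.2).unique hfib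
  rw [heq]
  refine hasSum_of_forall_eq (h1'.add hs2.hasSum) fun p => ?_
  exact integral_kFun_unit hq s (latPt_im_ne_zero α hτ (p, 0))

/-! ### The two angular factors -/

/-- The angular factor of weight `2`. -/
def qTwo (z : ℂ) : ℂ := conj z * z⁻¹

/-- The derivative of `qTwo` in the real direction. -/
def aTwo (z : ℂ) : ℂ := z⁻¹ - conj z * (z⁻¹ * z⁻¹)

lemma isAngularFactor_one : IsAngularFactor (fun _ => 1) (fun _ => 0) where
  norm_le z := by simp
  real_mul r _ z := rfl
  hasDerivAt z _ t := hasDerivAt_const _ _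
  continuousOn := continuousOn_const
  continuousOn_deriv := continuousOn_const
  norm_deriv_le z := by simp

lemma norm_qTwo_le (z : ℂ) : ‖qTwo z‖ ≤ 1 := by
  rw [qTwo, norm_mul, norm_inv, RCLike.norm_conj]
  exact mul_inv_le_one

lemma isAngularFactor_two : IsAngularFactor qTwo aTwo where
  norm_le := norm_qTwo_le
  real_mul r hr z := by
    have : (r : ℂ) ≠ 0 := Complex.ofReal_ne_zero.mpr hr
    simp only [qTwo, map_mul, Complex.conj_ofReal, mul_inv]
    field_simp
  hasDerivAt z hz t := by
    have h0 : z + t ≠ 0 := ne_zero_of_im_ne_zero (by simpa using hz)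
    have h1 : HasDerivAt (fun t : ℝ => z + (t : ℂ)) 1 t := by
      simpa using! (hasDerivAt_id t).ofReal_comp.const_add z
    have h2 : HasDerivAt (fun t : ℝ => conj (z + (t : ℂ))) 1 t := by
      simp only [map_add, Complex.conj_ofReal]
      simpa using! (hasDerivAt_id t).ofReal_comp.const_add (conj z)
    have h3 := h2.mul (h1.fun_inv h0)
    refine h3.congr_deriv ?_
    rw [aTwo]
    field_simp
    ring
  continuousOn := fun z hz => ContinuousAt.continuousWithinAt
    (Complex.continuous_conj.continuousAt.mul (continuousAt_inv₀ (ne_zero_of_im_ne_zero hz)))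
  continuousOn_deriv := fun z hz => by
    have h := continuousAt_inv₀ (ne_zero_of_im_ne_zero hz)
    exact ContinuousAt.continuousWithinAt
      (h.sub (Complex.continuous_conj.continuousAt.mul (h.mul h)))
  norm_deriv_le z := by
    refine (norm_sub_le _ _).trans ?_
    rw [← mul_assoc, norm_mul, two_mul, norm_inv]
    have := norm_qTwo_le z
    rw [qTwo] at this
    gcongr
    nlinarith [inv_nonneg.mpr (norm_nonneg z)]

/-- Up to the factor -1/s, the primitive U is conj z · |z|^(-2s) on the line z = i + x; it vanishes
at both ends, and its derivative is the difference of the two integrands. The factor 1 - s is what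
cancels the pole of ζ(2s-1) in weight two. -/
lemma betaInt_qTwo {s : ℂ} (hs : 1 / 2 < s.re) :
    betaInt qTwo s = (1 - s) / s * betaInt (fun _ => 1) s := by
  have hs0 : s ≠ 0 := by rintro rfl; norm_num at hs
  set U : ℝ → ℂ := fun x => (Complex.I + -x) / s * normPow s (Complex.I + x) with hU
  have hd : ∀ x : ℝ, HasDerivAt U (wFun qTwo s (Complex.I + x) -
      (1 - s) / s * wFun (fun _ => 1) s (Complex.I + x)) x := by
    intro x
    have h1 : HasDerivAt (fun x : ℝ => (Complex.I + -(x : ℂ)) / s) (-1 / s) x := by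
      simpa using! ((hasDerivAt_id x).ofReal_comp.neg.const_add Complex.I).div_const s
    refine (h1.mul (hasDerivAt_normPow s (z := Complex.I) (by simp) x)).congr_deriv ?_
    have hz : (Complex.I + x : ℂ) ≠ 0 := ne_zero_of_im_ne_zero (I_add_real_im x)
    have hz' : (-Complex.I + x : ℂ) ≠ 0 := ne_zero_of_im_ne_zero (by simp)
    simp only [wFun, qTwo, map_add, Complex.conj_I, Complex.conj_ofReal]
    rw [one_mul]
    field_simp
    ring_nf
  have hi1 := integrable_wFun_I isAngularFactor_two hs
  have hi2 := (integrable_wFun_I isAngularFactor_one hs).const_mul ((1 - s) / s)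
  have hnorm : ∀ x : ℝ, ‖U x‖ = ‖s‖⁻¹ * ‖Complex.I + x‖ ^ (-(2 * s.re - 1)) := by
    intro x
    have hz : (Complex.I + x : ℂ) ≠ 0 := ne_zero_of_im_ne_zero (I_add_real_im x)
    have h2 : ‖Complex.I + -(x : ℂ)‖ = ‖Complex.I + x‖ := by
      have := norm_I_add_real (-x)
      rw [neg_sq, ← norm_I_add_real] at this
      simpa using this
    simp only [hU]
    rw [norm_mul, norm_div, norm_normPow s hz, h2,
      show -(2 * s.re - 1) = 1 + -(2 * s.re) by ring, Real.rpow_add (norm_pos_iff.mpr hz),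
      Real.rpow_one]
    ring
  have hlim : ∀ l : Filter ℝ, Tendsto (fun x : ℝ => |x|) l atTop → Tendsto U l (𝓝 0) := by
    intro l hl
    rw [tendsto_zero_iff_norm_tendsto_zero]
    simp only [hnorm]
    have h1 : Tendsto (fun x : ℝ => ‖Complex.I + x‖) l atTop := by
      refine tendsto_atTop_mono (fun x => ?_) hl
      simpa using Complex.abs_re_le_norm (Complex.I + x)
    have h2 := (tendsto_rpow_neg_atTop (y := 2 * s.re - 1) (by linarith)).comp h1
    simpa using h2.const_mul ‖s‖⁻¹
  have h := integral_of_hasDerivAt_of_tendsto hd (hi1.sub hi2)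
    (hlim _ tendsto_abs_atBot_atTop) (hlim _ tendsto_abs_atTop_atTop)
  rw [integral_sub hi1 hi2, integral_const_mul, sub_self, sub_eq_zero] at h
  exact h

/-! ### Cosets and coprime pairs -/

/-- The cosets `Γ₀(N)_∞ \ Γ₀(N)`. -/
abbrev Coset (N : ℕ) := Quotient (QuotientGroup.rightRel (gammaInfty N))

lemma mem_gammaInfty {N : ℕ} {γ : Gamma0 N} : γ ∈ gammaInfty N ↔ (γ : SL(2, ℤ)) 1 0 = 0 := by
  rw [gammaInfty, Subgroup.mem_subgroupOf, Subgroup.mem_comap, MulAction.mem_stabilizer_iff,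
    OnePoint.smul_infty_eq_self_iff]
  simp [Matrix.SpecialLinearGroup.mapGL]

lemma mem_Gamma0_iff_dvd {N : ℕ} {γ : SL(2, ℤ)} : γ ∈ Gamma0 N ↔ (N : ℤ) ∣ γ 1 0 := by
  rw [Gamma0_mem, ZMod.intCast_zmod_eq_zero_iff_dvd]

lemma coset_mk_eq_iff {N : ℕ} {γ δ : Gamma0 N} :
    (Quotient.mk _ γ : Coset N) = Quotient.mk _ δ ↔
      ((δ * γ⁻¹ : Gamma0 N) : SL(2, ℤ)) 1 0 = 0 := by
  rw [Quotient.eq, QuotientGroup.rightRel_apply, mem_gammaInfty]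

lemma mul_inv_one_zero (δ γ : SL(2, ℤ)) :
    (δ * γ⁻¹) 1 0 = δ 1 0 * γ 1 1 - δ 1 1 * γ 1 0 := by
  simp [Matrix.SpecialLinearGroup.coe_inv, Matrix.adjugate_fin_two, Matrix.mul_apply,
    Fin.sum_univ_two]
  ring

/-- Bottom rows of matrices in `Γ₀(N)`. -/
abbrev BottomRow (N : ℕ) := {p : ℤ × ℤ // IsCoprime p.1 p.2 ∧ (N : ℤ) ∣ p.1}

/-- The bottom row of the representative of a coset. -/
def cosetRow {N : ℕ} (c : Coset N) : ℤ × ℤ :=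
  ((c.out : SL(2, ℤ)) 1 0, (c.out : SL(2, ℤ)) 1 1)

lemma eq_or_eq_neg_of_isCoprime {a b c d : ℤ} (h1 : IsCoprime a b) (h2 : IsCoprime c d)
    (h : a * d - b * c = 0) : (a, b) = (c, d) ∨ (a, b) = (-c, -d) := by
  have hac : a ∣ c := h1.dvd_of_dvd_mul_left (Dvd.intro d (by linarith))
  have hca : c ∣ a := h2.dvd_of_dvd_mul_right (Dvd.intro_left b (by linarith))
  have hbd : b ∣ d := h1.symm.dvd_of_dvd_mul_left (Dvd.intro c (by linarith))
  have hdb : d ∣ b := h2.symm.dvd_of_dvd_mul_right (Dvd.intro_left a (by linarith))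
  have h3 := Int.natAbs_eq_natAbs_iff.mp
    (Nat.dvd_antisymm (Int.natAbs_dvd_natAbs.mpr hac) (Int.natAbs_dvd_natAbs.mpr hca))
  have h4 := Int.natAbs_eq_natAbs_iff.mp
    (Nat.dvd_antisymm (Int.natAbs_dvd_natAbs.mpr hbd) (Int.natAbs_dvd_natAbs.mpr hdb))
  by_cases hc : c = 0
  · subst hc
    rcases h4 with rfl | rfl <;> simp_all
  by_cases hd : d = 0
  · subst hd
    rcases h3 with rfl | rfl <;> simp_all
  rcases h3 with rfl | rfl <;> rcases h4 with rfl | rfl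
  · exact Or.inl rfl
  · exfalso
    have : 2 * (a * d) = 0 := by linarith
    simp_all
  · exfalso
    have : 2 * (b * c) = 0 := by linarith
    simp_all
  · exact Or.inr rfl

lemma exists_bottomRow {N : ℕ} (p : BottomRow N) :
    ∃ γ : Gamma0 N, ((γ : SL(2, ℤ)) 1 0, (γ : SL(2, ℤ)) 1 1) = p.1 := by
  obtain ⟨g, -, hg⟩ := ModularGroup.bottom_row_surj (R := ℤ)
    (show ![p.1.1, p.1.2] ∈ {cd : Fin 2 → ℤ | IsCoprime (cd 0) (cd 1)} by simpa using p.2.1)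
  have h0 : g 1 0 = p.1.1 := by simpa using congrFun hg 0
  have h1 : g 1 1 = p.1.2 := by simpa using congrFun hg 1
  exact ⟨⟨g, mem_Gamma0_iff_dvd.mpr (h0 ▸ p.2.2)⟩, by simp [h0, h1]⟩

/-- Up to sign, the bottom row determines the coset. -/
def cosetEquiv (N : ℕ) : Coset N × ℤˣ ≃ BottomRow N :=
  Equiv.ofBijective (fun x => ⟨((x.2 : ℤ) * (cosetRow x.1).1, (x.2 : ℤ) * (cosetRow x.1).2), by
      refine ⟨?_, Dvd.dvd.mul_left (mem_Gamma0_iff_dvd.mp x.1.out.2) _⟩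
      have := ModularGroup.bottom_row_coprime (x.1.out : SL(2, ℤ))
      exact (isCoprime_mul_unit_left x.2.isUnit _ _).mpr this⟩) <| by
    constructor
    · rintro ⟨c, ε⟩ ⟨c', ε'⟩ h
      simp only [Subtype.mk.injEq, Prod.mk.injEq] at h
      obtain ⟨h1, h2⟩ := h
      have hc : c = c' := by
        rw [← Quotient.out_eq c, ← Quotient.out_eq c', coset_mk_eq_iff, Subgroup.coe_mul,
          Subgroup.coe_inv, mul_inv_one_zero]
        change (cosetRow c').1 * (cosetRow c).2 - (cosetRow c').2 * (cosetRow c).1 = 0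
        have h3 : (ε : ℤ) * (ε' : ℤ) * ((cosetRow c').1 * (cosetRow c).2 -
            (cosetRow c').2 * (cosetRow c).1) = 0 := by
          linear_combination (-(ε : ℤ) * (cosetRow c).2) * h1 + ((ε : ℤ) * (cosetRow c).1) * h2
        rcases mul_eq_zero.mp h3 with h | h
        · exact absurd h (mul_ne_zero ε.ne_zero ε'.ne_zero)
        · exact h
      subst hc
      have hrow : (cosetRow c).1 ≠ 0 ∨ (cosetRow c).2 ≠ 0 := by
        by_contra hcon
        push Not at hcon
        have := ModularGroup.bottom_row_coprime (c.out : SL(2, ℤ))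
        change IsCoprime (cosetRow c).1 (cosetRow c).2 at this
        rw [hcon.1, hcon.2] at this
        exact not_isCoprime_zero_zero this
      have hε : (ε : ℤ) = ε' := by
        rcases hrow with h | h
        · exact mul_right_cancel₀ h h1
        · exact mul_right_cancel₀ h h2
      rw [Units.ext hε]
    · intro p
      obtain ⟨γ, hγ⟩ := exists_bottomRow p
      set c : Coset N := Quotient.mk _ γ with hc
      have h1 : (Quotient.mk _ c.out : Coset N) = Quotient.mk _ γ := by rw [Quotient.out_eq]
      rw [coset_mk_eq_iff, Subgroup.coe_mul, Subgroup.coe_inv, mul_inv_one_zero] at h1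
      rcases eq_or_eq_neg_of_isCoprime (ModularGroup.bottom_row_coprime (γ : SL(2, ℤ)))
        (ModularGroup.bottom_row_coprime (c.out : SL(2, ℤ))) h1 with h | h
      · refine ⟨(c, 1), Subtype.ext ?_⟩
        rw [← hγ, h]
        simp [cosetRow]
      · refine ⟨(c, -1), Subtype.ext ?_⟩
        rw [← hγ, h]
        simp [cosetRow]

lemma cosetEquiv_apply {N : ℕ} (x : Coset N × ℤˣ) : (cosetEquiv N x).1 =
    ((x.2 : ℤ) * (cosetRow x.1).1, (x.2 : ℤ) * (cosetRow x.1).2) := rfl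

/-! ### Coprime pairs and all pairs -/

/-- The pairs `(m, n)` with `m ≠ 0`, `N ∣ m` and `n` prime to `N`. -/
abbrev LevelPair (N : ℕ) := {p : ℤ × ℤ // p.1 ≠ 0 ∧ (N : ℤ) ∣ p.1 ∧ IsCoprime p.2 (N : ℤ)}

/-- Bottom rows with nonzero first entry. -/
abbrev BottomRow' (N : ℕ) := {p : ℤ × ℤ // p.1 ≠ 0 ∧ IsCoprime p.1 p.2 ∧ (N : ℤ) ∣ p.1}

/-- Positive integers prime to `N`. -/
abbrev PrimeTo (N : ℕ) := {g : ℕ // 0 < g ∧ g.Coprime N}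

/-- Residues prime to `N`. -/
def residues (N : ℕ) : Finset ℕ := (Finset.range N).filter (·.Coprime N)

/-- Division by the greatest common divisor. -/
def gcdEquiv (N : ℕ) : PrimeTo N × BottomRow' N ≃ LevelPair N :=
  Equiv.ofBijective (fun x => ⟨((x.1.1 : ℤ) * x.2.1.1, (x.1.1 : ℤ) * x.2.1.2), by
      have hg : ((x.1.1 : ℕ) : ℤ) ≠ 0 := by exact_mod_cast x.1.2.1.ne'
      refine ⟨mul_ne_zero hg x.2.2.1, Dvd.dvd.mul_left x.2.2.2.2 _, IsCoprime.mul_left ?_ ?_⟩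
      · exact Nat.isCoprime_iff_coprime.mpr x.1.2.2
      · exact (IsCoprime.of_isCoprime_of_dvd_left x.2.2.2.1 x.2.2.2.2).symm⟩) <| by
    constructor
    · rintro ⟨⟨g, hg⟩, ⟨⟨c, d⟩, hp⟩⟩ ⟨⟨g', hg'⟩, ⟨⟨c', d'⟩, hp'⟩⟩ h
      simp only [Subtype.mk.injEq, Prod.mk.injEq] at h
      obtain ⟨h1, h2⟩ := h
      have e1 : (g : ℕ) = Int.gcd ((g : ℤ) * c) ((g : ℤ) * d) := by
        rw [Int.gcd_mul_left, Int.isCoprime_iff_gcd_eq_one.mp hp.2.1]; simp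
      have e2 : (g' : ℕ) = Int.gcd ((g' : ℤ) * c') ((g' : ℤ) * d') := by
        rw [Int.gcd_mul_left, Int.isCoprime_iff_gcd_eq_one.mp hp'.2.1]; simp
      have hgg : g = g' := by rw [e1, e2, h1, h2]
      subst hgg
      have hg0 : (g : ℤ) ≠ 0 := by exact_mod_cast hg.1.ne'
      have := mul_left_cancel₀ hg0 h1
      have := mul_left_cancel₀ hg0 h2
      subst_vars
      rfl
    · rintro ⟨⟨m, n⟩, hm, hN, hn⟩
      simp only at hm hN hn
      have hgpos : 0 < Int.gcd m n := Int.gcd_pos_of_ne_zero_left _ hm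
      have hg0 : ((Int.gcd m n : ℕ) : ℤ) ≠ 0 := by exact_mod_cast hgpos.ne'
      obtain ⟨c, hc⟩ := Int.gcd_dvd_left m n
      obtain ⟨d, hd⟩ := Int.gcd_dvd_right m n
      have hcop : IsCoprime ((Int.gcd m n : ℕ) : ℤ) (N : ℤ) :=
        IsCoprime.of_isCoprime_of_dvd_left hn (Int.gcd_dvd_right m n)
      refine ⟨(⟨Int.gcd m n, hgpos, Nat.isCoprime_iff_coprime.mp hcop⟩, ⟨(c, d), ?_, ?_, ?_⟩), ?_⟩
      · rintro rfl
        simp at hc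
        exact hm hc
      · rw [Int.isCoprime_iff_gcd_eq_one]
        have : Int.gcd m n = Int.gcd m n * Int.gcd c d := by
          calc Int.gcd m n = Int.gcd ((Int.gcd m n : ℤ) * c) ((Int.gcd m n : ℤ) * d) := by
                rw [← hc, ← hd]
            _ = _ := by rw [Int.gcd_mul_left]; simp
        exact (Nat.mul_eq_left hgpos.ne').mp this.symm
      · rw [hc] at hN
        exact hcop.symm.dvd_of_dvd_mul_left hN
      · simp only [Subtype.mk.injEq, Prod.mk.injEq]
        exact ⟨hc.symm, hd.symm⟩

lemma gcdEquiv_apply {N : ℕ} (x : PrimeTo N × BottomRow' N) :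
    (gcdEquiv N x).1 = ((x.1.1 : ℤ) * x.2.1.1, (x.1.1 : ℤ) * x.2.1.2) := rfl

/-- Division with remainder by `N`. -/
def residueEquiv (N : ℕ) (hN : 1 ≤ N) : residues N × LatIdx ≃ LevelPair N :=
  Equiv.ofBijective (fun x => ⟨((N : ℤ) * x.2.1.1, (N : ℤ) * x.2.1.2 + (x.1.1 : ℤ)), by
      have hN0 : (N : ℤ) ≠ 0 := by exact_mod_cast (by omega : N ≠ 0)
      refine ⟨mul_ne_zero hN0 x.2.2, Dvd.intro _ rfl, ?_⟩
      have h := (Finset.mem_filter.mp x.1.2).2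
      have := Nat.isCoprime_iff_coprime.mpr h
      rw [add_comm]
      exact this.add_mul_left_left _⟩) <| by
    have hN0 : (N : ℤ) ≠ 0 := by exact_mod_cast (by omega : N ≠ 0)
    constructor
    · rintro ⟨⟨r, hr⟩, ⟨⟨m, n⟩, hm⟩⟩ ⟨⟨r', hr'⟩, ⟨⟨m', n'⟩, hm'⟩⟩ h
      simp only [Subtype.mk.injEq, Prod.mk.injEq] at h
      obtain ⟨h1, h2⟩ := h
      have e1 := mul_left_cancel₀ hN0 h1
      have l1 := Finset.mem_range.mp (Finset.mem_filter.mp hr).1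
      have l2 := Finset.mem_range.mp (Finset.mem_filter.mp hr').1
      have e3 : n = n' := by
        have d1 : ((N : ℤ) * n + r) / N = n := by
          rw [Int.add_comm, Int.add_mul_ediv_left _ _ hN0,
            Int.ediv_eq_zero_of_lt (by positivity) (by exact_mod_cast l1), zero_add]
        have d2 : ((N : ℤ) * n' + r') / N = n' := by
          rw [Int.add_comm, Int.add_mul_ediv_left _ _ hN0,
            Int.ediv_eq_zero_of_lt (by positivity) (by exact_mod_cast l2), zero_add]
        rw [← d1, ← d2, h2]
      subst e3
      have e4 : r = r' := by
        have := add_left_cancel h2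
        exact_mod_cast this
      subst e4 e1
      rfl
    · rintro ⟨⟨m, n⟩, hm, hd, hn⟩
      simp only at hm hd hn
      obtain ⟨m', rfl⟩ := hd
      have hr0 : 0 ≤ n % N := Int.emod_nonneg _ hN0
      have hr1 : n % N < N := Int.emod_lt_of_pos _ (by positivity)
      have hcast : (((n % N).toNat : ℕ) : ℤ) = n % N := Int.toNat_of_nonneg hr0
      refine ⟨(⟨(n % N).toNat, ?_⟩, ⟨(m', n / N), ?_⟩), ?_⟩
      · rw [residues, Finset.mem_filter, Finset.mem_range]
        refine ⟨by omega, ?_⟩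
        rw [← Nat.isCoprime_iff_coprime, hcast]
        have : n % N = n + (N : ℤ) * (-(n / N)) := by
          have := Int.emod_add_mul_ediv n N
          linarith
        rw [this]
        exact hn.add_mul_left_left _
      · rintro rfl
        simp at hm
      · simp only [Subtype.mk.injEq, Prod.mk.injEq, hcast]
        exact ⟨trivial, Int.mul_ediv_add_emod n N⟩

lemma residueEquiv_apply {N : ℕ} (hN : 1 ≤ N) (x : residues N × LatIdx) :
    (residueEquiv N hN x).1 = ((N : ℤ) * x.2.1.1, (N : ℤ) * x.2.1.2 + (x.1.1 : ℤ)) := rfl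

/-! ### Eisenstein series as lattice sums -/

/-- `∑ g ^ (-2 s)` over the positive integers prime to `N`. -/
def levelL (N : ℕ) (s : ℂ) : ℂ := ∑' g : PrimeTo N, Complex.exp (-2 * s * Real.log (g : ℕ))

lemma norm_exp_log_natCast (s : ℂ) {g : ℕ} (hg : 0 < g) :
    ‖Complex.exp (-2 * s * Real.log g)‖ = (g : ℝ) ^ (-(2 * s.re)) := by
  rw [Complex.norm_exp, Real.rpow_def_of_pos (by exact_mod_cast hg)]
  congr 1
  rw [show (-2 * s * Real.log g : ℂ) = ((-(2 * Real.log g) : ℝ) : ℂ) * s by push_cast; ring,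
    Complex.re_ofReal_mul]
  ring

lemma summable_primeTo (N : ℕ) {e : ℝ} (he : 1 < e) :
    Summable fun g : PrimeTo N => ((g : ℕ) : ℝ) ^ (-e) := by
  have := Real.summable_nat_rpow.mpr (by linarith : -e < -1)
  exact this.comp_injective Subtype.val_injective

lemma summable_levelL (N : ℕ) {s : ℂ} (hs : 1 / 2 < s.re) :
    Summable fun g : PrimeTo N => Complex.exp (-2 * s * Real.log (g : ℕ)) := by
  refine Summable.of_norm ((summable_primeTo N (e := 2 * s.re) (by linarith)).congr fun g => ?_)
  rw [norm_exp_log_natCast s g.2.1]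

lemma differentiableAt_levelL (N : ℕ) {s₀ : ℂ} (hs : 3 / 4 < s₀.re) :
    DifferentiableAt ℂ (levelL N) s₀ := by
  have hopen : IsOpen {s : ℂ | 3 / 4 < s.re} := isOpen_lt continuous_const Complex.continuous_re
  refine DifferentiableOn.differentiableAt (s := {s : ℂ | 3 / 4 < s.re}) ?_ (hopen.mem_nhds hs)
  refine Complex.differentiableOn_tsum_of_summable_norm
    (summable_primeTo N (e := 3 / 2) (by norm_num)) (fun g => ?_) hopen fun g s hs => ?_
  · fun_prop
  · rw [norm_exp_log_natCast s g.2.1]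
    refine Real.rpow_le_rpow_of_exponent_le (by exact_mod_cast g.2.1) ?_
    have : 3 / 4 < s.re := hs
    linarith

/-- At s = 1 every term is a positive real and g = 1 is always admitted. Division by `levelL` near s
= 1 therefore creates no pole. -/
lemma levelL_one_ne_zero (N : ℕ) : levelL N 1 ≠ 0 := by
  have hterm : ∀ g : PrimeTo N, Complex.exp (-2 * 1 * Real.log (g : ℕ)) =
      ((Real.exp (-2 * Real.log (g : ℕ)) : ℝ) : ℂ) := fun g => by push_cast; simp
  have hs : Summable fun g : PrimeTo N => Real.exp (-2 * Real.log (g : ℕ)) := by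
    have := summable_levelL N (s := 1) (by norm_num)
    simp only [hterm] at this
    exact Complex.summable_ofReal.mp this
  have hpos : 0 < ∑' g : PrimeTo N, Real.exp (-2 * Real.log (g : ℕ)) :=
    hs.tsum_pos (fun _ => (Real.exp_pos _).le) ⟨1, one_pos, Nat.coprime_one_left N⟩ (Real.exp_pos _)
  rw [levelL]
  simp only [hterm]
  rw [← Complex.ofReal_tsum]
  exact_mod_cast hpos.ne'

lemma wFun_real_mul {q A : ℂ → ℂ} (hq : IsAngularFactor q A) (s : ℂ) {r : ℝ} (hr : r ≠ 0) {z : ℂ}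
    (hz : z ≠ 0) : wFun q s (r * z) = Complex.exp (-2 * s * Real.log |r|) * wFun q s z := by
  rw [wFun, wFun, hq.real_mul r hr, normPow_real_mul s hr hz]
  ring

lemma wFun_neg {q A : ℂ → ℂ} (hq : IsAngularFactor q A) (s z : ℂ) : wFun q s (-z) = wFun q s z := by
  have := hq.real_mul (-1) (by norm_num) z
  simp only [Complex.ofReal_neg, Complex.ofReal_one, neg_mul, one_mul] at this
  rw [wFun, wFun, this, normPow, normPow, norm_neg]

/-- The value of the lattice sums after continuation. -/
def latVal (q A : ℂ → ℂ) (N : ℕ) (s τ : ℂ) : ℂ :=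
  ∑ r ∈ residues N, (kerSum (kFun q A s) ((r : ℝ) / N) τ + 2 * riemannZeta (2 * s - 1) *
    (Complex.exp ((1 - 2 * s) * Real.log τ.im) * betaInt q s))

lemma div_mem_Icc {N r : ℕ} (hr : r ∈ residues N) : (r : ℝ) / N ∈ Set.Icc (0 : ℝ) 1 := by
  have h := Finset.mem_range.mp (Finset.mem_filter.mp hr).1
  refine ⟨by positivity, div_le_one_of_le₀ (by exact_mod_cast h.le) (by positivity)⟩

/-- A pair (Nm, Nn + r) gives the point N(mτ + n + r/N), so homogeneity extracts N^(-2s) and leaves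
one shifted lattice sum for each residue r prime to N. -/
lemma hasSum_levelPair {N : ℕ} (hN : 1 ≤ N) {q A : ℂ → ℂ} (hq : IsAngularFactor q A) {s : ℂ}
    (hs : 1 < s.re) {τ : ℂ} (hτ : 0 < τ.im) :
    HasSum (fun p : LevelPair N => wFun q s (p.1.1 * τ + p.1.2))
      (Complex.exp (-2 * s * Real.log N) * latVal q A N s τ) := by
  have hN0 : (N : ℝ) ≠ 0 := by exact_mod_cast (by omega : N ≠ 0)
  have hNC : (N : ℂ) ≠ 0 := by exact_mod_cast (by omega : N ≠ 0)
  rw [← (residueEquiv N hN).hasSum_iff]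
  set f : residues N × LatIdx → ℂ := fun x => wFun q s (latPt ((x.1.1 : ℝ) / N) τ (x.2, 0)) with hf
  have hterm : ∀ x : residues N × LatIdx, ((fun p : LevelPair N => wFun q s (p.1.1 * τ + p.1.2)) ∘
      residueEquiv N hN) x = Complex.exp (-2 * s * Real.log N) * f x := by
    intro x
    have hz := ne_zero_of_im_ne_zero (latPt_im_ne_zero ((x.1.1 : ℝ) / N) hτ (x.2, 0))
    have h := wFun_real_mul hq s hN0 hz
    rw [abs_of_nonneg (by positivity)] at h
    simp only [hf]
    rw [← h]
    simp only [Function.comp, residueEquiv_apply, latPt]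
    congr 1
    push_cast
    field_simp
    ring
  refine hasSum_of_forall_eq (HasSum.mul_left _ ?_) hterm
  have hsum : Summable f := by
    refine Summable.of_norm ?_
    rw [summable_prod_of_nonneg (fun _ => norm_nonneg _)]
    exact ⟨fun r => summable_wFun hq hs (div_mem_Icc r.2) hτ, Summable.of_finite⟩
  have h1 := hsum.hasSum.prod_fiberwise fun r => hasSum_wFun hq hs (div_mem_Icc r.2) hτ
  have h2 := h1.unique (hasSum_fintype _)
  rw [latVal, ← Finset.sum_coe_sort, ← h2]
  exact hsum.hasSum

/-- Each pair is uniquely a positive integer g prime to N times a primitive one, and by homogeneity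
the sum over all pairs factors as `levelL` times the primitive sum. -/
lemma hasSum_bottomRow' {N : ℕ} (hN : 1 ≤ N) {q A : ℂ → ℂ} (hq : IsAngularFactor q A) {s : ℂ}
    (hs : 1 < s.re) (hL : levelL N s ≠ 0) {τ : ℂ} (hτ : 0 < τ.im) :
    HasSum (fun p : BottomRow' N => wFun q s (p.1.1 * τ + p.1.2))
      (Complex.exp (-2 * s * Real.log N) / levelL N s * latVal q A N s τ) := by
  set W : BottomRow' N → ℂ := fun p => wFun q s (p.1.1 * τ + p.1.2) with hW
  set E : PrimeTo N → ℂ := fun g => Complex.exp (-2 * s * Real.log (g : ℕ)) with hE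
  have h' : HasSum (fun x : PrimeTo N × BottomRow' N => E x.1 * W x.2)
      (Complex.exp (-2 * s * Real.log N) * latVal q A N s τ) := by
    refine hasSum_of_forall_eq ((gcdEquiv N).hasSum_iff.mpr (hasSum_levelPair hN hq hs hτ))
      fun x => ?_
    have hg : ((x.1 : ℕ) : ℝ) ≠ 0 := by exact_mod_cast x.1.2.1.ne'
    have hz : (x.2.1.1 * τ + x.2.1.2 : ℂ) ≠ 0 := by
      apply ne_zero_of_im_ne_zero
      simpa using ⟨x.2.2.1, hτ.ne'⟩
    have h := wFun_real_mul hq s hg hz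
    rw [abs_of_nonneg (by positivity)] at h
    simp only [hW, hE, Function.comp, gcdEquiv_apply]
    rw [← h]
    congr 1
    push_cast
    ring
  -- Summability over primitive rows is read off from the slice g = 1 of the double family.
  have hS : Summable W := by
    have := h'.summable.comp_injective (i := fun p : BottomRow' N =>
      ((⟨1, one_pos, Nat.coprime_one_left N⟩ : PrimeTo N), p)) (Prod.mk_right_injective _)
    refine this.congr fun p => ?_
    simp only [hE, Function.comp, Nat.cast_one, Real.log_one, Complex.ofReal_zero, mul_zero,
      Complex.exp_zero, one_mul]
  have h2 : HasSum (fun g => E g * ∑' p, W p)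
      (Complex.exp (-2 * s * Real.log N) * latVal q A N s τ) :=
    h'.prod_fiberwise fun g => hS.hasSum.mul_left (E g)
  have hE' : HasSum E (levelL N s) := (summable_levelL N (by linarith)).hasSum
  have h3 := h2.unique (hE'.mul_right (∑' p, W p))
  rw [div_mul_eq_mul_div, h3, mul_div_cancel_left₀ _ hL]
  exact hS.hasSum

/-- The only primitive rows with first entry 0 are (0, 1) and (0, -1); they contribute the 2. -/
lemma hasSum_bottomRow {N : ℕ} (hN : 1 ≤ N) {q A : ℂ → ℂ} (hq : IsAngularFactor q A) (hq1 : q 1 = 1)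
    {s : ℂ} (hs : 1 < s.re) (hL : levelL N s ≠ 0) {τ : ℂ} (hτ : 0 < τ.im) :
    HasSum (fun p : BottomRow N => wFun q s (p.1.1 * τ + p.1.2))
      (2 + Complex.exp (-2 * s * Real.log N) / levelL N s * latVal q A N s τ) := by
  classical
  have h := hasSum_bottomRow' hN hq hs hL hτ
  set W : ℤ × ℤ → ℂ := fun p => wFun q s (p.1 * τ + p.2) with hW
  set f₁ : ℤ × ℤ → ℂ := fun p => if p.1 ≠ 0 ∧ IsCoprime p.1 p.2 ∧ (N : ℤ) ∣ p.1 then W p else 0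
    with hf₁
  set f₀ : ℤ × ℤ → ℂ := fun p => if p.1 = 0 ∧ IsCoprime p.1 p.2 then W p else 0 with hf₀
  have h1 : HasSum f₁ (Complex.exp (-2 * s * Real.log N) / levelL N s * latVal q A N s τ) := by
    rw [← Function.Injective.hasSum_iff (Subtype.val_injective
      (p := fun p : ℤ × ℤ => p.1 ≠ 0 ∧ IsCoprime p.1 p.2 ∧ (N : ℤ) ∣ p.1))]
    · refine hasSum_of_forall_eq h fun p => ?_
      simp only [Function.comp, hf₁]
      rw [if_pos p.2]
    · intro p hp
      simp only [hf₁]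
      rw [if_neg fun h => hp ⟨⟨p, h⟩, rfl⟩]
  have h0 : HasSum f₀ 2 := by
    have hne : ((0 : ℤ), (1 : ℤ)) ≠ (0, -1) := by decide
    have : HasSum f₀ (∑ p ∈ {((0 : ℤ), (1 : ℤ)), (0, -1)}, f₀ p) :=
      hasSum_sum_of_ne_finset_zero (by
      rintro ⟨c, d⟩ hp
      simp only [hf₀]
      rw [if_neg]
      rintro ⟨hc, hcop⟩
      subst hc
      rw [isCoprime_zero_left, Int.isUnit_iff] at hcop
      apply hp
      rcases hcop with rfl | rfl <;> simp)
    have hw1 : W (0, 1) = 1 := by simp [hW, wFun, normPow, hq1]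
    have hw2 : W (0, -1) = 1 := by
      rw [← hw1]
      simp only [hW]
      rw [← wFun_neg hq]
      congr 1
      push_cast
      ring
    rw [Finset.sum_pair hne] at this
    have e1 : f₀ (0, 1) = 1 := by simp [hf₀, hw1, isCoprime_zero_left]
    have e2 : f₀ (0, -1) = 1 := by simp [hf₀, hw2, isCoprime_zero_left]
    rw [e1, e2] at this
    norm_num at this
    exact this
  have h2 := h0.add h1
  rw [← Function.Injective.hasSum_iff (Subtype.val_injective
      (p := fun p : ℤ × ℤ => IsCoprime p.1 p.2 ∧ (N : ℤ) ∣ p.1))] at h2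
  · refine hasSum_of_forall_eq h2 fun p => ?_
    simp only [Function.comp, hf₀, hf₁]
    by_cases hc : p.1.1 = 0
    · rw [if_pos ⟨hc, p.2.1⟩, if_neg (fun h => h.1 hc), add_zero]
    · rw [if_neg (fun h => hc h.1), if_pos ⟨hc, p.2⟩, zero_add]
  · intro p hp
    simp only [hf₀, hf₁]
    rw [if_neg, if_neg, add_zero]
    · exact fun h => hp ⟨⟨p, h.2⟩, rfl⟩
    · rintro ⟨h1, h2⟩
      exact hp ⟨⟨p, h2, by rw [h1]; exact dvd_zero _⟩, rfl⟩

/-- The factor in front of the lattice sums. -/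
def levelM (N : ℕ) (s : ℂ) : ℂ := Complex.exp (-2 * s * Real.log N) / (2 * levelL N s)

lemma hasSum_coset {N : ℕ} (hN : 1 ≤ N) {q A : ℂ → ℂ} (hq : IsAngularFactor q A) (hq1 : q 1 = 1)
    {s : ℂ} (hs : 1 < s.re) (hL : levelL N s ≠ 0) {τ : ℂ} (hτ : 0 < τ.im) :
    HasSum (fun c : Coset N => wFun q s ((cosetRow c).1 * τ + (cosetRow c).2))
      (1 + levelM N s * latVal q A N s τ) := by
  have h := hasSum_bottomRow hN hq hq1 hs hL hτ
  rw [← (cosetEquiv N).hasSum_iff] at h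
  have hterm : ∀ x : Coset N × ℤˣ,
      ((fun p : BottomRow N => wFun q s (p.1.1 * τ + p.1.2)) ∘ cosetEquiv N) x =
      wFun q s ((cosetRow x.1).1 * τ + (cosetRow x.1).2) := by
    rintro ⟨c, ε⟩
    simp only [Function.comp, cosetEquiv_apply]
    rcases Int.units_eq_one_or ε with rfl | rfl
    · simp
    · rw [← wFun_neg hq]
      congr 1
      push_cast
      ring
  have h' := (hasSum_of_forall_eq h fun x => (hterm x).symm).prod_fiberwise
    fun c => hasSum_fintype _
  have h2 := h'.mul_left (1 / 2 : ℂ)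
  have e : (1 / 2 : ℂ) * (2 + Complex.exp (-2 * s * Real.log N) / levelL N s * latVal q A N s τ) =
      1 + levelM N s * latVal q A N s τ := by
    rw [levelM]; field_simp
  rw [e] at h2
  refine hasSum_of_forall_eq h2 fun c => ?_
  simp only [Finset.sum_const, Finset.card_univ, Fintype.card_units_int]
  simp

lemma cosetRow_denom {N : ℕ} (c : Coset N) (τ : ℍ) : ((cosetRow c).1 * (τ : ℂ) + (cosetRow c).2) =
    denom ((c.out : SL(2, ℤ)) : GL (Fin 2) ℝ) τ := by
  rw [ModularGroup.denom_apply]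
  rfl

lemma im_smul_cpow (γ : SL(2, ℤ)) (τ : ℍ) (a : ℂ) : ((γ • τ).im : ℂ) ^ a =
    Complex.exp (a * Real.log τ.im) * Complex.exp (-2 * a * Real.log ‖denom γ τ‖) := by
  have hd : denom (γ : GL (Fin 2) ℝ) τ ≠ 0 := denom_ne_zero _ τ
  have h0 : (((γ • τ).im : ℝ) : ℂ) ≠ 0 := by exact_mod_cast (γ • τ).im_pos.ne'
  rw [Complex.cpow_def_of_ne_zero h0, ← Complex.ofReal_log (γ • τ).im_pos.le,
    ModularGroup.im_smul_eq_div_normSq, Complex.normSq_eq_norm_sq,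
    Real.log_div τ.im_pos.ne' (pow_ne_zero _ (norm_ne_zero_iff.mpr hd)), Real.log_pow,
    ← Complex.exp_add]
  push_cast
  ring_nf

lemma eisenstein_zero_eq {N : ℕ} (hN : 1 ≤ N) {s : ℂ} (hs : 1 < s.re) (hL : levelL N s ≠ 0) (τ : ℍ) :
    eisenstein N 0 τ s = Complex.exp (s * Real.log τ.im) *
      (1 + levelM N s * latVal (fun _ => 1) (fun _ => 0) N s τ) := by
  have h := (hasSum_coset hN isAngularFactor_one rfl hs hL τ.im_pos).mul_left
    (Complex.exp (s * Real.log τ.im))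
  rw [eisenstein, ← h.tsum_eq]
  refine tsum_congr fun c => ?_
  rw [ModularForm.SL_slash_apply]
  simp only [Int.cast_zero, zero_div, sub_zero, neg_zero, zpow_zero, mul_one]
  rw [im_smul_cpow]
  simp only [wFun, normPow, one_mul]
  erw [cosetRow_denom c τ]

/-- With z = cτ + d, slashing v^(s-1) in weight two yields |z|^(-2(s-1)) z^(-2), which equals (conj
z / z) |z|^(-2s). This is the origin of the angular factor `qTwo`. -/
lemma eisenstein_two_eq {N : ℕ} (hN : 1 ≤ N) {s : ℂ} (hs : 1 < s.re) (hL : levelL N s ≠ 0) (τ : ℍ) :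
    eisenstein N 2 τ s = Complex.exp ((s - 1) * Real.log τ.im) *
      (1 + levelM N s * latVal qTwo aTwo N s τ) := by
  have h := (hasSum_coset hN isAngularFactor_two (by simp [qTwo]) hs hL τ.im_pos).mul_left
    (Complex.exp ((s - 1) * Real.log τ.im))
  rw [eisenstein, ← h.tsum_eq]
  refine tsum_congr fun c => ?_
  rw [ModularForm.SL_slash_apply]
  have e : s - ((2 : ℤ) : ℂ) / 2 = s - 1 := by norm_num
  simp only [e]
  rw [im_smul_cpow, mul_assoc]
  congr 1
  erw [cosetRow_denom c τ]
  set z := denom ((c.out : SL(2, ℤ)) : GL (Fin 2) ℝ) τ with hz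
  have hd : z ≠ 0 := denom_ne_zero _ τ
  have h2 : Complex.exp (2 * Real.log ‖z‖) = z * conj z := by
    rw [Complex.mul_conj, Complex.normSq_eq_norm_sq, show (2 * Real.log ‖z‖ : ℂ) =
      ((Real.log ‖z‖ + Real.log ‖z‖ : ℝ) : ℂ) by push_cast; ring, ← Complex.ofReal_exp,
      Real.exp_add, Real.exp_log (norm_pos_iff.mpr hd)]
    push_cast
    ring
  have h3 : Complex.exp (-2 * (s - 1) * Real.log ‖z‖) =
      normPow s z * Complex.exp (2 * Real.log ‖z‖) := by
    rw [normPow, ← Complex.exp_add]; ring_nf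
  rw [h3, h2, wFun, qTwo]
  have : z ^ (-2 : ℤ) = z⁻¹ * z⁻¹ := by
    rw [zpow_neg, ← mul_inv]; norm_cast; rw [sq]
  rw [this]
  field_simp

/-! ### Wirtinger derivatives -/

/-- The real linear map `v ↦ P v + Q conj v`. -/
def wirt (P Q : ℂ) : ℂ →L[ℝ] ℂ :=
  P • ContinuousLinearMap.id ℝ ℂ + Q • (Complex.conjCLE : ℂ →L[ℝ] ℂ)

@[simp] lemma wirt_apply (P Q v : ℂ) : wirt P Q v = P * v + Q * conj v := rfl

lemma wirt_dbar (P Q : ℂ) : wirt P Q 1 + Complex.I * wirt P Q Complex.I = 2 * Q := by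
  simp only [wirt_apply, map_one, Complex.conj_I]
  linear_combination (P - Q) * Complex.I_mul_I

lemma norm_wirt_le (P Q : ℂ) : ‖wirt P Q‖ ≤ ‖P‖ + ‖Q‖ := by
  refine ContinuousLinearMap.opNorm_le_bound _ (by positivity) fun v => ?_
  rw [wirt_apply]
  refine (norm_add_le _ _).trans ?_
  rw [norm_mul, norm_mul, RCLike.norm_conj]
  linarith

lemma continuousOn_wirt {P Q : ℂ → ℂ} {s : Set ℂ} (hP : ContinuousOn P s) (hQ : ContinuousOn Q s) :
    ContinuousOn (fun z => wirt (P z) (Q z)) s :=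
  (hP.smul continuousOn_const).add (hQ.smul continuousOn_const)

/-- `P = ∂f/∂z` and `Q = ∂f/∂(conj z)`. -/
def HasWirt (f : ℂ → ℂ) (P Q z : ℂ) : Prop := HasFDerivAt f (wirt P Q) z

lemma HasWirt.congr {f : ℂ → ℂ} {P Q P' Q' z : ℂ} (h : HasWirt f P Q z) (hP : P = P') (hQ : Q = Q') :
    HasWirt f P' Q' z := by
  subst hP hQ
  exact h

lemma HasWirt.add {f g : ℂ → ℂ} {P Q P' Q' z : ℂ} (hf : HasWirt f P Q z) (hg : HasWirt g P' Q' z) :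
    HasWirt (fun z => f z + g z) (P + P') (Q + Q') z := by
  refine (HasFDerivAt.fun_add hf hg).congr_fderiv (ContinuousLinearMap.ext fun v => ?_)
  change wirt P Q v + wirt P' Q' v = _
  simp only [wirt_apply]
  ring

lemma HasWirt.mul {f g : ℂ → ℂ} {P Q P' Q' z : ℂ} (hf : HasWirt f P Q z) (hg : HasWirt g P' Q' z) :
    HasWirt (fun z => f z * g z) (P * g z + f z * P') (Q * g z + f z * Q') z := by
  refine (HasFDerivAt.fun_mul hf hg).congr_fderiv (ContinuousLinearMap.ext fun v => ?_)
  change f z * wirt P' Q' v + g z * wirt P Q v = _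
  simp only [wirt_apply]
  ring

lemma hasWirt_const (c z : ℂ) : HasWirt (fun _ => c) 0 0 z := by
  refine (hasFDerivAt_const c z).congr_fderiv (ContinuousLinearMap.ext fun v => ?_)
  simp

lemma HasWirt.const_mul {f : ℂ → ℂ} {P Q z : ℂ} (c : ℂ) (hf : HasWirt f P Q z) :
    HasWirt (fun z => c * f z) (c * P) (c * Q) z :=
  ((hasWirt_const c z).mul hf).congr (by ring) (by ring)

lemma hasWirt_of_hasDerivAt {f : ℂ → ℂ} {d z : ℂ} (h : HasDerivAt f d z) : HasWirt f d 0 z := by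
  refine (h.hasFDerivAt.restrictScalars ℝ).congr_fderiv (ContinuousLinearMap.ext fun v => ?_)
  simp [mul_comm]

lemma hasWirt_inv {z : ℂ} (hz : z ≠ 0) : HasWirt (fun z => z⁻¹) (-(z⁻¹ * z⁻¹)) 0 z :=
  (hasWirt_of_hasDerivAt (hasDerivAt_inv hz)).congr (by rw [sq, mul_inv]) rfl

lemma hasWirt_conj_inv {z : ℂ} (hz : z ≠ 0) :
    HasWirt (fun z => (conj z)⁻¹) 0 (-((conj z)⁻¹ * (conj z)⁻¹)) z := by
  have h1 : HasFDerivAt (fun z : ℂ => conj z) (Complex.conjCLE : ℂ →L[ℝ] ℂ) z :=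
    (Complex.conjCLE : ℂ →L[ℝ] ℂ).hasFDerivAt
  have h2 : HasFDerivAt (fun z : ℂ => z⁻¹) (wirt (-((conj z)⁻¹ * (conj z)⁻¹)) 0) (conj z) :=
    hasWirt_inv ((map_ne_zero _).mpr hz)
  refine (h2.comp z h1).congr_fderiv (ContinuousLinearMap.ext fun v => ?_)
  change wirt (-((conj z)⁻¹ * (conj z)⁻¹)) 0 (conj v) = _
  simp only [wirt_apply]
  ring

lemma hasWirt_ofReal_comp {f : ℂ → ℝ} {h : ℝ → ℝ} {L : ℂ →L[ℝ] ℝ} {h' : ℝ} {z P Q : ℂ}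
    (hf : HasFDerivAt f L z) (hh : HasDerivAt h h' (f z))
    (hL : ∀ v, (((h' * L v) : ℝ) : ℂ) = P * v + Q * conj v) :
    HasWirt (fun z => ((h (f z) : ℝ) : ℂ)) P Q z := by
  have h1 := Complex.ofRealCLM.hasFDerivAt.comp z (hh.hasFDerivAt.comp z hf)
  refine h1.congr_fderiv (ContinuousLinearMap.ext fun v => ?_)
  rw [wirt_apply, ← hL]
  simp [mul_comm]

lemma hasWirt_log_norm {z : ℂ} (hz : z ≠ 0) :
    HasWirt (fun z => (Real.log ‖z‖ : ℂ)) (2⁻¹ * z⁻¹) (2⁻¹ * (conj z)⁻¹) z := by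
  have e : ∀ z : ℂ, Real.log ‖z‖ = (fun x => 2⁻¹ * Real.log x) (z.re * z.re + z.im * z.im) := by
    intro z
    simp only
    rw [← Complex.normSq_apply, Complex.normSq_eq_norm_sq, Real.log_pow]
    push_cast
    ring
  have hre : HasFDerivAt Complex.re Complex.reCLM z := Complex.reCLM.hasFDerivAt
  have him : HasFDerivAt Complex.im Complex.imCLM z := Complex.imCLM.hasFDerivAt
  have hN : z.re * z.re + z.im * z.im ≠ 0 := by
    rw [← Complex.normSq_apply]; exact (Complex.normSq_pos.mpr hz).ne'
  simp only [e]
  refine hasWirt_ofReal_comp (f := fun z : ℂ => z.re * z.re + z.im * z.im)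
    (h := fun x => 2⁻¹ * Real.log x) ((hre.fun_mul hre).fun_add (him.fun_mul him))
    ((Real.hasDerivAt_log hN).const_mul 2⁻¹) fun v => ?_
  have h5 : z * conj z = ((z.re * z.re + z.im * z.im : ℝ) : ℂ) := by
    rw [Complex.mul_conj, Complex.normSq_apply]
  have hz' : conj z ≠ 0 := (map_ne_zero _).mpr hz
  have h7 : (2⁻¹ * z⁻¹ * v + 2⁻¹ * (conj z)⁻¹ * conj v : ℂ) =
      2⁻¹ * (z * conj z)⁻¹ * (conj z * v + z * conj v) := by
    field_simp
  rw [h7, h5]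
  have h8 : conj z * v + z * conj v = ((2 * (z.re * v.re + z.im * v.im) : ℝ) : ℂ) := by
    apply Complex.ext <;> simp <;> ring
  rw [h8]
  rw [← Complex.ofReal_inv, show ((2 : ℂ)⁻¹) = ((2⁻¹ : ℝ) : ℂ) by push_cast; rfl,
    ← Complex.ofReal_mul, ← Complex.ofReal_mul]
  congr 1
  change 2⁻¹ * (z.re * z.re + z.im * z.im)⁻¹ *
    (z.re * v.re + z.re * v.re + (z.im * v.im + z.im * v.im)) = _
  ring

lemma hasWirt_im_comp {h : ℝ → ℝ} {h' : ℝ} {z : ℂ} (hh : HasDerivAt h h' z.im) :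
    HasWirt (fun z => ((h z.im : ℝ) : ℂ)) (-(Complex.I / 2) * h') (Complex.I / 2 * h') z := by
  have him : HasFDerivAt Complex.im Complex.imCLM z := Complex.imCLM.hasFDerivAt
  refine hasWirt_ofReal_comp him hh fun v => ?_
  have : v - conj v = (2 * v.im : ℝ) * Complex.I := Complex.sub_conj v
  push_cast at this
  simp only [Complex.imCLM_apply, Complex.ofReal_mul]
  linear_combination (Complex.I / 2 * h') * this + (h' * v.im) * Complex.I_mul_I

/-! ### The kernels at `s = 1` -/

lemma normPow_one {z : ℂ} (hz : z ≠ 0) : normPow 1 z = z⁻¹ * (conj z)⁻¹ := by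
  rw [normPow, show (-2 * 1 * Real.log ‖z‖ : ℂ) = ((-(Real.log ‖z‖ + Real.log ‖z‖) : ℝ) : ℂ) by
    push_cast; ring, ← Complex.ofReal_exp, Real.exp_neg, Real.exp_add,
    Real.exp_log (norm_pos_iff.mpr hz), ← sq, ← Complex.normSq_eq_norm_sq, Complex.ofReal_inv,
    ← Complex.mul_conj, mul_inv]

lemma kFun_zero_one {z : ℂ} (hz : z ≠ 0) : kFun (fun _ => 1) (fun _ => 0) 1 z =
    -(z⁻¹ * z⁻¹ * (conj z)⁻¹ + z⁻¹ * ((conj z)⁻¹ * (conj z)⁻¹)) := by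
  rw [kFun, normPow_one hz]
  ring

/-- At s = 1 the summand (conj z / z)|z|^(-2) is z^(-2), whose derivative is holomorphic. Hence the
kernel sum contributes nothing to the conjugate derivative. -/
lemma kFun_two_one {z : ℂ} (hz : z ≠ 0) : kFun qTwo aTwo 1 z = -2 * (z⁻¹ * (z⁻¹ * z⁻¹)) := by
  have hz' : conj z ≠ 0 := (map_ne_zero _).mpr hz
  rw [kFun, normPow_one hz, qTwo, aTwo]
  field_simp
  ring

lemma kFunDeriv_two_one {z : ℂ} (hz : z ≠ 0) : kFunDeriv qTwo aTwo 1 z =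
    4 * (Real.log ‖z‖ * (z⁻¹ * (z⁻¹ * z⁻¹))) +
      (-1 * (z⁻¹ * (z⁻¹ * z⁻¹)) + -1 * (z⁻¹ * z⁻¹ * (conj z)⁻¹)) := by
  have hz' : conj z ≠ 0 := (map_ne_zero _).mpr hz
  rw [kFunDeriv, normPow_one hz, qTwo, aTwo]
  field_simp
  ring

lemma hasWirt_congr_of_im_ne_zero {f g : ℂ → ℂ} {P Q z : ℂ} (hz : z.im ≠ 0)
    (h : ∀ z : ℂ, z ≠ 0 → f z = g z) (hg : HasWirt g P Q z) : HasWirt f P Q z := by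
  refine HasFDerivAt.congr_of_eventuallyEq hg ?_
  filter_upwards [isOpen_ne.mem_nhds (ne_zero_of_im_ne_zero hz)] with w hw using h w hw

lemma hasWirt_inv_cube {z : ℂ} (hz : z ≠ 0) :
    HasWirt (fun z => z⁻¹ * (z⁻¹ * z⁻¹)) (-3 * (z⁻¹ * z⁻¹ * (z⁻¹ * z⁻¹))) 0 z :=
  ((hasWirt_inv hz).mul ((hasWirt_inv hz).mul (hasWirt_inv hz))).congr (by ring) (by ring)

lemma hasWirt_kFun_two {z : ℂ} (hz : z.im ≠ 0) :
    HasWirt (kFun qTwo aTwo 1) (6 * (z⁻¹ * z⁻¹ * (z⁻¹ * z⁻¹))) 0 z := by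
  refine hasWirt_congr_of_im_ne_zero hz (fun z hz => kFun_two_one hz) ?_
  exact ((hasWirt_inv_cube (ne_zero_of_im_ne_zero hz)).const_mul (-2)).congr (by ring) (by ring)

lemma hasWirt_kFunDeriv_two {z : ℂ} (hz : z.im ≠ 0) :
    HasWirt (kFunDeriv qTwo aTwo 1)
      (5 * (z⁻¹ * z⁻¹ * (z⁻¹ * z⁻¹)) + 2 * (z⁻¹ * z⁻¹ * (z⁻¹ * (conj z)⁻¹)) -
        12 * Real.log ‖z‖ * (z⁻¹ * z⁻¹ * (z⁻¹ * z⁻¹)))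
      (2 * (z⁻¹ * z⁻¹ * (z⁻¹ * (conj z)⁻¹)) + z⁻¹ * z⁻¹ * ((conj z)⁻¹ * (conj z)⁻¹)) z := by
  have h0 := ne_zero_of_im_ne_zero hz
  refine hasWirt_congr_of_im_ne_zero hz (fun z hz => kFunDeriv_two_one hz) ?_
  have h1 := ((hasWirt_log_norm h0).mul (hasWirt_inv_cube h0)).const_mul 4
  have h2 := (hasWirt_inv_cube h0).const_mul (-1)
  have h3 := (((hasWirt_inv h0).mul (hasWirt_inv h0)).mul (hasWirt_conj_inv h0)).const_mul (-1)
  exact (h1.add (h2.add h3)).congr (by ring) (by ring)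

/-- Half a power of x is spent on the logarithm. This is affordable: the exponents 5/2 and 7/2 that
remain still exceed the thresholds 2 and 3 of `hasFDerivAt_kerSum`. -/
lemma exists_log_bound {δ : ℝ} (hδ : 0 < δ) :
    ∃ C ≥ 0, ∀ x : ℝ, δ ≤ x → 1 + |Real.log x| ≤ C * x ^ (1 / 2 : ℝ) := by
  refine ⟨(δ ^ (1 / 2 : ℝ))⁻¹ + 2 + 2 * (δ ^ (1 / 2 : ℝ))⁻¹ * (δ ^ (1 / 2 : ℝ))⁻¹, by positivity,
    fun x hx => ?_⟩
  have hx0 : 0 < x := hδ.trans_le hx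
  have hd : 0 < δ ^ (1 / 2 : ℝ) := by positivity
  have hmono : δ ^ (1 / 2 : ℝ) ≤ x ^ (1 / 2 : ℝ) := Real.rpow_le_rpow hδ.le hx (by norm_num)
  have h1 : Real.log x ≤ 2 * x ^ (1 / 2 : ℝ) := by
    have := Real.log_le_rpow_div hx0.le (ε := 1 / 2) (by norm_num)
    linarith
  have h2 : -Real.log x ≤ 2 * (δ ^ (1 / 2 : ℝ))⁻¹ := by
    have := Real.log_le_rpow_div (inv_nonneg.mpr hx0.le) (ε := 1 / 2) (by norm_num)
    rw [Real.log_inv, Real.inv_rpow hx0.le] at this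
    have h3 := inv_anti₀ hd hmono
    linarith
  have h3 : |Real.log x| ≤ 2 * x ^ (1 / 2 : ℝ) + 2 * (δ ^ (1 / 2 : ℝ))⁻¹ :=
    abs_le'.mpr ⟨by have := inv_pos.mpr hd; linarith,
      by have := Real.rpow_nonneg hx0.le (1 / 2); linarith⟩
  have h4 : 1 ≤ (δ ^ (1 / 2 : ℝ))⁻¹ * x ^ (1 / 2 : ℝ) := by
    rw [← div_eq_inv_mul, one_le_div hd]; exact hmono
  have h5 : 2 * (δ ^ (1 / 2 : ℝ))⁻¹ * 1 ≤
      2 * (δ ^ (1 / 2 : ℝ))⁻¹ * ((δ ^ (1 / 2 : ℝ))⁻¹ * x ^ (1 / 2 : ℝ)) := by gcongr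
  nlinarith

/-- Functions bounded by a multiple of `(1 + |log |z||) |z| ^ (-n)` decay like `|z| ^ (1/2 - n)`. -/
lemma decaysWith_of_log_bound {E : Type*} [Norm E] {G : ℂ → E} {n : ℕ} {B : ℝ} (hB : 0 ≤ B)
    (h : ∀ z : ℂ, z.im ≠ 0 → ‖G z‖ ≤ B * (1 + |Real.log ‖z‖|) * ‖z‖⁻¹ ^ n) :
    DecaysWith (n - 1 / 2) G := by
  intro δ hδ
  obtain ⟨C, hC, hCb⟩ := exists_log_bound hδ
  refine ⟨B * C, by positivity, fun z hz him => (h z him).trans ?_⟩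
  have hz0 : 0 < ‖z‖ := hδ.trans_le hz
  calc B * (1 + |Real.log ‖z‖|) * ‖z‖⁻¹ ^ n ≤ B * (C * ‖z‖ ^ (1 / 2 : ℝ)) * ‖z‖⁻¹ ^ n := by
        gcongr; exact hCb _ hz
    _ = B * C * ‖z‖ ^ (-((n : ℝ) - 1 / 2)) := by
        rw [show -((n : ℝ) - 1 / 2) = 1 / 2 + -n by ring, Real.rpow_add hz0, Real.rpow_neg hz0.le,
          Real.rpow_natCast, inv_pow]
        ring

lemma decaysWith_kFunDeriv_two : DecaysWith (((3 : ℕ) : ℝ) - 1 / 2) (kFunDeriv qTwo aTwo 1) := by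
  refine decaysWith_of_log_bound (B := 4) (by norm_num) fun z hz => ?_
  rw [kFunDeriv_two_one (ne_zero_of_im_ne_zero hz)]
  refine (norm_add_le _ _).trans ((add_le_add_right (norm_add_le _ _) _).trans ?_)
  simp only [norm_mul, norm_inv, norm_neg, RCLike.norm_conj, Complex.norm_real, norm_one,
    Real.norm_eq_abs, Complex.norm_ofNat]
  have : 0 ≤ |Real.log ‖z‖| * ‖z‖⁻¹ ^ 3 := by positivity
  have : 0 ≤ ‖z‖⁻¹ ^ 3 := by positivity
  nlinarith

lemma decaysWith_wirt_kFunDeriv_two : DecaysWith (((4 : ℕ) : ℝ) - 1 / 2) (fun z : ℂ => wirt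
      (5 * (z⁻¹ * z⁻¹ * (z⁻¹ * z⁻¹)) + 2 * (z⁻¹ * z⁻¹ * (z⁻¹ * (conj z)⁻¹)) -
        12 * Real.log ‖z‖ * (z⁻¹ * z⁻¹ * (z⁻¹ * z⁻¹)))
      (2 * (z⁻¹ * z⁻¹ * (z⁻¹ * (conj z)⁻¹)) + z⁻¹ * z⁻¹ * ((conj z)⁻¹ * (conj z)⁻¹))) := by
  refine decaysWith_of_log_bound (B := 12) (by norm_num) fun z hz => ?_
  refine (norm_wirt_le _ _).trans ?_
  refine (add_le_add ((norm_sub_le _ _).trans (add_le_add_left (norm_add_le _ _) _))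
    (norm_add_le _ _)).trans ?_
  simp only [norm_mul, norm_inv, RCLike.norm_conj, Complex.norm_real,
    Real.norm_eq_abs, Complex.norm_ofNat]
  have : 0 ≤ ‖z‖⁻¹ ^ 4 := by positivity
  nlinarith

lemma decaysWith_kFun_two : DecaysWith (((3 : ℕ) : ℝ) - 1 / 2) (kFun qTwo aTwo 1) := by
  refine decaysWith_of_log_bound (B := 2) (by norm_num) fun z hz => ?_
  rw [kFun_two_one (ne_zero_of_im_ne_zero hz)]
  simp only [norm_mul, norm_inv, norm_neg, Complex.norm_ofNat]
  have : 0 ≤ |Real.log ‖z‖| * ‖z‖⁻¹ ^ 3 := by positivity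
  nlinarith

lemma decaysWith_wirt_kFun_two : DecaysWith (((4 : ℕ) : ℝ) - 1 / 2) (fun z : ℂ => wirt
      (6 * (z⁻¹ * z⁻¹ * (z⁻¹ * z⁻¹))) 0) := by
  refine decaysWith_of_log_bound (B := 6) (by norm_num) fun z hz => ?_
  refine (norm_wirt_le _ _).trans ?_
  simp only [norm_mul, norm_inv, Complex.norm_ofNat, norm_zero]
  have : 0 ≤ |Real.log ‖z‖| * ‖z‖⁻¹ ^ 4 := by positivity
  nlinarith

lemma continuousOn_inv_im : ContinuousOn (fun z : ℂ => z⁻¹) {z | z.im ≠ 0} := fun _ hz =>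
  (continuousAt_inv₀ (ne_zero_of_im_ne_zero hz)).continuousWithinAt

lemma continuousOn_conj_inv_im : ContinuousOn (fun z : ℂ => (conj z)⁻¹) {z | z.im ≠ 0} :=
  fun _ hz => (Complex.continuous_conj.continuousAt.inv₀
    ((map_ne_zero _).mpr (ne_zero_of_im_ne_zero hz))).continuousWithinAt

lemma continuousOn_log_norm : ContinuousOn (fun z : ℂ => (Real.log ‖z‖ : ℂ)) {z | z.im ≠ 0} :=
  fun _ hz => (Complex.continuous_ofReal.continuousAt.comp (continuous_norm.continuousAt.log
    (norm_ne_zero_iff.mpr (ne_zero_of_im_ne_zero hz)))).continuousWithinAt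

/-! ### Wirtinger derivatives of the kernel sums -/

lemma hasWirt_of_fderiv {f : ℂ → ℂ} {L : ℂ →L[ℝ] ℂ} {z : ℂ} (h : HasFDerivAt f L z) :
    ∃ P, HasWirt f P ((L 1 + Complex.I * L Complex.I) / 2) z := by
  refine ⟨(L 1 - Complex.I * L Complex.I) / 2,
    h.congr_fderiv (ContinuousLinearMap.ext fun v => ?_)⟩
  have hv : v = v.re • (1 : ℂ) + v.im • Complex.I := by
    apply Complex.ext <;> simp
  rw [wirt_apply]
  conv_lhs => rw [hv]
  rw [map_add, map_smul, map_smul, Complex.real_smul, Complex.real_smul]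
  have h1 : v + conj v = 2 * v.re := by rw [Complex.add_conj]; push_cast; ring
  have h2 : v - conj v = 2 * v.im * Complex.I := by rw [Complex.sub_conj]; push_cast; ring
  linear_combination (-(L 1) / 2) * h1 + (Complex.I * L Complex.I / 2) * h2 +
    (L Complex.I * v.im) * Complex.I_mul_I

lemma hasWirt_kerSum_kFun_two {α : ℝ} (hα : α ∈ Set.Icc (0 : ℝ) 1) {τ : ℂ} (hτ : 0 < τ.im) :
    ∃ P, HasWirt (kerSum (kFun qTwo aTwo 1) α) P 0 τ := by
  have hc : ContinuousOn (fun z : ℂ => wirt (6 * (z⁻¹ * z⁻¹ * (z⁻¹ * z⁻¹))) 0) {z | z.im ≠ 0} := by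
    have h1 := continuousOn_inv_im
    exact continuousOn_wirt (continuousOn_const.mul ((h1.mul h1).mul (h1.mul h1)))
      continuousOn_const
  obtain ⟨L, hL, hL2⟩ := hasFDerivAt_kerSum (by norm_num) (by norm_num)
    (fun z hz => hasWirt_kFun_two hz) hc decaysWith_kFun_two decaysWith_wirt_kFun_two hα hτ
  obtain ⟨P, hP⟩ := hasWirt_of_fderiv hL
  refine ⟨P, hP.congr rfl ?_⟩
  rw [hL2]
  simp only [wirt_dbar, mul_zero, integral_zero, zero_div]

/-- The identity holds term by term. The chain rule in τ multiplies the conjugate derivative 2z^(-3)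
(conj z)^(-1) + z^(-2) (conj z)^(-2) by m, and m = (z - conj z) / (2iv) because mv is the imaginary
part of z. Expanding the product gives exactly i/(2v) times the difference of the weight-zero and
weight-two kernels at s = 1. -/
lemma hasWirt_kerSum_kFunDeriv_two {α : ℝ} (hα : α ∈ Set.Icc (0 : ℝ) 1) {τ : ℂ} (hτ : 0 < τ.im) :
    ∃ P, HasWirt (kerSum (kFunDeriv qTwo aTwo 1) α) P (Complex.I / 2 / τ.im *
      (kerSum (kFun (fun _ => 1) (fun _ => 0) 1) α τ - kerSum (kFun qTwo aTwo 1) α τ)) τ := by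
  have hc : ContinuousOn (fun z : ℂ => wirt
      (5 * (z⁻¹ * z⁻¹ * (z⁻¹ * z⁻¹)) + 2 * (z⁻¹ * z⁻¹ * (z⁻¹ * (conj z)⁻¹)) -
        12 * Real.log ‖z‖ * (z⁻¹ * z⁻¹ * (z⁻¹ * z⁻¹)))
      (2 * (z⁻¹ * z⁻¹ * (z⁻¹ * (conj z)⁻¹)) + z⁻¹ * z⁻¹ * ((conj z)⁻¹ * (conj z)⁻¹)))
      {z | z.im ≠ 0} := by
    have h1 := continuousOn_inv_im
    have h2 := continuousOn_conj_inv_im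
    have h3 := continuousOn_log_norm
    exact continuousOn_wirt (((continuousOn_const.mul ((h1.mul h1).mul (h1.mul h1))).add
      (continuousOn_const.mul ((h1.mul h1).mul (h1.mul h2)))).sub
      ((continuousOn_const.mul h3).mul ((h1.mul h1).mul (h1.mul h1))))
      ((continuousOn_const.mul ((h1.mul h1).mul (h1.mul h2))).add
        ((h1.mul h1).mul (h2.mul h2)))
  obtain ⟨L, hL, hL2⟩ := hasFDerivAt_kerSum (by norm_num) (by norm_num)
    (fun z hz => hasWirt_kFunDeriv_two hz) hc decaysWith_kFunDeriv_two
    decaysWith_wirt_kFunDeriv_two hα hτ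
  obtain ⟨P, hP⟩ := hasWirt_of_fderiv hL
  refine ⟨P, hP.congr rfl ?_⟩
  have hi1 := integrable_kernel (a := 2 * (1 : ℂ).re + 1) (by norm_num)
    (continuousOn_kFun isAngularFactor_one 1) (decaysWith_kFun isAngularFactor_one 1) hα hτ
  have hi2 := integrable_kernel (a := 2 * (1 : ℂ).re + 1) (by norm_num)
    (continuousOn_kFun isAngularFactor_two 1) (decaysWith_kFun isAngularFactor_two 1) hα hτ
  rw [hL2, kerSum, kerSum, ← integral_sub hi1 hi2, ← integral_const_mul, ← integral_div]
  refine integral_congr_ae (Eventually.of_forall fun x => ?_)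
  simp only [wirt_dbar]
  have hz0 := ne_zero_of_im_ne_zero (latPt_im_ne_zero α hτ x)
  have hz1 : conj (latPt α τ x) ≠ 0 := (map_ne_zero _).mpr hz0
  rw [kFun_zero_one hz0, kFun_two_one hz0]
  have hv : (τ.im : ℂ) ≠ 0 := Complex.ofReal_ne_zero.mpr hτ.ne'
  have hm : (x.1.1.1 : ℂ) = -(Complex.I / 2) / τ.im *
      (latPt α τ x - conj (latPt α τ x)) := by
    have h := Complex.sub_conj (latPt α τ x)
    rw [latPt_im] at h
    rw [h]
    push_cast
    field_simp
    rw [Complex.I_sq]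
    ring
  rw [hm]
  field_simp
  ring

/-! ### Laurent expansions of the Eisenstein series -/

/-- The entire part of `(s - 1) ζ(2 s - 1)` near `s = 1`. -/
def zetaReg : ℂ → ℂ := Function.update (fun s => (s - 1) * riemannZeta (2 * s - 1)) 1 (1 / 2)

lemma zetaReg_of_ne {s : ℂ} (hs : s ≠ 1) : zetaReg s = (s - 1) * riemannZeta (2 * s - 1) := by
  rw [zetaReg, Function.update_of_ne hs]

/-- The pole of ζ(2s-1) at s = 1 has residue 1/2, since 2s - 1 moves at double speed. So the
prescribed value makes the function continuous and the singularity is removable. -/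
lemma analyticAt_zetaReg : AnalyticAt ℂ zetaReg 1 := by
  refine Complex.analyticAt_of_differentiable_on_punctured_nhds_of_continuousAt ?_ ?_
  · filter_upwards [self_mem_nhdsWithin] with s hs
    have hs' : s ≠ 1 := hs
    have h1 : 2 * s - 1 ≠ 1 := fun h => hs' (by linear_combination h / 2)
    have : DifferentiableAt ℂ (fun s => (s - 1) * riemannZeta (2 * s - 1)) s := by
      refine DifferentiableAt.mul (by fun_prop) ?_
      exact (differentiableAt_riemannZeta h1).comp s (f := fun s => 2 * s - 1) (by fun_prop)
    refine this.congr_of_eventuallyEq ?_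
    filter_upwards [isOpen_ne.mem_nhds hs'] with w hw using zetaReg_of_ne hw
  · rw [zetaReg, continuousAt_update_same]
    have h1 : Tendsto (fun s : ℂ => 2 * s - 1) (𝓝[≠] 1) (𝓝[≠] 1) := by
      refine tendsto_nhdsWithin_of_tendsto_nhds_of_eventually_within _ ?_ ?_
      · refine Tendsto.mono_left ?_ nhdsWithin_le_nhds
        have : Continuous fun s : ℂ => 2 * s - 1 := by fun_prop
        convert this.tendsto 1 using 2
        norm_num
      · filter_upwards [self_mem_nhdsWithin] with s hs
        exact fun h => hs (by
          have h' : 2 * s - 1 = 1 := h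
          exact Set.mem_singleton_iff.mpr (by linear_combination h' / 2))
    have h2 := (riemannZeta_residue_one.comp h1).const_mul (1 / 2 : ℂ)
    rw [mul_one] at h2
    refine h2.congr fun s => ?_
    simp only [Function.comp]
    ring

/-- `2 (s - 1) ζ(2 s - 1)` times the beta integral of weight zero. -/
def polH (s : ℂ) : ℂ := 2 * zetaReg s * betaInt (fun _ => 1) s

lemma analyticAt_of_differentiable {f : ℂ → ℂ}
    (h : ∀ s : ℂ, 3 / 4 < s.re → DifferentiableAt ℂ f s) : AnalyticAt ℂ f 1 := by
  have hopen : IsOpen {s : ℂ | 3 / 4 < s.re} := isOpen_lt continuous_const Complex.continuous_re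
  refine DifferentiableOn.analyticAt (s := {s : ℂ | 3 / 4 < s.re})
    (fun s hs => (h s hs).differentiableWithinAt) (hopen.mem_nhds ?_)
  norm_num

lemma analyticAt_polH : AnalyticAt ℂ polH 1 := by
  refine (analyticAt_const.mul analyticAt_zetaReg).mul (analyticAt_of_differentiable fun s hs => ?_)
  exact differentiableAt_betaInt isAngularFactor_one (by linarith)

lemma analyticAt_levelM (N : ℕ) : AnalyticAt ℂ (levelM N) 1 := by
  refine AnalyticAt.div (analyticAt_of_differentiable fun s _ => by fun_prop)
    (analyticAt_const.mul (analyticAt_of_differentiable fun s hs => differentiableAt_levelL N hs)) ?_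
  simpa using levelL_one_ne_zero N

/-- The part of the lattice sums which is holomorphic for `Re s > 1/2`. -/
def diffSum (q A : ℂ → ℂ) (N : ℕ) (s τ : ℂ) : ℂ :=
  ∑ r ∈ residues N, kerSum (kFun q A s) ((r : ℝ) / N) τ

/-- The derivative of `diffSum` in `s`. -/
def diffSumDeriv (q A : ℂ → ℂ) (N : ℕ) (s τ : ℂ) : ℂ :=
  ∑ r ∈ residues N, kerSum (kFunDeriv q A s) ((r : ℝ) / N) τ

lemma hasDerivAt_diffSum {q A : ℂ → ℂ} (hq : IsAngularFactor q A) (N : ℕ) {s τ : ℂ}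
    (hs : 1 / 2 < s.re) (hτ : 0 < τ.im) :
    HasDerivAt (fun s => diffSum q A N s τ) (diffSumDeriv q A N s τ) s :=
  HasDerivAt.fun_sum fun _ hr => hasDerivAt_kerSum_kFun hq (div_mem_Icc hr) hτ hs

lemma analyticAt_diffSum {q A : ℂ → ℂ} (hq : IsAngularFactor q A) (N : ℕ) {τ : ℂ}
    (hτ : 0 < τ.im) : AnalyticAt ℂ (fun s => diffSum q A N s τ) 1 :=
  analyticAt_of_differentiable fun _ hs =>
    (hasDerivAt_diffSum hq N (by linarith) hτ).differentiableAt

/-- `(s - 1)` times the Eisenstein series of weight zero. -/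
def eisZeroNum (N : ℕ) (τ s : ℂ) : ℂ :=
  Complex.exp (s * Real.log τ.im) * ((s - 1) * (1 + levelM N s *
      diffSum (fun _ => 1) (fun _ => 0) N s τ)) +
    levelM N s * ((residues N).card * (Complex.exp ((1 - s) * Real.log τ.im) * polH s))

/-- The Eisenstein series of weight two. -/
def eisTwo (N : ℕ) (τ s : ℂ) : ℂ :=
  Complex.exp ((s - 1) * Real.log τ.im) * (1 + levelM N s * diffSum qTwo aTwo N s τ) -
    levelM N s * ((residues N).card * (Complex.exp (-s * Real.log τ.im) * (polH s / s)))

lemma eventually_levelL_ne_zero (N : ℕ) :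
    ∀ᶠ s in 𝓝[{s : ℂ | 1 < s.re}] 1, 1 < s.re ∧ levelL N s ≠ 0 ∧ s ≠ 1 ∧ s ≠ 0 := by
  have h1 : ∀ᶠ s in 𝓝 (1 : ℂ), levelL N s ≠ 0 :=
    (differentiableAt_levelL N (by norm_num)).continuousAt.eventually_ne (levelL_one_ne_zero N)
  filter_upwards [self_mem_nhdsWithin, nhdsWithin_le_nhds h1] with s hs hL
  have hs' : 1 < s.re := hs
  refine ⟨hs', hL, ?_, ?_⟩ <;> rintro rfl <;> norm_num at hs'

lemma eventually_eisenstein_zero {N : ℕ} (hN : 1 ≤ N) (τ : ℍ) :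
    ∀ᶠ s in 𝓝[{s : ℂ | 1 < s.re}] 1, eisZeroNum N τ s / (s - 1) = eisenstein N 0 τ s := by
  filter_upwards [eventually_levelL_ne_zero N] with s hs
  obtain ⟨hs, hL, h1, h0⟩ := hs
  have h1' : s - 1 ≠ 0 := sub_ne_zero.mpr h1
  rw [eisenstein_zero_eq hN hs hL, eisZeroNum, latVal, Finset.sum_add_distrib, Finset.sum_const,
    nsmul_eq_mul, ← diffSum, polH, zetaReg_of_ne h1]
  have e : Complex.exp ((1 - s) * Real.log τ.im) =
      Complex.exp (s * Real.log τ.im) * Complex.exp ((1 - 2 * s) * Real.log τ.im) := by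
    rw [← Complex.exp_add]; ring_nf
  rw [UpperHalfPlane.coe_im, e]
  field_simp
  ring

/-- By `betaInt_qTwo`, the zeta term 2ζ(2s-1) `betaInt qTwo s` equals -`polH s` / s. It is therefore
regular at s = 1, although its weight-zero analogue has a pole. -/
lemma eventually_eisenstein_two {N : ℕ} (hN : 1 ≤ N) (τ : ℍ) :
    ∀ᶠ s in 𝓝[{s : ℂ | 1 < s.re}] 1, eisTwo N τ s = eisenstein N 2 τ s := by
  filter_upwards [eventually_levelL_ne_zero N] with s hs
  obtain ⟨hs, hL, h1, h0⟩ := hs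
  have h1' : s - 1 ≠ 0 := sub_ne_zero.mpr h1
  rw [eisenstein_two_eq hN hs hL, eisTwo, latVal, Finset.sum_add_distrib, Finset.sum_const,
    nsmul_eq_mul, ← diffSum, polH, zetaReg_of_ne h1, betaInt_qTwo (by linarith)]
  have e : Complex.exp (-s * Real.log τ.im) =
      Complex.exp ((s - 1) * Real.log τ.im) * Complex.exp ((1 - 2 * s) * Real.log τ.im) := by
    rw [← Complex.exp_add]; ring_nf
  rw [UpperHalfPlane.coe_im, e]
  field_simp
  ring

lemma analyticAt_eisZeroNum (N : ℕ) {τ : ℂ} (hτ : 0 < τ.im) :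
    AnalyticAt ℂ (eisZeroNum N τ) 1 := by
  have h1 := analyticAt_levelM N
  have h2 := analyticAt_diffSum isAngularFactor_one N hτ
  have h3 := analyticAt_polH
  unfold eisZeroNum
  fun_prop

lemma analyticAt_eisTwo (N : ℕ) {τ : ℂ} (hτ : 0 < τ.im) : AnalyticAt ℂ (eisTwo N τ) 1 := by
  have h1 := analyticAt_levelM N
  have h2 := analyticAt_diffSum isAngularFactor_two N hτ
  have h3 : AnalyticAt ℂ (fun s => polH s / s) 1 := analyticAt_polH.div analyticAt_id one_ne_zero
  unfold eisTwo
  fun_prop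

/-- The residue of the Eisenstein series of weight zero. -/
def eisRes (N : ℕ) : ℂ := levelM N 1 * ((residues N).card * polH 1)

/-- The constant term of the Eisenstein series of weight zero. -/
def eisConst (N : ℕ) (τ : ℂ) : ℂ :=
  τ.im * (1 + levelM N 1 * diffSum (fun _ => 1) (fun _ => 0) N 1 τ) +
    (residues N).card * (deriv (levelM N) 1 * polH 1 + levelM N 1 *
      (deriv polH 1 - Real.log τ.im * polH 1))

/-- The linear coefficient of the Eisenstein series of weight two. -/
def gVal (N : ℕ) (τ : ℂ) : ℂ :=
  Real.log τ.im * (1 + levelM N 1 * diffSum qTwo aTwo N 1 τ) +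
    (deriv (levelM N) 1 * diffSum qTwo aTwo N 1 τ + levelM N 1 * diffSumDeriv qTwo aTwo N 1 τ) +
    (-1 * (residues N).card) * ((τ.im⁻¹ : ℝ) * (deriv (levelM N) 1 * polH 1 + levelM N 1 *
      (deriv polH 1 - polH 1) + (-1 * (levelM N 1 * polH 1)) * Real.log τ.im))

lemma exp_log_im {τ : ℂ} (hτ : 0 < τ.im) : Complex.exp (Real.log τ.im) = τ.im := by
  rw [← Complex.ofReal_exp, Real.exp_log hτ]

lemma hasDerivAt_eisZeroNum (N : ℕ) {τ : ℂ} (hτ : 0 < τ.im) :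
    HasDerivAt (eisZeroNum N τ) (eisConst N τ) 1 := by
  have h1 := (analyticAt_levelM N).differentiableAt.hasDerivAt
  have h2 := hasDerivAt_diffSum isAngularFactor_one N (s := 1) (by norm_num) hτ
  have h3 := analyticAt_polH.differentiableAt.hasDerivAt
  have e1 := ((hasDerivAt_id (1 : ℂ)).mul_const (Real.log τ.im : ℂ)).cexp
  have e2 := (((hasDerivAt_id (1 : ℂ)).const_sub 1).mul_const (Real.log τ.im : ℂ)).cexp
  have h := (e1.mul (((hasDerivAt_id (1 : ℂ)).sub_const 1).mul ((h1.mul h2).const_add 1))).add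
    (h1.mul ((e2.mul h3).const_mul ((residues N).card : ℂ)))
  refine h.congr_deriv ?_
  simp only [id, one_mul, sub_self, zero_mul, mul_zero, Complex.exp_zero, add_zero,
    exp_log_im hτ, eisConst, zero_add, Pi.mul_apply]
  ring

lemma hasDerivAt_eisTwo (N : ℕ) {τ : ℂ} (hτ : 0 < τ.im) :
    HasDerivAt (eisTwo N τ) (gVal N τ) 1 := by
  have h1 := (analyticAt_levelM N).differentiableAt.hasDerivAt
  have h2 := hasDerivAt_diffSum isAngularFactor_two N (s := 1) (by norm_num) hτ
  have h3 := analyticAt_polH.differentiableAt.hasDerivAt.div (hasDerivAt_id (1 : ℂ)) one_ne_zero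
  have e1 := (((hasDerivAt_id (1 : ℂ)).sub_const 1).mul_const (Real.log τ.im : ℂ)).cexp
  have e2 := ((hasDerivAt_id (1 : ℂ)).neg.mul_const (Real.log τ.im : ℂ)).cexp
  have h := (e1.mul ((h1.mul h2).const_add 1)).sub
    (h1.mul ((e2.mul h3).const_mul ((residues N).card : ℂ)))
  refine h.congr_deriv ?_
  have hv : (τ.im : ℂ) ≠ 0 := Complex.ofReal_ne_zero.mpr hτ.ne'
  simp only [id, one_mul, sub_self, zero_mul, Complex.exp_zero, mul_one, Pi.mul_apply,
    Pi.neg_apply, Pi.div_apply, div_one, neg_mul, Complex.exp_neg, exp_log_im hτ, gVal, one_pow]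
  push_cast
  ring

theorem exists_laurent_zero {N : ℕ} (hN : 1 ≤ N) (τ : ℍ) :
    ∃ a : ℤ → ℂ, HasLaurentExpansionAtOne (eisenstein N 0 τ) a ∧ a (-1) = eisRes N ∧
      a 0 = eisConst N τ := by
  have hτ : 0 < (τ : ℂ).im := τ.im_pos
  obtain ⟨a, h1, h2, h3⟩ := exists_hasLaurent_of_pole (analyticAt_eisZeroNum N hτ)
    (eventually_eisenstein_zero hN τ)
  refine ⟨a, h1, ?_, h3.trans (hasDerivAt_eisZeroNum N hτ).deriv⟩
  rw [h2, eisZeroNum, eisRes]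
  simp

theorem exists_laurent_two {N : ℕ} (hN : 1 ≤ N) (τ : ℍ) :
    ∃ a : ℤ → ℂ, HasLaurentExpansionAtOne (eisenstein N 2 τ) a ∧ a (-1) = 0 ∧ a 1 = gVal N τ := by
  have hτ : 0 < (τ : ℂ).im := τ.im_pos
  obtain ⟨a, h1, h2, h3⟩ := exists_hasLaurent_of_analyticAt (analyticAt_eisTwo N hτ)
    (eventually_eisenstein_two hN τ)
  exact ⟨a, h1, h2, h3.trans (hasDerivAt_eisTwo N hτ).deriv⟩

/-! ### Coefficients at `s = 1` and the conjugate derivative of `g` -/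

lemma gFun_eq {N : ℕ} (hN : 1 ≤ N) (τ : ℍ) : gFun N τ = gVal N τ := by
  obtain ⟨a, h1, -, h3⟩ := exists_laurent_two hN τ
  rw [gFun, laurentCoeffAtOne_eq h1, h3]

lemma laurentCoeff_eisenstein_zero {N : ℕ} (hN : 1 ≤ N) (τ : ℍ) :
    laurentCoeffAtOne (eisenstein N 0 τ) 0 = eisConst N τ := by
  obtain ⟨a, h1, -, h3⟩ := exists_laurent_zero hN τ
  rw [laurentCoeffAtOne_eq h1, h3]

lemma HasWirt.sum {ι : Type*} {f : ι → ℂ → ℂ} {P Q : ι → ℂ} {z : ℂ} (s : Finset ι)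
    (h : ∀ i ∈ s, HasWirt (f i) (P i) (Q i) z) :
    HasWirt (fun z => ∑ i ∈ s, f i z) (∑ i ∈ s, P i) (∑ i ∈ s, Q i) z := by
  classical
  induction s using Finset.induction_on with
  | empty => simpa using hasWirt_const 0 z
  | insert i s hi ih =>
    simp only [Finset.sum_insert hi]
    exact (h i (Finset.mem_insert_self i s)).add (ih fun j hj => h j (Finset.mem_insert_of_mem hj))

lemma hasWirt_diffSum_two (N : ℕ) {τ : ℂ} (hτ : 0 < τ.im) :
    ∃ P, HasWirt (diffSum qTwo aTwo N 1) P 0 τ := by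
  have h : ∀ r : ℕ, ∃ P, r ∈ residues N → HasWirt (kerSum (kFun qTwo aTwo 1) ((r : ℝ) / N)) P 0 τ := by
    intro r
    by_cases hr : r ∈ residues N
    · obtain ⟨P, hP⟩ := hasWirt_kerSum_kFun_two (div_mem_Icc hr) hτ
      exact ⟨P, fun _ => hP⟩
    · exact ⟨0, fun h => absurd h hr⟩
  choose P hP using h
  refine ⟨_, (HasWirt.sum (residues N) hP).congr rfl ?_⟩
  simp

lemma hasWirt_diffSumDeriv_two (N : ℕ) {τ : ℂ} (hτ : 0 < τ.im) :
    ∃ P, HasWirt (diffSumDeriv qTwo aTwo N 1) P (Complex.I / 2 / τ.im *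
      (diffSum (fun _ => 1) (fun _ => 0) N 1 τ - diffSum qTwo aTwo N 1 τ)) τ := by
  have h : ∀ r : ℕ, ∃ P, r ∈ residues N →
      HasWirt (kerSum (kFunDeriv qTwo aTwo 1) ((r : ℝ) / N)) P (Complex.I / 2 / τ.im *
      (kerSum (kFun (fun _ => 1) (fun _ => 0) 1) ((r : ℝ) / N) τ -
        kerSum (kFun qTwo aTwo 1) ((r : ℝ) / N) τ)) τ := by
    intro r
    by_cases hr : r ∈ residues N
    · obtain ⟨P, hP⟩ := hasWirt_kerSum_kFunDeriv_two (div_mem_Icc hr) hτ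
      exact ⟨P, fun _ => hP⟩
    · exact ⟨0, fun h => absurd h hr⟩
  choose P hP using h
  refine ⟨_, (HasWirt.sum (residues N) hP).congr rfl ?_⟩
  rw [← Finset.mul_sum, Finset.sum_sub_distrib]
  rfl

/-- The conjugate derivatives of log v and of `diffSumDeriv` both produce the weight-two sum, with
opposite signs; it cancels, and the weight-zero sum takes its place. In the remaining part,
differentiating log v / v supplies the term that turns `deriv polH 1 - polH 1` into `deriv polH 1`.
-/
lemma hasWirt_gVal (N : ℕ) {τ : ℂ} (hτ : 0 < τ.im) :
    ∃ P, HasWirt (gVal N) P (Complex.I / 2 / τ.im ^ 2 * eisConst N τ) τ := by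
  obtain ⟨P₂, h2⟩ := hasWirt_diffSum_two N hτ
  obtain ⟨P₃, h3⟩ := hasWirt_diffSumDeriv_two N hτ
  have hlog := hasWirt_im_comp (Real.hasDerivAt_log hτ.ne')
  have hinv := hasWirt_im_comp (hasDerivAt_inv hτ.ne')
  have h := ((hlog.mul ((hasWirt_const 1 τ).add (h2.const_mul (levelM N 1)))).add
    ((h2.const_mul (deriv (levelM N) 1)).add (h3.const_mul (levelM N 1)))).add
    ((hinv.mul ((hasWirt_const (deriv (levelM N) 1 * polH 1 + levelM N 1 *
      (deriv polH 1 - polH 1)) τ).add (hlog.const_mul (-1 * (levelM N 1 * polH 1))))).const_mul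
      (-1 * ((residues N).card : ℂ)))
  refine ⟨_, HasWirt.congr h rfl ?_⟩
  have hv : (τ.im : ℂ) ≠ 0 := Complex.ofReal_ne_zero.mpr hτ.ne'
  rw [eisConst]
  push_cast
  field_simp
  ring

/-! ### Limits along real `s > 1` and reality of the constant term -/

/-- The Eisenstein series of weight zero at real `s`. -/
def eisReal (N : ℕ) (τ : ℍ) (s : ℝ) : ℝ := ∑' c : Coset N, (((c.out : SL(2, ℤ)) • τ).im) ^ s

lemma eisenstein_zero_ofReal (N : ℕ) (τ : ℍ) (s : ℝ) :
    eisenstein N 0 τ (s : ℂ) = ((eisReal N τ s : ℝ) : ℂ) := by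
  rw [eisenstein, eisReal, Complex.ofReal_tsum]
  refine tsum_congr fun c => ?_
  rw [ModularForm.SL_slash_apply, Complex.ofReal_cpow (im_pos _).le]
  simp

lemma tendsto_ofReal_halfPlane :
    Tendsto (fun s : ℝ => (s : ℂ)) (𝓝[>] 1) (𝓝[{s : ℂ | 1 < s.re}] 1) := by
  refine tendsto_nhdsWithin_of_tendsto_nhds_of_eventually_within _ ?_ ?_
  · refine Tendsto.mono_left ?_ nhdsWithin_le_nhds
    simpa using Complex.continuous_ofReal.tendsto (1 : ℝ)
  · filter_upwards [self_mem_nhdsWithin] with s hs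
    simpa using hs

lemma eventually_eisZeroNum_real {N : ℕ} (hN : 1 ≤ N) (τ : ℍ) :
    ∀ᶠ s : ℝ in 𝓝[>] 1, eisZeroNum N τ s = (((s - 1) * eisReal N τ s : ℝ) : ℂ) := by
  filter_upwards [tendsto_ofReal_halfPlane.eventually (eventually_eisenstein_zero hN τ),
    self_mem_nhdsWithin] with s hs h1
  have h1' : (s : ℂ) - 1 ≠ 0 := by
    rw [sub_ne_zero]
    exact_mod_cast (ne_of_gt h1)
  rw [eisenstein_zero_ofReal, div_eq_iff h1'] at hs
  rw [hs]
  push_cast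
  ring

lemma eisZeroNum_one (N : ℕ) (τ : ℂ) : eisZeroNum N τ 1 = eisRes N := by
  rw [eisZeroNum, eisRes]
  simp

lemma tendsto_eisReal {N : ℕ} (hN : 1 ≤ N) (τ : ℍ) :
    Tendsto (fun s : ℝ => (s - 1) * eisReal N τ s) (𝓝[>] 1) (𝓝 (eisRes N).re) := by
  have h := (analyticAt_eisZeroNum N (τ := τ) τ.im_pos).continuousAt.tendsto
  rw [eisZeroNum_one] at h
  have h2 := (Complex.continuous_re.tendsto _).comp (h.comp
    (tendsto_ofReal_halfPlane.mono_right nhdsWithin_le_nhds))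
  refine h2.congr' ?_
  filter_upwards [eventually_eisZeroNum_real hN τ] with s hs
  simp only [Function.comp, hs, Complex.ofReal_re]

lemma eisRes_eq_ofReal {N : ℕ} (hN : 1 ≤ N) (τ : ℍ) : eisRes N = ((eisRes N).re : ℂ) := by
  have h := (analyticAt_eisZeroNum N (τ := τ) τ.im_pos).continuousAt.tendsto
  rw [eisZeroNum_one] at h
  have h2 := h.comp (tendsto_ofReal_halfPlane.mono_right nhdsWithin_le_nhds)
  have h3 := (Complex.continuous_ofReal.tendsto _).comp (tendsto_eisReal hN τ)
  refine tendsto_nhds_unique (h2.congr' ?_) h3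
  filter_upwards [eventually_eisZeroNum_real hN τ] with s hs using hs

lemma tendsto_eisReal_sub {N : ℕ} (hN : 1 ≤ N) (τ : ℍ) :
    Tendsto (fun s : ℝ => ((eisReal N τ s - (eisRes N).re / (s - 1) : ℝ) : ℂ)) (𝓝[>] 1)
      (𝓝 (eisConst N τ)) := by
  have h := (hasDerivAt_eisZeroNum N (τ := τ) τ.im_pos).tendsto_slope
  have h2 := h.comp (tendsto_ofReal_halfPlane.mono_right halfPlane_nhdsWithin_le)
  refine h2.congr' ?_
  filter_upwards [eventually_eisZeroNum_real hN τ, self_mem_nhdsWithin] with s hs h1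
  have h1' : (s : ℂ) - 1 ≠ 0 := by
    rw [sub_ne_zero]
    exact_mod_cast (ne_of_gt h1)
  simp only [Function.comp, slope_def_field, hs, eisZeroNum_one]
  rw [eisRes_eq_ofReal hN τ]
  push_cast
  field_simp
  rw [Complex.ofReal_re]

/-- The constant term is a limit of real numbers. This disposes of the complex conjugation in the
operator `xi`. -/
lemma conj_eisConst {N : ℕ} (hN : 1 ≤ N) (τ : ℍ) : conj (eisConst N τ) = eisConst N τ := by
  have h := tendsto_eisReal_sub hN τ
  have h2 := (Complex.continuous_conj.tendsto _).comp h
  refine tendsto_nhds_unique (h2.congr fun s => ?_) h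
  simp only [Function.comp, Complex.conj_ofReal]

lemma gFun_comp_ofComplex {N : ℕ} (hN : 1 ≤ N) (τ : ℍ) :
    gFun N ∘ ofComplex =ᶠ[𝓝 (τ : ℂ)] gVal N := by
  have hopen : IsOpen {z : ℂ | 0 < z.im} := isOpen_lt continuous_const Complex.continuous_im
  filter_upwards [hopen.mem_nhds τ.im_pos] with z hz
  rw [Function.comp, gFun_eq hN, ofComplex_apply_of_im_pos hz]

theorem xi_gFun {N : ℕ} (hN : 1 ≤ N) (τ : ℍ) :
    DifferentiableAt ℝ (gFun N ∘ ofComplex) (τ : ℂ) ∧ xi 2 (gFun N) τ = eisConst N τ := by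
  obtain ⟨P, hP⟩ := hasWirt_gVal N (τ := τ) τ.im_pos
  have hd : HasFDerivAt (gFun N ∘ ofComplex) (wirt P (Complex.I / 2 / (τ : ℂ).im ^ 2 *
      eisConst N τ)) (τ : ℂ) := HasFDerivAt.congr_of_eventuallyEq hP (gFun_comp_ofComplex hN τ)
  refine ⟨hd.differentiableAt, ?_⟩
  have hv : (τ.im : ℂ) ≠ 0 := Complex.ofReal_ne_zero.mpr τ.im_pos.ne'
  rw [xi, dbar, hd.fderiv, wirt_dbar, mul_div_cancel_left₀ _ two_ne_zero, map_mul, conj_eisConst hN]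
  simp only [map_div₀, Complex.conj_I, map_pow, Complex.conj_ofReal, map_ofNat,
    UpperHalfPlane.coe_im]
  have : (τ.im : ℂ) ^ (2 : ℤ) = (τ.im : ℂ) ^ 2 := by norm_cast
  rw [this]
  field_simp
  rw [Complex.I_sq]
  ring

/-! ### Unfolding -/

open scoped ENNReal

instance countable_SL2Z : Countable SL(2, ℤ) :=
  have : Countable (Matrix (Fin 2) (Fin 2) ℤ) := inferInstanceAs (Countable (Fin 2 → Fin 2 → ℤ))
  inferInstanceAs (Countable {A : Matrix (Fin 2) (Fin 2) ℤ // A.det = 1})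

lemma measurePreserving_smul_SL (γ : SL(2, ℤ)) :
    MeasurePreserving (fun τ : ℍ => γ • τ) volume volume :=
  measurePreserving_smul (γ : GL (Fin 2) ℝ) (volume : Measure ℍ)

lemma measurableEmbedding_smul_SL (γ : SL(2, ℤ)) : MeasurableEmbedding (fun τ : ℍ => γ • τ) :=
  measurableEmbedding_const_smul (γ : GL (Fin 2) ℝ)

lemma continuous_smul_SL (γ : SL(2, ℤ)) : Continuous (fun τ : ℍ => γ • τ) :=
  continuous_const_smul (γ : GL (Fin 2) ℝ)

lemma neg_one_mem_Gamma0 (N : ℕ) : (-1 : SL(2, ℤ)) ∈ Gamma0 N := by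
  rw [mem_Gamma0_iff_dvd]; simp

lemma neg_mem_Gamma0 {N : ℕ} {γ : SL(2, ℤ)} (h : γ ∈ Gamma0 N) : -γ ∈ Gamma0 N := by
  rw [mem_Gamma0_iff_dvd] at *; simpa using h

lemma neg_ne_self_SL (γ : SL(2, ℤ)) : -γ ≠ γ := by
  intro h
  have h1 := ModularGroup.bottom_row_coprime γ
  have h2 : ∀ i j, γ i j = 0 := fun i j => by
    have := congrArg (fun g : SL(2, ℤ) => g i j) h
    simp at this
    omega
  rw [h2, h2] at h1
  exact not_isCoprime_zero_zero h1

namespace IsClosedFundamentalDomain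

variable {N : ℕ} {F : Set ℍ}

/-- Almost every point has exactly two translates `γ τ = (-γ) τ` in the fundamental domain. -/
lemma ae_tsum_indicator (hF : IsClosedFundamentalDomain N F) :
    ∀ᵐ τ : ℍ, ∑' γ : Gamma0 N, F.indicator (1 : ℍ → ℝ≥0∞) ((γ : SL(2, ℤ)) • τ) = 2 := by
  -- The countably many translates of the null frontier are discarded. Afterwards every translate
  -- lying in F is interior, and disjointness of interiors leaves only g and -g.
  have h : ∀ᵐ τ : ℍ, ∀ γ : SL(2, ℤ), γ • τ ∉ frontier F := by
    rw [ae_all_iff]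
    intro γ
    exact (measurePreserving_smul_SL γ).quasiMeasurePreserving.ae (p := fun τ => τ ∉ frontier F)
      (measure_eq_zero_iff_ae_notMem.mp hF.null_frontier)
  filter_upwards [h] with τ hτ
  have hinteg : ∀ γ : SL(2, ℤ), γ • τ ∈ F → γ • τ ∈ interior F := fun γ hγ => by
    by_contra hcon
    exact hτ γ ⟨subset_closure hγ, hcon⟩
  obtain ⟨g, hg, hgF⟩ := hF.covers τ
  rw [tsum_eq_sum (s := ({⟨g, hg⟩, ⟨-g, neg_mem_Gamma0 hg⟩} : Finset (Gamma0 N))),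
    Finset.sum_pair]
  · simp only [ModularGroup.SL_neg_smul]
    rw [Set.indicator_of_mem hgF, Pi.one_apply, one_add_one_eq_two]
  · intro h
    exact neg_ne_self_SL g (Subtype.ext_iff.mp h).symm
  · intro γ hγ
    simp only [Finset.mem_insert, Finset.mem_singleton, not_or] at hγ
    rw [Set.indicator_of_notMem]
    intro hγF
    refine hF.disjoint_interior ((γ : SL(2, ℤ)) * g⁻¹) (mul_mem γ.2 (inv_mem hg)) ?_ ?_ _
      (hinteg _ hgF) ?_
    · intro h
      exact hγ.1 (Subtype.ext (mul_inv_eq_one.mp h))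
    · intro h
      refine hγ.2 (Subtype.ext ?_)
      rw [mul_inv_eq_iff_eq_mul] at h
      simpa using h
    · rw [smul_smul, inv_mul_cancel_right]
      exact hinteg _ hγF

lemma measurableSet (hF : IsClosedFundamentalDomain N F) : MeasurableSet F :=
  hF.isClosed.measurableSet

/-- Unfolding for non-negative functions. -/
lemma lintegral_mul_tsum (hF : IsClosedFundamentalDomain N F) {φ ψ : ℍ → ℝ≥0∞}
    (hφ : Measurable φ) (hψ : Measurable ψ)
    (hinv : ∀ γ ∈ Gamma0 N, ∀ τ, φ (γ • τ) = φ τ) :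
    ∫⁻ τ in F, φ τ * ∑' γ : Gamma0 N, ψ ((γ : SL(2, ℤ)) • τ) = 2 * ∫⁻ τ, φ τ * ψ τ := by
  have hm : ∀ γ : SL(2, ℤ), Measurable (fun τ : ℍ => γ • τ) :=
    fun γ => (measurePreserving_smul_SL γ).measurable
  have hind : Measurable (F.indicator (1 : ℍ → ℝ≥0∞)) :=
    measurable_one.indicator hF.measurableSet
  calc ∫⁻ τ in F, φ τ * ∑' γ : Gamma0 N, ψ ((γ : SL(2, ℤ)) • τ)
      = ∫⁻ τ, ∑' γ : Gamma0 N, F.indicator 1 τ * (φ τ * ψ ((γ : SL(2, ℤ)) • τ)) := by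
        rw [← lintegral_indicator hF.measurableSet]
        refine lintegral_congr fun τ => ?_
        by_cases hτ : τ ∈ F <;> simp [hτ, ENNReal.tsum_mul_left]
    _ = ∑' γ : Gamma0 N, ∫⁻ τ, F.indicator 1 τ * (φ τ * ψ ((γ : SL(2, ℤ)) • τ)) :=
        lintegral_tsum fun γ => (hind.mul (hφ.mul (hψ.comp (hm γ)))).aemeasurable
    _ = ∑' γ : Gamma0 N, ∫⁻ τ, F.indicator 1 ((γ : SL(2, ℤ))⁻¹ • τ) * (φ τ * ψ τ) := by
        refine tsum_congr fun γ => ?_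
        rw [← (measurePreserving_smul_SL (γ : SL(2, ℤ))).lintegral_comp_emb
          (measurableEmbedding_smul_SL _)
          (fun τ => F.indicator 1 ((γ : SL(2, ℤ))⁻¹ • τ) * (φ τ * ψ τ))]
        simp only [hinv γ γ.2, inv_smul_smul]
    _ = ∫⁻ τ, ∑' γ : Gamma0 N, F.indicator 1 ((γ : SL(2, ℤ))⁻¹ • τ) * (φ τ * ψ τ) :=
        (lintegral_tsum fun γ => ((hind.comp (hm _)).mul (hφ.mul hψ)).aemeasurable).symm
    _ = ∫⁻ τ, 2 * (φ τ * ψ τ) := by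
        refine lintegral_congr_ae ?_
        filter_upwards [hF.ae_tsum_indicator] with τ hτ
        rw [ENNReal.tsum_mul_right]
        congr 1
        rw [← hτ]
        exact (Equiv.inv (Gamma0 N)).tsum_eq
          (fun γ : Gamma0 N => F.indicator (1 : ℍ → ℝ≥0∞) ((γ : SL(2, ℤ)) • τ))
    _ = 2 * ∫⁻ τ, φ τ * ψ τ := lintegral_const_mul _ (hφ.mul hψ)

/-- Unfolding for integrable functions. -/
lemma integral_mul_tsum (hF : IsClosedFundamentalDomain N F) {φ : ℍ → ℝ} {ψ : ℍ → ℝ≥0∞}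
    (hφ : Measurable φ) (hψ : Measurable ψ)
    (hinv : ∀ γ ∈ Gamma0 N, ∀ τ, φ (γ • τ) = φ τ)
    (hfin : ∀ τ, ∑' γ : Gamma0 N, ψ ((γ : SL(2, ℤ)) • τ) ≠ ⊤)
    (hinteg : IntegrableOn (fun τ => φ τ * (∑' γ : Gamma0 N, ψ ((γ : SL(2, ℤ)) • τ)).toReal) F) :
    Integrable (fun τ => φ τ * (ψ τ).toReal) ∧
      ∫ τ in F, φ τ * (∑' γ : Gamma0 N, ψ ((γ : SL(2, ℤ)) • τ)).toReal =
        2 * ∫ τ, φ τ * (ψ τ).toReal := by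
  have hψfin : ∀ τ, ψ τ ≠ ⊤ := fun τ h => hfin τ <| by
    refine ENNReal.tsum_eq_top_of_eq_top ⟨1, ?_⟩
    rw [OneMemClass.coe_one, one_smul, h]
  -- Used for χ the norm, the identity and the negation. As `ENNReal.ofReal` is 0 on negative
  -- numbers, the last two give the positive and negative parts of φ.
  have key : ∀ χ : ℝ → ℝ, Measurable χ →
      ∫⁻ τ in F, ENNReal.ofReal (χ (φ τ)) * ∑' γ : Gamma0 N, ψ ((γ : SL(2, ℤ)) • τ) =
        2 * ∫⁻ τ, ENNReal.ofReal (χ (φ τ)) * ψ τ := fun χ hχ =>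
    hF.lintegral_mul_tsum (hχ.comp hφ).ennreal_ofReal hψ fun γ hγ τ => by rw [hinv γ hγ]
  have e1 : ∀ (x : ℝ) (y : ℝ≥0∞), y ≠ ⊤ →
      ENNReal.ofReal (x * y.toReal) = ENNReal.ofReal x * y := fun x y hy => by
    rw [ENNReal.ofReal_mul' ENNReal.toReal_nonneg, ENNReal.ofReal_toReal hy]
  have hI : Integrable (fun τ => φ τ * (ψ τ).toReal) := by
    refine ⟨(hφ.mul hψ.ennreal_toReal).aestronglyMeasurable, ?_⟩
    have h2 := hinteg.2
    rw [hasFiniteIntegral_iff_norm] at h2 ⊢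
    simp only [norm_mul, Real.norm_of_nonneg ENNReal.toReal_nonneg] at h2 ⊢
    simp_rw [e1 _ _ (hψfin _)]
    simp_rw [e1 _ _ (hfin _)] at h2
    rw [key (fun x => ‖x‖) measurable_norm] at h2
    contrapose! h2
    rw [top_le_iff] at h2
    rw [h2]
    simp
  refine ⟨hI, ?_⟩
  rw [integral_eq_lintegral_pos_part_sub_lintegral_neg_part hinteg,
    integral_eq_lintegral_pos_part_sub_lintegral_neg_part hI]
  simp_rw [← neg_mul, e1 _ _ (hψfin _), e1 _ _ (hfin _)]
  rw [key (fun x => x) measurable_id, key (fun x => -x) measurable_neg, ENNReal.toReal_mul,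
    ENNReal.toReal_mul]
  simp
  ring

end IsClosedFundamentalDomain

/-! ### Incomplete Eisenstein series -/

/-- An element of `Γ₀(N)` with given bottom row. -/
def rowRep {N : ℕ} (p : BottomRow N) : Gamma0 N := (exists_bottomRow p).choose

lemma rowRep_one_zero {N : ℕ} (p : BottomRow N) : (rowRep p : SL(2, ℤ)) 1 0 = p.1.1 :=
  congrArg Prod.fst (exists_bottomRow p).choose_spec

lemma rowRep_one_one {N : ℕ} (p : BottomRow N) : (rowRep p : SL(2, ℤ)) 1 1 = p.1.2 :=
  congrArg Prod.snd (exists_bottomRow p).choose_spec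

lemma T_zpow_mem_Gamma0 (N : ℕ) (n : ℤ) : ModularGroup.T ^ n ∈ Gamma0 N := by
  rw [mem_Gamma0_iff_dvd]; simp [ModularGroup.coe_T_zpow]

/-- An element of `Γ₀(N)` is determined by its bottom row and a translation. -/
def rowEquiv (N : ℕ) : BottomRow N × ℤ ≃ Gamma0 N :=
  Equiv.ofBijective
    (fun x => ⟨ModularGroup.T ^ x.2, T_zpow_mem_Gamma0 N x.2⟩ * rowRep x.1) <| by
  have hrow : ∀ (p : BottomRow N) (n : ℤ) (j : Fin 2),
      (ModularGroup.T ^ n * (rowRep p : SL(2, ℤ))) 1 j = (rowRep p : SL(2, ℤ)) 1 j := by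
    intro p n j
    simp
  constructor
  · rintro ⟨p, n⟩ ⟨q, m⟩ h
    have h' : ModularGroup.T ^ n * (rowRep p : SL(2, ℤ)) =
      ModularGroup.T ^ m * (rowRep q : SL(2, ℤ)) := congrArg Subtype.val h
    have hpq : p = q := by
      refine Subtype.ext (Prod.ext ?_ ?_)
      · rw [← rowRep_one_zero, ← rowRep_one_zero, ← hrow p n, h', hrow]
      · rw [← rowRep_one_one, ← rowRep_one_one, ← hrow p n, h', hrow]
    subst hpq
    have h2 := congrArg (fun g : SL(2, ℤ) => g 0 1) (mul_right_cancel h')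
    simp [ModularGroup.coe_T_zpow] at h2
    rw [h2]
  · intro γ
    let p : BottomRow N := ⟨((γ : SL(2, ℤ)) 1 0, (γ : SL(2, ℤ)) 1 1),
      ModularGroup.bottom_row_coprime _, mem_Gamma0_iff_dvd.mp γ.2⟩
    set δ : SL(2, ℤ) := γ * (rowRep p : SL(2, ℤ))⁻¹ with hδ
    have hd := Matrix.SpecialLinearGroup.det_coe (rowRep p : SL(2, ℤ))
    rw [Matrix.det_fin_two] at hd
    have h10 : δ 1 0 = 0 := by
      rw [hδ, mul_inv_one_zero, rowRep_one_one, rowRep_one_zero]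
      ring
    have h11 : δ 1 1 = 1 := by
      have h0 : δ 1 1 = -(γ : SL(2, ℤ)) 1 0 * (rowRep p : SL(2, ℤ)) 0 1 +
          (γ : SL(2, ℤ)) 1 1 * (rowRep p : SL(2, ℤ)) 0 0 := by
        simp [hδ, Matrix.SpecialLinearGroup.coe_inv, Matrix.adjugate_fin_two, Matrix.mul_apply,
          Fin.sum_univ_two]
      rw [rowRep_one_zero, rowRep_one_one] at hd
      rw [h0]
      linear_combination hd
    have h00 : δ 0 0 = 1 := by
      have := Matrix.SpecialLinearGroup.det_coe δ
      rw [Matrix.det_fin_two, h10, h11] at this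
      simpa using this
    refine ⟨(p, δ 0 1), Subtype.ext ?_⟩
    change ModularGroup.T ^ (δ 0 1) * (rowRep p : SL(2, ℤ)) = γ
    rw [← eq_mul_inv_iff_mul_eq, ← hδ]
    ext i j
    fin_cases i <;> fin_cases j <;> simp [ModularGroup.coe_T_zpow, h10, h11, h00]

/-- A function of the imaginary part, cut off to a strip of width one. -/
def stripFun (h : ℝ → ℝ≥0∞) (τ : ℍ) : ℝ≥0∞ :=
  if 0 ≤ τ.re ∧ τ.re < 1 then h τ.im else 0

lemma measurable_stripFun {h : ℝ → ℝ≥0∞} (hh : Measurable h) : Measurable (stripFun h) := by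
  have hre : Measurable (fun τ : ℍ => τ.re) := UpperHalfPlane.continuous_re.measurable
  have him : Measurable (fun τ : ℍ => τ.im) := UpperHalfPlane.continuous_im.measurable
  exact Measurable.ite ((measurableSet_le measurable_const hre).inter
    (measurableSet_lt hre measurable_const)) (hh.comp him) measurable_const

lemma tsum_stripFun_translate (h : ℝ → ℝ≥0∞) (τ : ℍ) :
    ∑' n : ℤ, stripFun h (ModularGroup.T ^ n • τ) = h τ.im := by
  rw [tsum_eq_single (-⌊τ.re⌋)]
  · have h1 := Int.floor_le τ.re
    have h2 := Int.lt_floor_add_one τ.re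
    rw [UpperHalfPlane.modular_T_zpow_smul, stripFun, if_pos]
    · simp
    · simp only [vadd_re]
      push_cast
      constructor <;> linarith
  · intro n hn
    rw [UpperHalfPlane.modular_T_zpow_smul, stripFun, if_neg]
    rintro ⟨h1, h2⟩
    simp only [vadd_re] at h1 h2
    refine hn ?_
    have : ⌊τ.re⌋ = -n := by
      rw [Int.floor_eq_iff]
      push_cast
      constructor <;> linarith
    omega

lemma tsum_stripFun_eq_row {N : ℕ} (h : ℝ → ℝ≥0∞) (τ : ℍ) :
    ∑' γ : Gamma0 N, stripFun h ((γ : SL(2, ℤ)) • τ) =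
      ∑' p : BottomRow N, h (τ.im / Complex.normSq (p.1.1 * τ + p.1.2)) := by
  rw [← (rowEquiv N).tsum_eq, ENNReal.tsum_prod']
  refine tsum_congr fun p => ?_
  have e : ∀ n : ℤ, ((rowEquiv N (p, n) : Gamma0 N) : SL(2, ℤ)) =
    ModularGroup.T ^ n * (rowRep p : SL(2, ℤ)) := fun n => rfl
  simp_rw [e, mul_smul]
  rw [tsum_stripFun_translate, ModularGroup.im_smul_eq_div_normSq,
    ModularGroup.denom_apply, rowRep_one_zero, rowRep_one_one]

/-- The matrices with a given bottom row differ by integer translations, exactly one of which moves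
the point into the strip. Each coset has two bottom rows, whence the 2. -/
lemma tsum_stripFun {N : ℕ} (h : ℝ → ℝ≥0∞) (τ : ℍ) :
    ∑' γ : Gamma0 N, stripFun h ((γ : SL(2, ℤ)) • τ) =
      2 * ∑' c : Coset N, h ((c.out : SL(2, ℤ)) • τ).im := by
  rw [tsum_stripFun_eq_row, ← (cosetEquiv N).tsum_eq, ENNReal.tsum_prod', ← ENNReal.tsum_mul_left]
  refine tsum_congr fun c => ?_
  have e : ∀ ε : ℤˣ, h (τ.im / Complex.normSq (((cosetEquiv N (c, ε)).1.1 : ℤ) * τ +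
      ((cosetEquiv N (c, ε)).1.2 : ℤ))) = h ((c.out : SL(2, ℤ)) • τ).im := by
    intro ε
    rw [ModularGroup.im_smul_eq_div_normSq, ModularGroup.denom_apply, cosetEquiv_apply]
    rcases Int.units_eq_one_or ε with rfl | rfl
    · simp [cosetRow]
    · simp only [cosetRow, Units.val_neg, Units.val_one]
      congr 2
      rw [← Complex.normSq_neg]
      congr 1
      push_cast
      ring
  simp_rw [e]
  rw [tsum_fintype]
  simp [two_mul]

/-! ### Sums over orbits -/

lemma stabilizer_finite {N : ℕ} {F : Set ℍ} (hF : IsClosedFundamentalDomain N F) (z : ℍ) :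
    Finite (MulAction.stabilizer (Gamma0 N) z) := by
  obtain ⟨g, hg, hgF⟩ := hF.covers z
  have h1 := hF.locally_finite {z} isCompact_singleton
  have h2 : Function.Injective (fun γ : MulAction.stabilizer (Gamma0 N) z =>
      (⟨g * ((γ : Gamma0 N) : SL(2, ℤ)), mul_mem hg (γ : Gamma0 N).2, z, rfl, by
        rw [mul_smul]
        have : ((γ : Gamma0 N) : SL(2, ℤ)) • z = z := γ.2
        rwa [this]⟩ : ({γ : SL(2, ℤ) | γ ∈ Gamma0 N ∧ ∃ τ ∈ ({z} : Set ℍ), γ • τ ∈ F}))) := by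
    intro γ δ h
    exact Subtype.ext (Subtype.ext (mul_left_cancel (congrArg Subtype.val h)))
  have := h1.to_subtype
  exact Finite.of_injective _ h2

lemma tsum_smul_eq_card_mul {N : ℕ} {F : Set ℍ} (hF : IsClosedFundamentalDomain N F)
    (ψ : ℍ → ℝ≥0∞) (z : ℍ) :
    ∑' γ : Gamma0 N, ψ ((γ : SL(2, ℤ)) • z) =
      Nat.card (MulAction.stabilizer (Gamma0 N) z) *
        ∑' w : MulAction.orbit (Gamma0 N) z, ψ w := by
  have := stabilizer_finite hF z
  have := Fintype.ofFinite (MulAction.stabilizer (Gamma0 N) z)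
  rw [← (MulAction.orbitProdStabilizerEquivGroup (Gamma0 N) z).tsum_eq, ENNReal.tsum_prod',
    ← ENNReal.tsum_mul_left]
  refine tsum_congr fun w => ?_
  have e : ∀ x, ψ (((MulAction.orbitProdStabilizerEquivGroup (Gamma0 N) z (w, x) : Gamma0 N) :
      SL(2, ℤ)) • z) = ψ w := by
    intro x
    congr 1
    set g := MulAction.orbitProdStabilizerEquivGroup (Gamma0 N) z (w, x) with hg
    have h1 : (MulAction.orbitProdStabilizerEquivGroup (Gamma0 N) z).symm g = (w, x) := by
      rw [hg, Equiv.symm_apply_apply]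
    have h2 : (MulAction.orbitEquivQuotientStabilizer (Gamma0 N) z).symm
        (QuotientGroup.mk g) = w := congrArg Prod.fst h1
    rw [← h2, MulAction.orbitEquivQuotientStabilizer_symm_apply]
    rfl
  simp_rw [e]
  rw [tsum_fintype, Finset.sum_const, Nat.card_eq_fintype_card, nsmul_eq_mul, Finset.card_univ]

lemma mem_center_SL2Z {γ : SL(2, ℤ)} : γ ∈ Subgroup.center SL(2, ℤ) ↔ γ = 1 ∨ γ = -1 := by
  rw [Matrix.SpecialLinearGroup.mem_center_iff]
  constructor
  · rintro ⟨r, hr, h⟩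
    rw [Fintype.card_fin, sq_eq_one_iff] at hr
    rcases hr with rfl | rfl
    · left; ext i j; rw [← h]; fin_cases i <;> fin_cases j <;> simp
    · right; ext i j; rw [← h]; fin_cases i <;> fin_cases j <;> simp
  · rintro (rfl | rfl)
    · exact ⟨1, by simp, by simp⟩
    · exact ⟨-1, by simp, by simp⟩

/-- The projection modulo the centre has kernel {±1} on the stabilizer. The resulting 2 later
cancels the one in `tsum_stripFun`. -/
lemma card_stabilizer {N : ℕ} (z : ℍ) :
    Nat.card (MulAction.stabilizer (Gamma0 N) z) = 2 * ellipticOrder N z := by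
  set H : Subgroup SL(2, ℤ) := Gamma0 N ⊓ MulAction.stabilizer SL(2, ℤ) z with hH
  have hneg : (-1 : SL(2, ℤ)) ∈ H :=
    ⟨neg_one_mem_Gamma0 N, by
      change (-1 : SL(2, ℤ)) • z = z
      rw [ModularGroup.SL_neg_smul, one_smul]⟩
  have e1 : Nat.card (MulAction.stabilizer (Gamma0 N) z) = Nat.card H :=
    Nat.card_congr
      { toFun := fun γ => ⟨γ.1.1, γ.1.2, γ.2⟩
        invFun := fun γ => ⟨⟨γ.1, γ.2.1⟩, γ.2.2⟩
        left_inv := fun _ => rfl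
        right_inv := fun _ => rfl }
  set φ := (QuotientGroup.mk' (Subgroup.center SL(2, ℤ))).comp H.subtype with hφ
  have e2 : φ.range = H.map (QuotientGroup.mk' (Subgroup.center SL(2, ℤ))) := by
    rw [hφ, MonoidHom.range_comp, Subgroup.range_subtype]
  have e3 : Nat.card φ.ker = 2 := by
    have : (φ.ker : Set H) = {1, ⟨-1, hneg⟩} := by
      ext γ
      rw [SetLike.mem_coe, MonoidHom.mem_ker, hφ, MonoidHom.comp_apply, QuotientGroup.mk'_apply,
        QuotientGroup.eq_one_iff, Subgroup.coe_subtype, mem_center_SL2Z]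
      rw [Set.mem_insert_iff, Set.mem_singleton_iff, Subtype.ext_iff, Subtype.ext_iff]
      rfl
    change Nat.card (φ.ker : Set H) = 2
    rw [this, Nat.card_coe_set_eq, Set.ncard_pair]
    intro h
    exact neg_ne_self_SL 1 (congrArg Subtype.val h).symm
  rw [e1, ← Subgroup.card_mul_index φ.ker, Subgroup.index_ker, e2, e3, ellipticOrder]

lemma ellipticOrder_ne_zero {N : ℕ} {F : Set ℍ} (hF : IsClosedFundamentalDomain N F) (z : ℍ) :
    ellipticOrder N z ≠ 0 := by
  have := stabilizer_finite hF z
  have h : Nat.card (MulAction.stabilizer (Gamma0 N) z) ≠ 0 := Nat.card_pos.ne'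
  rw [card_stabilizer] at h
  exact right_ne_zero_of_mul h

/-- Sums over an orbit in the strip are Eisenstein series. -/
lemma ellipticOrder_mul_tsum_orbit {N : ℕ} {F : Set ℍ} (hF : IsClosedFundamentalDomain N F)
    (h : ℝ → ℝ≥0∞) (z : ℍ) :
    ellipticOrder N z * ∑' w : MulAction.orbit (Gamma0 N) z, stripFun h w =
      ∑' c : Coset N, h ((c.out : SL(2, ℤ)) • z).im := by
  have h1 := tsum_smul_eq_card_mul hF (stripFun h) z
  rw [tsum_stripFun, card_stabilizer, Nat.cast_mul, Nat.cast_two, mul_assoc] at h1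
  exact ((ENNReal.mul_right_inj two_ne_zero ENNReal.ofNat_ne_top).mp h1).symm

/-! ### The invariant measure in coordinates -/

open scoped ENNReal

lemma measurable_ofComplex : Measurable ofComplex := by
  have h : ∀ w : ℂ, ofComplex w = if hw : 0 < w.im then ⟨w, hw⟩ else ofComplex 0 := by
    intro w
    split_ifs with hw
    · exact ofComplex_apply_of_im_pos hw
    · exact ofComplex_apply_eq_of_im_nonpos (not_lt.mp hw) (by simp)
  have h2 : ∀ w : ℂ, (ofComplex w : ℂ) = if 0 < w.im then w else (ofComplex 0 : ℂ) := by
    intro w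
    rw [h w]
    split_ifs <;> rfl
  rw [← measurableEmbedding_coe.measurable_comp_iff]
  rw [show UpperHalfPlane.coe ∘ ofComplex = fun w : ℂ => if 0 < w.im then w else (ofComplex 0 : ℂ)
    from funext h2]
  exact Measurable.ite (measurableSet_lt measurable_const Complex.measurable_im) measurable_id
    measurable_const

lemma lintegral_eq_lintegral_complex (Φ : ℍ → ℝ≥0∞) (hΦ : Measurable Φ) :
    ∫⁻ τ, Φ τ = ∫⁻ z in {z : ℂ | 0 < z.im}, ENNReal.ofReal (1 / z.im ^ 2) * Φ (ofComplex z) := by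
  rw [volume_def, lintegral_withDensity_eq_lintegral_mul _ ?_ hΦ]
  · have h1 : ∫⁻ z in {z : ℂ | 0 < z.im}, ENNReal.ofReal (1 / z.im ^ 2) * Φ (ofComplex z) =
        ∫⁻ τ, ENNReal.ofReal (1 / (τ : ℂ).im ^ 2) * Φ (ofComplex (τ : ℂ))
          ∂(volume.comap UpperHalfPlane.coe) := by
      rw [measurableEmbedding_coe.lintegral_map
        (fun z => ENNReal.ofReal (1 / z.im ^ 2) * Φ (ofComplex z)) |>.symm,
        measurableEmbedding_coe.map_comap]
      congr 2
      ext z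
      exact ⟨fun hz => ⟨⟨z, hz⟩, rfl⟩, by rintro ⟨τ, rfl⟩; exact τ.im_pos⟩
    rw [h1]
    refine lintegral_congr fun τ => ?_
    simp only [Pi.mul_apply, ofComplex_apply]
    congr 1
    rw [← ENNReal.ofReal_coe_nnreal]
    congr 1
    push_cast
    rw [one_div_pow]
    rfl
  · refine Measurable.coe_nnreal_ennreal (Measurable.pow_const (Measurable.const_div ?_ _) _)
    exact UpperHalfPlane.continuous_im.measurable.subtype_mk

/-- The coordinates `(v, u)` of a point `u + i v`. -/
def imRe (τ : ℍ) : ℝ × ℝ := (τ.im, τ.re)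

/-- The measure `dv / v²` on the positive reals. -/
def imMeasure : Measure ℝ :=
  (volume.restrict (Set.Ioi 0)).withDensity fun v => ENNReal.ofReal (1 / v ^ 2)

lemma lintegral_eq_lintegral_prod (Φ : ℍ → ℝ≥0∞) (hΦ : Measurable Φ) :
    ∫⁻ τ, Φ τ = ∫⁻ v in Set.Ioi (0 : ℝ), ENNReal.ofReal (1 / v ^ 2) *
      ∫⁻ u : ℝ, Φ (ofComplex (u + v * Complex.I)) := by
  have hm : Measurable (fun p : ℝ × ℝ => (p.1 + p.2 * Complex.I : ℂ)) := by fun_prop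
  have hm2 : Measurable (fun p : ℝ × ℝ => ENNReal.ofReal (1 / p.2 ^ 2) *
      Φ (ofComplex (p.1 + p.2 * Complex.I))) :=
    (by fun_prop : Measurable fun p : ℝ × ℝ => ENNReal.ofReal (1 / p.2 ^ 2)).mul
      (hΦ.comp (measurable_ofComplex.comp hm))
  rw [lintegral_eq_lintegral_complex Φ hΦ,
    ← Complex.volume_preserving_equiv_real_prod.symm.setLIntegral_comp_preimage_emb
      (MeasurableEquiv.measurableEmbedding _)]
  have e : (⇑Complex.measurableEquivRealProd.symm ⁻¹' {z : ℂ | 0 < z.im}) =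
      (Set.univ : Set ℝ) ×ˢ Set.Ioi (0 : ℝ) := by
    ext p
    simp [Complex.measurableEquivRealProd_symm_apply]
  have e2 : ∀ p : ℝ × ℝ, Complex.measurableEquivRealProd.symm p = p.1 + p.2 * Complex.I := by
    intro p
    rw [Complex.measurableEquivRealProd_symm_apply, Complex.mk_eq_add_mul_I]
  rw [e]
  simp_rw [e2]
  rw [Measure.volume_eq_prod, ← Measure.prod_restrict, Measure.restrict_univ,
    lintegral_prod_symm]
  · refine lintegral_congr fun v => ?_
    rw [← lintegral_const_mul]
    · simp
    · exact hΦ.comp (measurable_ofComplex.comp (by fun_prop))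
  · refine Measurable.aemeasurable ?_
    simpa using hm2

lemma imRe_ofComplex {p : ℝ × ℝ} (hp : 0 < p.1) :
    imRe (ofComplex (p.2 + p.1 * Complex.I)) = p := by
  have : 0 < ((p.2 : ℂ) + p.1 * Complex.I).im := by simpa using hp
  rw [ofComplex_apply_of_im_pos this]
  ext
  · simp [imRe, UpperHalfPlane.im]
  · simp [imRe, UpperHalfPlane.re]

lemma measurable_imRe : Measurable imRe :=
  UpperHalfPlane.continuous_im.measurable.prodMk UpperHalfPlane.continuous_re.measurable

/-- The height is put first so that Fubini integrates along horizontal lines first, as unfolding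
requires. -/
lemma measurePreserving_imRe :
    MeasurePreserving imRe volume (imMeasure.prod volume) := by
  refine ⟨measurable_imRe, Measure.ext fun s hs => ?_⟩
  rw [Measure.map_apply measurable_imRe hs, Measure.prod_apply hs, imMeasure,
    lintegral_withDensity_eq_lintegral_mul _ (by fun_prop) (measurable_measure_prodMk_left hs),
    ← lintegral_indicator_one (measurable_imRe hs),
    lintegral_eq_lintegral_prod _ (measurable_one.indicator (measurable_imRe hs))]
  refine setLIntegral_congr_fun measurableSet_Ioi fun v hv => ?_
  simp only [Pi.mul_apply]
  congr 1
  rw [← lintegral_indicator_one (measurable_prodMk_left hs)]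
  refine lintegral_congr fun u => ?_
  have := imRe_ofComplex (p := (v, u)) hv
  have hiff : ofComplex (u + v * Complex.I) ∈ imRe ⁻¹' s ↔ u ∈ Prod.mk v ⁻¹' s := by
    change imRe _ ∈ s ↔ _
    rw [this]
    rfl
  by_cases hu : u ∈ Prod.mk v ⁻¹' s
  · rw [Set.indicator_of_mem hu, Set.indicator_of_mem (hiff.mpr hu)]
    rfl
  · rw [Set.indicator_of_notMem hu, Set.indicator_of_notMem (mt hiff.mp hu)]

lemma measurableEmbedding_imRe : MeasurableEmbedding imRe :=
  MeasurableEmbedding.of_measurable_inverse (g := fun p => ofComplex (p.2 + p.1 * Complex.I))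
    measurable_imRe (by
      have : Set.range imRe = Set.Ioi (0 : ℝ) ×ˢ Set.univ := by
        ext p
        simp only [Set.mem_range, Set.mem_prod, Set.mem_Ioi, Set.mem_univ, and_true]
        exact ⟨by rintro ⟨τ, rfl⟩; exact τ.im_pos, fun hp => ⟨_, imRe_ofComplex hp⟩⟩
      rw [this]
      exact measurableSet_Ioi.prod .univ)
    (measurable_ofComplex.comp (by fun_prop)) (fun τ => by
      have h : ((imRe τ).2 : ℂ) + (imRe τ).1 * Complex.I = τ := Complex.re_add_im (τ : ℂ)
      simp only
      rw [h, ofComplex_apply])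

/-- Fubini on the upper half plane. -/
lemma integral_eq_integral_integral {Φ : ℍ → ℝ} (hΦ : Integrable Φ) :
    ∫ τ, Φ τ = ∫ v in Set.Ioi (0 : ℝ), 1 / v ^ 2 * ∫ u : ℝ, Φ (ofComplex (u + v * Complex.I)) := by
  set Ψ : ℝ × ℝ → ℝ := fun p => Φ (ofComplex (p.2 + p.1 * Complex.I)) with hΨ
  have h0 : ∀ τ, Φ τ = Ψ (imRe τ) := fun τ => by
    have h : ((imRe τ).2 : ℂ) + (imRe τ).1 * Complex.I = τ := Complex.re_add_im (τ : ℂ)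
    rw [hΨ]
    simp only
    rw [h, ofComplex_apply]
  have h1 : Integrable Ψ (imMeasure.prod volume) := by
    rw [← measurePreserving_imRe.integrable_comp_emb measurableEmbedding_imRe]
    exact hΦ.congr (ae_of_all _ h0)
  have : SFinite imMeasure := by unfold imMeasure; infer_instance
  simp_rw [h0]
  rw [measurePreserving_imRe.integral_comp measurableEmbedding_imRe, integral_prod _ h1, imMeasure,
    integral_withDensity_eq_integral_toReal_smul (by fun_prop) (ae_of_all _ fun _ => by simp)]
  refine setIntegral_congr_fun measurableSet_Ioi fun v hv => ?_
  simp only [smul_eq_mul]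
  rw [ENNReal.toReal_ofReal (by positivity)]
  congr 1
  refine integral_congr_ae (ae_of_all _ fun u => ?_)
  have := imRe_ofComplex (p := (v, u)) hv
  simp only at this
  simp only
  rw [this]

/-! ### Local integrability of `log ‖f‖` -/

/-- In polar coordinates the integrand becomes r log r, which is continuous up to r = 0. -/
lemma integrableOn_log_norm_ball : IntegrableOn (fun z : ℂ => Real.log ‖z‖) (Metric.ball 0 1) := by
  rw [integrableOn_fun_norm_addHaar volume (f := Real.log)]
  have h : Continuous fun y : ℝ => y ^ (Module.finrank ℝ ℂ - 1) • Real.log y := by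
    simpa using Real.continuous_mul_log
  exact (h.integrableOn_Icc (a := 0) (b := 1)).mono_set Set.Ioo_subset_Icc_self

lemma integrableAtFilter_log_norm_sub (z₀ : ℂ) :
    IntegrableAtFilter (fun z : ℂ => Real.log ‖z - z₀‖) (𝓝 z₀) := by
  refine ⟨Metric.ball z₀ 1, Metric.ball_mem_nhds _ one_pos, ?_⟩
  have h := (measurePreserving_sub_right (volume : Measure ℂ) z₀).integrableOn_comp_preimage
    (measurableEmbedding_subRight z₀) (f := fun z : ℂ => Real.log ‖z‖) (s := Metric.ball 0 1)
  have e : (fun z : ℂ => z - z₀) ⁻¹' Metric.ball 0 1 = Metric.ball z₀ 1 := by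
    ext z
    simp [dist_eq_norm]
  rw [e] at h
  exact h.mpr integrableOn_log_norm_ball

/-- Near z₀ write h as (z - z₀)^n g with g analytic and non-vanishing; then log‖h‖ is n log‖z - z₀‖
plus a continuous function. -/
lemma integrableAtFilter_log_norm_meromorphic {h : ℂ → ℂ} {z₀ : ℂ} (hh : MeromorphicAt h z₀)
    (hord : meromorphicOrderAt h z₀ ≠ ⊤) :
    IntegrableAtFilter (fun z : ℂ => Real.log ‖h z‖) (𝓝 z₀) := by
  obtain ⟨g, hg, hg0, hev⟩ := (meromorphicOrderAt_ne_top_iff hh).mp hord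
  set n := (meromorphicOrderAt h z₀).untop₀ with hn
  have hgne : ∀ᶠ z in 𝓝 z₀, AnalyticAt ℂ g z ∧ g z ≠ 0 :=
    hg.eventually_analyticAt.and (hg.continuousAt.eventually_ne hg0)
  have h1 : IntegrableAtFilter (fun z : ℂ => Real.log ‖g z‖) (𝓝 z₀) := by
    obtain ⟨r, hr, hball⟩ := Metric.eventually_nhds_iff_ball.mp hgne
    refine ⟨Metric.closedBall z₀ (r / 2), Metric.closedBall_mem_nhds _ (by positivity), ?_⟩
    refine ContinuousOn.integrableOn_compact (isCompact_closedBall _ _) fun z hz => ?_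
    have hz' := hball z (Metric.closedBall_subset_ball (by linarith) hz)
    exact (hz'.1.continuousAt.norm.log (norm_ne_zero_iff.mpr hz'.2)).continuousWithinAt
  have h2 := (integrableAtFilter_log_norm_sub z₀).smul (n : ℝ) |>.add h1
  have h3 : ∀ᶠ z in 𝓝 z₀, z ≠ z₀ → Real.log ‖h z‖ =
      ((n : ℝ) • fun z : ℂ => Real.log ‖z - z₀‖) z + Real.log ‖g z‖ := by
    filter_upwards [eventually_nhdsWithin_iff.mp hev, hgne] with z hz hgz hne
    rw [hz hne, norm_smul, norm_zpow, Real.log_mul, Real.log_zpow]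
    · rfl
    · exact zpow_ne_zero _ (norm_ne_zero_iff.mpr (sub_ne_zero.mpr hne))
    · exact norm_ne_zero_iff.mpr hgz.2
  obtain ⟨s, hs, hsi⟩ := h2
  obtain ⟨t, ht, hto, htz⟩ := mem_nhds_iff.mp h3
  refine ⟨s ∩ t, inter_mem hs (hto.mem_nhds htz), ?_⟩
  refine (hsi.mono_set Set.inter_subset_left).congr ?_
  have hne : ∀ᵐ z : ℂ ∂(volume.restrict (s ∩ t)), z ≠ z₀ :=
    ae_restrict_of_ae (measure_eq_zero_iff_ae_notMem.mp (measure_singleton z₀))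
  have hmt : ∀ᵐ z : ℂ ∂(volume.restrict (s ∩ t)), z ∈ t :=
    ae_restrict_of_ae_restrict_of_subset Set.inter_subset_right (ae_restrict_mem hto.measurableSet)
  filter_upwards [hne, hmt] with z hz hz'
  exact (ht hz' hz).symm

/-! ### Behaviour of the form under `SL(2, ℤ)` -/

/-- |cτ + d|² is at least 1 if c = 0 and at least v² otherwise. Heights in a full orbit are thus
bounded: every point lies outside all sufficiently small horoballs, and a high enough truncation
does not affect it. -/
lemma im_smul_le_max (g : SL(2, ℤ)) (τ : ℍ) : (g • τ).im ≤ max τ.im (1 / τ.im) := by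
  have hv := τ.im_pos
  have hn : Complex.normSq ((g 1 0 : ℂ) * τ + (g 1 1 : ℂ)) =
      ((g 1 0 : ℝ) * τ.re + (g 1 1 : ℝ)) ^ 2 + (g 1 0 : ℝ) ^ 2 * τ.im ^ 2 := by
    simp [Complex.normSq_apply]
    ring
  rw [ModularGroup.im_smul_eq_div_normSq, ModularGroup.denom_apply, hn]
  by_cases hg : g 1 0 = 0
  · have h1 : g 1 1 ≠ 0 := fun hg' => by
      have := ModularGroup.bottom_row_coprime g
      rw [hg, hg'] at this
      exact not_isCoprime_zero_zero this
    have h2 : (1 : ℝ) ≤ (g 1 1 : ℝ) ^ 2 := by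
      exact_mod_cast (one_le_sq_iff_one_le_abs _).mpr (Int.one_le_abs h1)
    refine le_trans ?_ (le_max_left _ _)
    rw [hg]
    simp only [Int.cast_zero, zero_mul, zero_add, ne_eq, OfNat.ofNat_ne_zero, not_false_eq_true,
      zero_pow, add_zero]
    exact div_le_self hv.le h2
  · have h2 : (1 : ℝ) ≤ (g 1 0 : ℝ) ^ 2 := by
      exact_mod_cast (one_le_sq_iff_one_le_abs _).mpr (Int.one_le_abs hg)
    refine le_trans ?_ (le_max_right _ _)
    have h3 := sq_nonneg ((g 1 0 : ℝ) * τ.re + (g 1 1 : ℝ))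
    have h4 : τ.im ^ 2 ≤ (g 1 0 : ℝ) ^ 2 * τ.im ^ 2 := le_mul_of_one_le_left (sq_nonneg _) h2
    rw [div_le_div_iff₀ (by nlinarith [sq_pos_of_pos hv]) hv]
    nlinarith

/-- The real-valued function `log (v^(k/2) |f|)`. -/
def logAbs (k : ℤ) (f : ℍ → ℂ) (τ : ℍ) : ℝ := Real.log (τ.im ^ ((k : ℝ) / 2) * ‖f τ‖)

lemma logNorm_eq (k : ℤ) (f : ℍ → ℂ) (τ : ℍ) : logNorm k f τ = (logAbs k f τ : ℂ) := rfl

lemma logAbs_smul (k : ℤ) (f : ℍ → ℂ) (σ : SL(2, ℤ)) (τ : ℍ) :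
    logAbs k f (σ • τ) = logAbs k (f ∣[k] σ) τ := by
  have hd : denom σ τ ≠ 0 := denom_ne_zero _ _
  have hn : 0 < ‖denom σ τ‖ := norm_pos_iff.mpr hd
  have h1 : (‖denom σ τ‖ ^ 2) ^ ((k : ℝ) / 2) = ‖denom σ τ‖ ^ k := by
    rw [← Real.rpow_natCast, ← Real.rpow_mul hn.le, ← Real.rpow_intCast]
    congr 1
    push_cast
    ring
  rw [logAbs, logAbs, ModularForm.SL_slash_apply, ModularGroup.im_smul_eq_div_normSq,
    Complex.normSq_eq_norm_sq, Real.div_rpow τ.im_pos.le (by positivity), norm_mul, norm_zpow,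
    zpow_neg, h1]
  congr 1
  field_simp

lemma logAbs_smul_of_mem {N : ℕ} {k : ℤ} {f : ℍ → ℂ} (hf : IsMeromorphicModularForm N k f)
    {γ : SL(2, ℤ)} (hγ : γ ∈ Gamma0 N) (τ : ℍ) : logAbs k f (γ • τ) = logAbs k f τ := by
  rw [logAbs_smul, hf.slash_eq γ hγ]

lemma logAbs_eq {k : ℤ} {f : ℍ → ℂ} {τ : ℍ} (h : f τ ≠ 0) :
    logAbs k f τ = (k : ℝ) / 2 * Real.log τ.im + Real.log ‖f τ‖ := by
  rw [logAbs, Real.log_mul (Real.rpow_pos_of_pos τ.im_pos _).ne' (norm_ne_zero_iff.mpr h),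
    Real.log_rpow τ.im_pos]

namespace IsMeromorphicModularForm

variable {N : ℕ} {k : ℤ} {f : ℍ → ℂ}

lemma smul_eq (hf : IsMeromorphicModularForm N k f) {γ : SL(2, ℤ)} (hγ : γ ∈ Gamma0 N) (τ : ℍ) :
    f (γ • τ) = denom γ τ ^ k * f τ := by
  have h := congrFun (hf.slash_eq γ hγ) τ
  rw [ModularForm.SL_slash_apply] at h
  rw [← h, zpow_neg]
  field_simp [zpow_ne_zero k (denom_ne_zero γ τ)]

lemma meromorphicAt (hf : IsMeromorphicModularForm N k f) (z : ℍ) :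
    MeromorphicAt (f ∘ ofComplex) z :=
  (hf.meromorphic z.im_pos).meromorphicAt

lemma slash_eventuallyEq (k : ℤ) (f : ℍ → ℂ) (σ : SL(2, ℤ)) (z : ℍ) :
    (f ∣[k] σ) ∘ ofComplex =ᶠ[𝓝 (z : ℂ)]
      (fun w => denom σ w ^ (-k)) * fun w => f ((σ : GL (Fin 2) ℝ) • ofComplex w) := by
  filter_upwards [isOpen_upperHalfPlaneSet.mem_nhds z.im_pos] with w hw
  rw [Function.comp_apply, ModularForm.SL_slash_apply, mul_comm, Pi.mul_apply,
    ofComplex_apply_of_im_pos hw]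
  rfl

lemma det_pos_SL (σ : SL(2, ℤ)) : 0 < (σ : GL (Fin 2) ℝ).val.det := by
  have h : (σ : GL (Fin 2) ℝ).val.det = 1 :=
    (Matrix.SpecialLinearGroup.map (Int.castRingHom ℝ) σ).det_coe
  rw [h]
  exact one_pos

lemma analyticAt_denom_zpow (σ : SL(2, ℤ)) (z : ℍ) (m : ℤ) :
    AnalyticAt ℂ (fun w => denom σ w ^ m) (z : ℂ) := by
  refine AnalyticAt.fun_zpow ?_ (denom_ne_zero σ z)
  unfold denom
  fun_prop

lemma meromorphicAt_slash (hf : IsMeromorphicModularForm N k f) (σ : SL(2, ℤ)) (z : ℍ) :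
    MeromorphicAt ((f ∣[k] σ) ∘ ofComplex) z := by
  rw [MeromorphicAt.meromorphicAt_congr
    ((slash_eventuallyEq k f σ z).filter_mono nhdsWithin_le_nhds)]
  refine (analyticAt_denom_zpow σ z _).meromorphicAt.mul ?_
  have h := hf.meromorphicAt ((σ : GL (Fin 2) ℝ) • z)
  have h2 := analyticAt_smul (det_pos_SL σ) z
  have h3 : MeromorphicAt ((f ∘ ofComplex) ∘ fun w : ℂ =>
      (((σ : GL (Fin 2) ℝ) • ofComplex w : ℍ) : ℂ)) (z : ℂ) :=
    MeromorphicAt.comp_analyticAt (by simpa using h) h2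
  refine h3.congr (Eventually.of_forall fun w => ?_)
  simp

lemma meromorphicOrderAt_slash (hf : IsMeromorphicModularForm N k f) (σ : SL(2, ℤ)) (z : ℍ) :
    meromorphicOrderAt ((f ∣[k] σ) ∘ ofComplex) z =
      meromorphicOrderAt (f ∘ ofComplex) (σ • z : ℍ) := by
  rw [meromorphicOrderAt_congr ((slash_eventuallyEq k f σ z).filter_mono nhdsWithin_le_nhds)]
  have h3 : MeromorphicAt (fun w : ℂ => f ((σ : GL (Fin 2) ℝ) • ofComplex w)) (z : ℂ) := by
    have h3 : MeromorphicAt ((f ∘ ofComplex) ∘ fun w : ℂ =>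
        (((σ : GL (Fin 2) ℝ) • ofComplex w : ℍ) : ℂ)) (z : ℂ) :=
      MeromorphicAt.comp_analyticAt (by simpa using hf.meromorphicAt ((σ : GL (Fin 2) ℝ) • z))
        (analyticAt_smul (det_pos_SL σ) z)
    exact h3.congr (Eventually.of_forall fun w => by simp)
  rw [meromorphicOrderAt_mul (analyticAt_denom_zpow σ z _).meromorphicAt h3,
    meromorphicOrderAt_comp_smul (det_pos_SL σ), (analyticAt_denom_zpow σ z _).meromorphicOrderAt_eq,
    (analyticAt_denom_zpow σ z _).analyticOrderAt_eq_zero.mpr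
      (zpow_ne_zero _ (denom_ne_zero σ z))]
  simp
  rfl

lemma ordAt_smul (hf : IsMeromorphicModularForm N k f) {γ : SL(2, ℤ)} (hγ : γ ∈ Gamma0 N) (z : ℍ) :
    ordAt f (γ • z) = ordAt f z := by
  rw [ordAt, ← hf.meromorphicOrderAt_slash γ z, hf.slash_eq γ hγ, ordAt]

/-! ### Behaviour at the cusps -/

lemma coe_T_pow (l : ℕ) :
    ((ModularGroup.T ^ l : SL(2, ℤ)) : Matrix (Fin 2) (Fin 2) ℤ) = !![1, (l : ℤ); 0, 1] := by
  rw [← zpow_natCast, ModularGroup.coe_T_zpow]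

lemma cuspWidth_spec (hN : 1 ≤ N) (σ : SL(2, ℤ)) :
    0 < cuspWidth N σ ∧ σ * ModularGroup.T ^ cuspWidth N σ * σ⁻¹ ∈ Gamma0 N := by
  refine Nat.sInf_mem (s := {l : ℕ | 0 < l ∧ σ * ModularGroup.T ^ l * σ⁻¹ ∈ Gamma0 N})
    ⟨N, hN, ?_⟩
  rw [mem_Gamma0_iff_dvd, mul_inv_one_zero]
  simp only [Matrix.SpecialLinearGroup.coe_mul, coe_T_pow, Matrix.mul_apply, Fin.sum_univ_two]
  simp
  exact ⟨-(σ 1 0) ^ 2, by ring⟩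

lemma slash_vadd (hf : IsMeromorphicModularForm N k f) (hN : 1 ≤ N) (σ : SL(2, ℤ)) (τ : ℍ) :
    (f ∣[k] σ) ((cuspWidth N σ : ℝ) +ᵥ τ) = (f ∣[k] σ) τ := by
  have h1 : (f ∣[k] σ) ∣[k] (ModularGroup.T ^ cuspWidth N σ) = f ∣[k] σ := by
    rw [← SlashAction.slash_mul]
    conv_rhs => rw [← hf.slash_eq _ (cuspWidth_spec hN σ).2]
    rw [← SlashAction.slash_mul, inv_mul_cancel_right]
  have h2 := congrFun h1 τ
  rw [ModularForm.SL_slash_apply, ModularGroup.denom_apply, coe_T_pow, ← zpow_natCast,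
    UpperHalfPlane.modular_T_zpow_smul] at h2
  simpa using h2

lemma periodic_slash (hf : IsMeromorphicModularForm N k f) (hN : 1 ≤ N) (σ : SL(2, ℤ)) :
    Function.Periodic ((f ∣[k] σ) ∘ ofComplex) ((cuspWidth N σ : ℝ) : ℂ) := by
  intro w
  by_cases hw : 0 < w.im
  · have hw' : 0 < (w + ((cuspWidth N σ : ℝ) : ℂ)).im := by simpa using hw
    rw [Function.comp_apply, Function.comp_apply, ofComplex_apply_of_im_pos hw,
      ofComplex_apply_of_im_pos hw', ← hf.slash_vadd hN σ ⟨w, hw⟩]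
    refine congrArg _ (UpperHalfPlane.ext ?_)
    simp [add_comm]
  · rw [Function.comp_apply, Function.comp_apply,
      ofComplex_apply_eq_of_im_nonpos (w' := w) (by simpa using hw) (not_lt.mp hw)]

lemma tendsto_slash (hf : IsMeromorphicModularForm N k f) (hN : 1 ≤ N) (σ : SL(2, ℤ))
    (hσ : cuspOrder N k f σ = 0) :
    ∃ c ≠ 0, Tendsto (expansionAtCusp N k f σ) (𝓝[≠] 0) (𝓝 c) ∧
      Tendsto (f ∣[k] σ) atImInfty (𝓝 c) := by
  obtain ⟨c, hc, hlim⟩ := tendsto_ne_zero_of_meromorphicOrderAt_eq_zero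
    (hf.meromorphic_cusps σ) hσ
  have hpos : (0 : ℝ) < cuspWidth N σ := by exact_mod_cast (cuspWidth_spec hN σ).1
  refine ⟨c, hc, hlim, ?_⟩
  have h2 : Tendsto (fun τ : ℍ => Function.Periodic.qParam (cuspWidth N σ : ℝ) (τ : ℂ))
      atImInfty (𝓝[≠] 0) :=
    (Function.Periodic.qParam_tendsto hpos).comp tendsto_coe_atImInfty
  refine (hlim.comp h2).congr fun τ => ?_
  exact eq_cuspFunction τ hpos.ne' (hf.periodic_slash hN σ)

lemma meromorphicOrderAt_eq_zero_iff (hf : IsMeromorphicModularForm N k f) (z : ℍ) :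
    meromorphicOrderAt (f ∘ ofComplex) z = 0 ↔ f z ≠ 0 := by
  rw [MeromorphicNFAt.meromorphicOrderAt_eq_zero_iff (hf.meromorphic z.im_pos)]
  simp

/-- The non-zero limit at i∞ gives a point of finite order, and finiteness propagates because the
half-plane is connected. -/
lemma meromorphicOrderAt_ne_top (hf : IsMeromorphicModularForm N k f) (hN : 1 ≤ N)
    (hcusp : ∀ σ : SL(2, ℤ), cuspOrder N k f σ = 0) (z : ℍ) :
    meromorphicOrderAt (f ∘ ofComplex) z ≠ ⊤ := by
  obtain ⟨c, hc, -, hlim⟩ := hf.tendsto_slash hN 1 (hcusp 1)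
  rw [SlashAction.slash_one] at hlim
  obtain ⟨w, hw⟩ := (hlim.eventually_ne hc).exists
  have hconn : IsConnected {z : ℂ | 0 < z.im} :=
    ⟨⟨Complex.I, by simp⟩, (convex_halfSpace_im_gt 0).isPreconnected⟩
  refine (hf.meromorphic.meromorphicOn.exists_meromorphicOrderAt_ne_top_iff_forall_mem hconn).mp
    ⟨w, w.im_pos, ?_⟩ z z.im_pos
  rw [(hf.meromorphicOrderAt_eq_zero_iff w).mpr hw]
  simp

/-- A function in normal form takes the value 0 at its poles, so here f z = 0 detects zeros and
poles alike. As `untop₀` sends ⊤ to 0, infinite order has to be excluded first. -/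
lemma ordAt_eq_zero_iff (hf : IsMeromorphicModularForm N k f) (hN : 1 ≤ N)
    (hcusp : ∀ σ : SL(2, ℤ), cuspOrder N k f σ = 0) (z : ℍ) : ordAt f z = 0 ↔ f z ≠ 0 := by
  rw [← hf.meromorphicOrderAt_eq_zero_iff, ordAt, WithTop.untop₀_eq_zero]
  simp [hf.meromorphicOrderAt_ne_top hN hcusp z]

lemma slash_apply_eq_zero_iff (σ : SL(2, ℤ)) (z : ℍ) : (f ∣[k] σ) z = 0 ↔ f (σ • z) = 0 := by
  rw [ModularForm.SL_slash_apply, mul_eq_zero]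
  simp only [zpow_ne_zero _ (denom_ne_zero σ z), or_false]

/-! ### Reduction to a box -/

/-- A neighbourhood of the standard fundamental domain of `SL(2, ℤ)`. -/
def box : Set ℍ := {τ | |τ.re| ≤ 1 / 2 ∧ 1 / 2 ≤ τ.im}

lemma exists_smul_mem_box (τ : ℍ) : ∃ g : SL(2, ℤ), g • τ ∈ box := by
  obtain ⟨g, hg⟩ := ModularGroup.exists_smul_mem_fd τ
  refine ⟨g, hg.2, ?_⟩
  have := ModularGroup.three_le_four_mul_im_sq_of_mem_fd hg
  nlinarith [(g • τ).im_pos]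

lemma exists_finset_reps (hN : 1 ≤ N) : ∃ J : Finset SL(2, ℤ), ∀ τ : ℍ, ∃ γ ∈ Gamma0 N, ∃ j ∈ J,
    ∃ w ∈ box, γ • τ = j • w := by
  have : NeZero N := ⟨by omega⟩
  have : Fintype (SL(2, ℤ) ⧸ Gamma0 N) := Subgroup.fintypeQuotientOfFiniteIndex
  classical
  refine ⟨Finset.univ.image fun q : SL(2, ℤ) ⧸ Gamma0 N => q.out⁻¹, fun τ => ?_⟩
  obtain ⟨g, hg⟩ := exists_smul_mem_box τ
  set q : SL(2, ℤ) ⧸ Gamma0 N := QuotientGroup.mk g with hq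
  obtain ⟨h, hh⟩ := QuotientGroup.mk_out_eq_mul (Gamma0 N) g
  refine ⟨(h : SL(2, ℤ))⁻¹, inv_mem h.2, q.out⁻¹, ?_, g • τ, hg, ?_⟩
  · simp
  · rw [hq, hh, smul_smul, mul_inv_rev, inv_mul_cancel_right]

lemma exists_bound_slash (hf : IsMeromorphicModularForm N k f) (hN : 1 ≤ N)
    (hcusp : ∀ σ : SL(2, ℤ), cuspOrder N k f σ = 0) (σ : SL(2, ℤ)) :
    ∃ y C : ℝ, 1 ≤ y ∧ ∀ τ : ℍ, y ≤ τ.im →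
      (f ∣[k] σ) τ ≠ 0 ∧ |Real.log ‖(f ∣[k] σ) τ‖| ≤ C := by
  obtain ⟨c, hc, -, hlim⟩ := hf.tendsto_slash hN σ (hcusp σ)
  have h1 : Tendsto (fun τ => |Real.log ‖(f ∣[k] σ) τ‖|) atImInfty (𝓝 |Real.log ‖c‖|) :=
    (hlim.norm.log (norm_ne_zero_iff.mpr hc)).abs
  have h2 := (hlim.eventually_ne hc).and (h1.eventually_le_const (lt_add_one _))
  obtain ⟨y, hy⟩ := (atImInfty_basis.eventually_iff.mp h2)
  exact ⟨max 1 y, _, le_max_left _ _, fun τ hτ => hy.2 (le_trans (le_max_right _ _) hτ)⟩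

/-- The part of the box below height `y`, as a subset of the complex plane. -/
def lowBox (y : ℝ) : Set ℂ := Set.Icc (-(1 / 2)) (1 / 2) ×ℂ Set.Icc (1 / 2) y

lemma isCompact_lowBox (y : ℝ) : IsCompact (lowBox y) := isCompact_Icc.reProdIm isCompact_Icc

lemma coe_mem_lowBox {y : ℝ} {τ : ℍ} : (τ : ℂ) ∈ lowBox y ↔ τ ∈ box ∧ τ.im ≤ y := by
  simp only [lowBox, Complex.mem_reProdIm, Set.mem_Icc, box, Set.mem_ofPred_eq, abs_le]
  change (_ ≤ τ.re ∧ τ.re ≤ _) ∧ (_ ≤ τ.im ∧ τ.im ≤ _) ↔ _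
  tauto

lemma im_pos_of_mem_lowBox {y : ℝ} {z : ℂ} (hz : z ∈ lowBox y) : 0 < z.im := by
  have := hz.2.1
  linarith

/-- The non-zero limit at the cusp excludes zeros and poles above some height; what remains of the
box is compact, and a divisor has finite support there. -/
lemma finite_zeros_box (hf : IsMeromorphicModularForm N k f) (hN : 1 ≤ N)
    (hcusp : ∀ σ : SL(2, ℤ), cuspOrder N k f σ = 0) (σ : SL(2, ℤ)) :
    {w ∈ box | f (σ • w) = 0}.Finite := by
  obtain ⟨y, C, hy, hyC⟩ := hf.exists_bound_slash hN hcusp σ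
  have hmer : MeromorphicOn ((f ∣[k] σ) ∘ ofComplex) (lowBox y) := fun z hz =>
    hf.meromorphicAt_slash σ ⟨z, im_pos_of_mem_lowBox hz⟩
  have hfin := (MeromorphicOn.divisor ((f ∣[k] σ) ∘ ofComplex) (lowBox y)).finiteSupport
    (isCompact_lowBox y)
  refine Set.Finite.of_finite_image (f := UpperHalfPlane.coe) (hfin.subset ?_)
    (fun a _ b _ h => UpperHalfPlane.ext h)
  rintro _ ⟨w, ⟨hw, hw0⟩, rfl⟩
  have hwy : w.im ≤ y := by
    by_contra hcon
    exact (hyC w (not_le.mp hcon).le).1 ((slash_apply_eq_zero_iff σ w).mpr hw0)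
  have hmem : (w : ℂ) ∈ lowBox y := coe_mem_lowBox.mpr ⟨hw, hwy⟩
  rw [Function.mem_support, MeromorphicOn.divisor_apply hmer hmem, hf.meromorphicOrderAt_slash]
  exact fun h => ((hf.ordAt_eq_zero_iff hN hcusp (σ • w)).mp h) hw0

/-- There are finitely many zeros and poles modulo `Γ₀(N)`. -/
lemma exists_finset_zeros (hf : IsMeromorphicModularForm N k f) (hN : 1 ≤ N)
    (hcusp : ∀ σ : SL(2, ℤ), cuspOrder N k f σ = 0) :
    ∃ Z : Finset ℍ, ∀ τ, f τ = 0 → ∃ γ ∈ Gamma0 N, γ • τ ∈ Z := by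
  obtain ⟨J, hJ⟩ := exists_finset_reps hN
  have hfin : (⋃ j ∈ J, (fun w : ℍ => j • w) '' {w ∈ box | f (j • w) = 0}).Finite :=
    J.finite_toSet.biUnion fun j _ => (hf.finite_zeros_box hN hcusp j).image _
  refine ⟨hfin.toFinset, fun τ hτ => ?_⟩
  obtain ⟨γ, hγ, j, hj, w, hw, h⟩ := hJ τ
  refine ⟨γ, hγ, ?_⟩
  rw [Set.Finite.mem_toFinset, Set.mem_iUnion₂]
  refine ⟨j, hj, w, ⟨hw, ?_⟩, h.symm⟩
  rw [← h, hf.smul_eq hγ, hτ, mul_zero]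

lemma finite_orbits (hf : IsMeromorphicModularForm N k f) (hN : 1 ≤ N)
    (hcusp : ∀ σ : SL(2, ℤ), cuspOrder N k f σ = 0) :
    {z : MulAction.orbitRel.Quotient (Gamma0 N) ℍ | ordAt f z.out ≠ 0}.Finite := by
  obtain ⟨Z, hZ⟩ := hf.exists_finset_zeros hN hcusp
  refine (Z.finite_toSet.image
    (fun z => (Quotient.mk _ z : MulAction.orbitRel.Quotient (Gamma0 N) ℍ))).subset ?_
  intro z hz
  rw [Set.mem_ofPred_eq, ne_eq, hf.ordAt_eq_zero_iff hN hcusp, not_not] at hz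
  obtain ⟨γ, hγ, hmem⟩ := hZ _ hz
  refine ⟨γ • z.out, hmem, ?_⟩
  conv_rhs => rw [← Quotient.out_eq z]
  exact Quotient.sound ⟨⟨γ, hγ⟩, rfl⟩

lemma countable_zeros (hf : IsMeromorphicModularForm N k f) (hN : 1 ≤ N)
    (hcusp : ∀ σ : SL(2, ℤ), cuspOrder N k f σ = 0) : {τ | f τ = 0}.Countable := by
  obtain ⟨Z, hZ⟩ := hf.exists_finset_zeros hN hcusp
  have h : (⋃ γ : SL(2, ℤ), (fun w : ℍ => γ • w) '' (Z : Set ℍ)).Countable :=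
    Set.countable_iUnion fun γ => Z.countable_toSet.image _
  refine h.mono fun τ hτ => ?_
  obtain ⟨γ, -, hmem⟩ := hZ τ hτ
  exact Set.mem_iUnion.mpr ⟨γ⁻¹, _, hmem, inv_smul_smul _ _⟩

lemma finite_zeros_inter (hf : IsMeromorphicModularForm N k f) (hN : 1 ≤ N)
    (hcusp : ∀ σ : SL(2, ℤ), cuspOrder N k f σ = 0) {F : Set ℍ}
    (hF : IsClosedFundamentalDomain N F) : (F ∩ {τ | f τ = 0}).Finite := by
  obtain ⟨Z, hZ⟩ := hf.exists_finset_zeros hN hcusp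
  have hfin := hF.locally_finite (Z : Set ℍ) Z.finite_toSet.isCompact
  refine (hfin.image2 (fun γ w => γ • w) Z.finite_toSet).subset ?_
  rintro τ ⟨hτF, hτ⟩
  obtain ⟨γ, hγ, hmem⟩ := hZ τ hτ
  refine ⟨γ⁻¹, ⟨inv_mem hγ, γ • τ, hmem, ?_⟩, γ • τ, hmem, inv_smul_smul _ _⟩
  rwa [inv_smul_smul]

lemma analyticAt_of_ne_zero (hf : IsMeromorphicModularForm N k f) {z : ℍ} (hz : f z ≠ 0) :
    AnalyticAt ℂ (f ∘ ofComplex) z :=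
  (hf.meromorphic z.im_pos).meromorphicOrderAt_nonneg_iff_analyticAt.mp
    ((hf.meromorphicOrderAt_eq_zero_iff z).mpr hz).ge

lemma measurable_form (hf : IsMeromorphicModularForm N k f) : Measurable f := by
  have hopen : IsOpen {τ : ℍ | f τ ≠ 0} := by
    rw [isOpen_iff_mem_nhds]
    intro z hz
    have h1 := (hf.analyticAt_of_ne_zero hz).continuousAt
    have h2 : ContinuousAt f z := by
      have := ContinuousAt.comp (f := UpperHalfPlane.coe) (x := z) h1
        UpperHalfPlane.continuous_coe.continuousAt
      simpa [Function.comp_def] using this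
    exact h2.eventually_ne hz
  have hcont : ContinuousOn f {τ : ℍ | f τ ≠ 0} := by
    intro z hz
    have h1 := (hf.analyticAt_of_ne_zero hz).continuousAt
    have := ContinuousAt.comp (f := UpperHalfPlane.coe) (x := z) h1
      UpperHalfPlane.continuous_coe.continuousAt
    exact (by simpa [Function.comp_def] using this : ContinuousAt f z).continuousWithinAt
  have h := hcont.measurable_piecewise (continuousOn_const (c := (0 : ℂ))) hopen.measurableSet
    (g := fun _ => 0)
  classical
  convert h using 1
  ext τ
  by_cases hτ : f τ = 0 <;> simp [Set.piecewise, hτ]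

end IsMeromorphicModularForm

open scoped ENNReal
open IsMeromorphicModularForm

/-! ### Integrability on a fundamental domain -/

lemma measurableSet_box : MeasurableSet box :=
  (measurableSet_le UpperHalfPlane.continuous_re.measurable.abs measurable_const).inter
    (measurableSet_le measurable_const UpperHalfPlane.continuous_im.measurable)

/-- Unfold against ψ, the sum of the indicators of the translates of the box by coset
representatives. These translates meet every orbit, and γ and -γ both count, so the sum of ψ over
the group is at least 2. No knowledge of the shape of F near its cusps is needed. -/
lemma IsClosedFundamentalDomain.exists_lintegral_le {N : ℕ} {F : Set ℍ}
    (hF : IsClosedFundamentalDomain N F) (hN : 1 ≤ N) :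
    ∃ J : Finset SL(2, ℤ), ∀ Φ : ℍ → ℝ≥0∞, Measurable Φ →
      (∀ γ ∈ Gamma0 N, ∀ τ, Φ (γ • τ) = Φ τ) →
      ∫⁻ τ in F, Φ τ ≤ ∑ j ∈ J, ∫⁻ τ in box, Φ (j • τ) := by
  obtain ⟨J, hJ⟩ := exists_finset_reps hN
  refine ⟨J, fun Φ hΦ hinv => ?_⟩
  have hm : ∀ γ : SL(2, ℤ), Measurable (fun τ : ℍ => γ • τ) :=
    fun γ => (measurePreserving_smul_SL γ).measurable
  have hb : Measurable (box.indicator (1 : ℍ → ℝ≥0∞)) := measurable_one.indicator measurableSet_box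
  set ψ : ℍ → ℝ≥0∞ := fun τ => ∑ j ∈ J, box.indicator 1 (j⁻¹ • τ) with hψ
  have hψm : Measurable ψ := Finset.measurable_fun_sum _ fun j _ => hb.comp (hm _)
  have h2 : ∀ τ, 2 ≤ ∑' γ : Gamma0 N, ψ ((γ : SL(2, ℤ)) • τ) := by
    intro τ
    obtain ⟨γ, hγ, j, hj, w, hw, h⟩ := hJ τ
    have h1 : 1 ≤ ψ (γ • τ) := by
      rw [h]
      refine le_trans ?_ (Finset.single_le_sum (f := fun j' => box.indicator (1 : ℍ → ℝ≥0∞)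
        (j'⁻¹ • j • w)) (fun _ _ => zero_le) hj)
      simp only [inv_smul_smul]
      rw [Set.indicator_of_mem hw, Pi.one_apply]
    refine le_trans ?_ (ENNReal.sum_le_tsum
      ({⟨γ, hγ⟩, ⟨-γ, neg_mem_Gamma0 hγ⟩} : Finset (Gamma0 N)))
    rw [Finset.sum_pair]
    · simp only [ModularGroup.SL_neg_smul]
      rw [← one_add_one_eq_two]
      exact add_le_add h1 h1
    · intro h
      exact neg_ne_self_SL γ (Subtype.ext_iff.mp h).symm
  have h3 : 2 * ∫⁻ τ in F, Φ τ ≤ 2 * ∫⁻ τ, Φ τ * ψ τ := by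
    rw [← hF.lintegral_mul_tsum hΦ hψm hinv, ← lintegral_const_mul _ hΦ]
    refine lintegral_mono fun τ => ?_
    rw [mul_comm]
    exact mul_le_mul_right (h2 τ) _
  refine ((ENNReal.mul_le_mul_iff_right two_ne_zero ENNReal.ofNat_ne_top).mp h3).trans_eq ?_
  simp_rw [hψ, Finset.mul_sum]
  rw [lintegral_finsetSum (f := fun j τ => Φ τ * box.indicator 1 (j⁻¹ • τ)) _
    fun j _ => hΦ.mul (hb.comp (hm _))]
  refine Finset.sum_congr rfl fun j _ => ?_
  rw [← (measurePreserving_smul_SL j).lintegral_comp_emb (measurableEmbedding_smul_SL j),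
    ← lintegral_indicator measurableSet_box]
  refine lintegral_congr fun τ => ?_
  simp only [inv_smul_smul]
  by_cases hτ : τ ∈ box
  · rw [Set.indicator_of_mem hτ, Set.indicator_of_mem hτ, Pi.one_apply, mul_one]
  · rw [Set.indicator_of_notMem hτ, Set.indicator_of_notMem hτ, mul_zero]

lemma lintegral_box_rpow_lt_top : ∫⁻ τ in box, ENNReal.ofReal (τ.im ^ (1 / 2 : ℝ)) < ⊤ := by
  have him : Measurable (fun τ : ℍ => τ.im) := UpperHalfPlane.continuous_im.measurable
  have hm : Measurable fun τ : ℍ => ENNReal.ofReal (τ.im ^ (1 / 2 : ℝ)) :=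
    (him.pow_const _).ennreal_ofReal
  rw [← lintegral_indicator measurableSet_box,
    lintegral_eq_lintegral_prod _ (hm.indicator measurableSet_box)]
  -- The exponent is 1/2 - 2. The endpoint 1/4 lies strictly below the bottom edge v = 1/2 of the
  -- box, so the open half-line contains that edge.
  have hinteg : IntegrableOn (fun v : ℝ => v ^ (-(3 / 2) : ℝ)) (Set.Ioi (1 / 4)) :=
    integrableOn_Ioi_rpow_of_lt (by norm_num) (by norm_num)
  refine lt_of_le_of_lt (b := ∫⁻ v in Set.Ioi (1 / 4 : ℝ), ENNReal.ofReal (v ^ (-(3 / 2) : ℝ))) ?_ ?_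
  · rw [← lintegral_indicator measurableSet_Ioi, ← lintegral_indicator measurableSet_Ioi]
    refine lintegral_mono fun v => ?_
    by_cases hv : 0 < v
    swap
    · rw [Set.indicator_of_notMem (by simpa using hv)]
      exact zero_le
    rw [Set.indicator_of_mem (by simpa using hv)]
    have key : ∀ u : ℝ, box.indicator (fun τ : ℍ => ENNReal.ofReal (τ.im ^ (1 / 2 : ℝ)))
        (ofComplex (u + v * Complex.I)) ≤ (Set.Icc (-(1 / 2)) (1 / 2)).indicator
          (fun _ => (Set.Ioi (1 / 4 : ℝ)).indicator (fun v => ENNReal.ofReal (v ^ (1 / 2 : ℝ))) v)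
          u := by
      intro u
      have h := imRe_ofComplex (p := (v, u)) hv
      have h1 : (ofComplex (u + v * Complex.I)).im = v := congrArg Prod.fst h
      have h2 : (ofComplex (u + v * Complex.I)).re = u := congrArg Prod.snd h
      by_cases hmem : ofComplex (u + v * Complex.I) ∈ box
      · rw [Set.indicator_of_mem hmem, h1]
        have h3 := hmem.1
        have h4 := hmem.2
        rw [h2] at h3
        rw [h1] at h4
        rw [Set.indicator_of_mem (Set.mem_Icc.mpr (abs_le.mp h3)),
          Set.indicator_of_mem (Set.mem_Ioi.mpr (by linarith))]
      · rw [Set.indicator_of_notMem hmem]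
        exact zero_le
    refine le_trans (mul_le_mul_right (lintegral_mono key) _) ?_
    rw [lintegral_indicator measurableSet_Icc, setLIntegral_const, Real.volume_Icc]
    norm_num
    by_cases hv4 : 1 / 4 < v
    · rw [Set.indicator_of_mem (by simpa using hv4), Set.indicator_of_mem (by simpa using hv4),
        ← ENNReal.ofReal_mul (by positivity)]
      refine ENNReal.ofReal_le_ofReal (le_of_eq ?_)
      rw [← Real.rpow_natCast, ← Real.rpow_neg hv.le, ← Real.rpow_add hv]
      norm_num
    · rw [Set.indicator_of_notMem (by simpa using hv4)]
      simp
  · exact hinteg.lintegral_lt_top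

lemma abs_log_le_mul_rpow {v : ℝ} (hv : 1 / 2 ≤ v) : |Real.log v| ≤ 4 * v ^ (1 / 2 : ℝ) := by
  have hv0 : 0 < v := by linarith
  have hp : 0 < v ^ (1 / 2 : ℝ) := Real.rpow_pos_of_pos hv0 _
  have h1 := Real.log_le_rpow_div hv0.le (show (0 : ℝ) < 1 / 2 by norm_num)
  have h2 := Real.log_le_rpow_div (inv_pos.mpr hv0).le (show (0 : ℝ) < 1 / 2 by norm_num)
  rw [Real.log_inv, Real.inv_rpow hv0.le] at h2
  have h3 : (v ^ (1 / 2 : ℝ)) * (v ^ (1 / 2 : ℝ)) = v := by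
    rw [← Real.rpow_add hv0]; norm_num
  have h4 : (v ^ (1 / 2 : ℝ))⁻¹ ≤ 2 * v ^ (1 / 2 : ℝ) := by
    rw [inv_le_iff_one_le_mul₀ hp]
    nlinarith
  rw [abs_le]
  constructor <;> linarith

lemma abs_logAbs_le (k : ℤ) (f : ℍ → ℂ) (τ : ℍ) :
    |logAbs k f τ| ≤ |(k : ℝ) / 2| * |Real.log τ.im| + |Real.log ‖f τ‖| := by
  by_cases h : f τ = 0
  · rw [logAbs, h]
    simp
    positivity
  · rw [logAbs_eq h, ← abs_mul]
    exact abs_add_le _ _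

namespace IsMeromorphicModularForm

variable {N : ℕ} {k : ℤ} {f : ℍ → ℂ} {F : Set ℍ}

lemma measurable_logAbs (hf : IsMeromorphicModularForm N k f) : Measurable (logAbs k f) := by
  have him : Measurable (fun τ : ℍ => τ.im) := UpperHalfPlane.continuous_im.measurable
  exact ((him.pow_const _).mul hf.measurable_form.norm).log

lemma integrableOn_lowBox (hf : IsMeromorphicModularForm N k f) (hN : 1 ≤ N)
    (hcusp : ∀ σ : SL(2, ℤ), cuspOrder N k f σ = 0) (σ : SL(2, ℤ)) (y : ℝ) :
    IntegrableOn (fun z : ℂ => Real.log ‖((f ∣[k] σ) ∘ ofComplex) z‖) (lowBox y) := by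
  refine LocallyIntegrableOn.integrableOn_isCompact (fun z hz => ?_) (isCompact_lowBox y)
  have h0 : 0 < z.im := im_pos_of_mem_lowBox hz
  refine (integrableAtFilter_log_norm_meromorphic (hf.meromorphicAt_slash σ ⟨z, h0⟩) ?_).filter_mono
    nhdsWithin_le_nhds
  rw [hf.meromorphicOrderAt_slash]
  exact hf.meromorphicOrderAt_ne_top hN hcusp _

lemma measurable_slash (hf : IsMeromorphicModularForm N k f) (σ : SL(2, ℤ)) :
    Measurable (f ∣[k] σ) := by
  rw [ModularForm.SL_slash_def]
  refine (hf.measurable_form.comp (measurePreserving_smul_SL σ).measurable).mul ?_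
  refine Measurable.pow_const ?_ _
  have : Continuous fun τ : ℍ => denom σ τ := by
    simp_rw [ModularGroup.denom_apply]
    fun_prop
  exact this.measurable

/-- Above height y the logarithm of the slashed form is bounded, so only log v remains and v^(1/2)
dominates it. Below y the box is compact in ℂ, where local integrability applies and the density
1/v² is at most 4. -/
lemma lintegral_box_lt_top (hf : IsMeromorphicModularForm N k f) (hN : 1 ≤ N)
    (hcusp : ∀ σ : SL(2, ℤ), cuspOrder N k f σ = 0) (σ : SL(2, ℤ)) :
    ∫⁻ τ in box, ENNReal.ofReal |logAbs k f (σ • τ)| < ⊤ := by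
  obtain ⟨y, C, hy, hyC⟩ := hf.exists_bound_slash hN hcusp σ
  set A : ℝ := |(k : ℝ) / 2| * 4 + |C| with hA
  have hA0 : 0 ≤ A := by positivity
  set Ψ : ℍ → ℝ≥0∞ := fun τ => (lowBox y).indicator
    (fun z => ENNReal.ofReal |Real.log ‖((f ∣[k] σ) ∘ ofComplex) z‖|) (τ : ℂ) with hΨ
  have hlogm : Measurable fun z : ℂ => ENNReal.ofReal |Real.log ‖((f ∣[k] σ) ∘ ofComplex) z‖| :=
    ((hf.measurable_slash σ).comp measurable_ofComplex).norm.log.abs.ennreal_ofReal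
  have hΨm : Measurable Ψ :=
    (hlogm.indicator (isCompact_lowBox y).measurableSet).comp measurable_coe
  have hle : ∀ τ ∈ box, ENNReal.ofReal |logAbs k f (σ • τ)| ≤
      ENNReal.ofReal A * ENNReal.ofReal (τ.im ^ (1 / 2 : ℝ)) + Ψ τ := by
    intro τ hτ
    have h1 := abs_logAbs_le k (f ∣[k] σ) τ
    have h2 := abs_log_le_mul_rpow hτ.2
    rw [logAbs_smul, ← ENNReal.ofReal_mul hA0]
    by_cases hτy : τ.im ≤ y
    · simp only [hΨ]
      rw [Set.indicator_of_mem (coe_mem_lowBox.mpr ⟨hτ, hτy⟩),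
        ← ENNReal.ofReal_add (mul_nonneg hA0 (Real.rpow_nonneg τ.im_pos.le _)) (abs_nonneg _)]
      refine ENNReal.ofReal_le_ofReal (h1.trans ?_)
      rw [Function.comp_apply, ofComplex_apply]
      refine add_le_add ?_ le_rfl
      have h3 := mul_le_mul_of_nonneg_left h2 (abs_nonneg ((k : ℝ) / 2))
      have h4 : 0 ≤ |C| * τ.im ^ (1 / 2 : ℝ) :=
        mul_nonneg (abs_nonneg _) (Real.rpow_nonneg τ.im_pos.le _)
      rw [hA]
      nlinarith
    · push Not at hτy
      refine le_trans (ENNReal.ofReal_le_ofReal (h1.trans ?_)) le_self_add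
      have h3 := mul_le_mul_of_nonneg_left h2 (abs_nonneg ((k : ℝ) / 2))
      have h4 := ((hyC τ hτy.le).2).trans (le_abs_self C)
      have h5 : |C| ≤ |C| * τ.im ^ (1 / 2 : ℝ) :=
        le_mul_of_one_le_right (abs_nonneg _) (Real.one_le_rpow (by linarith) (by norm_num))
      rw [hA]
      nlinarith
  refine lt_of_le_of_lt (setLIntegral_mono' measurableSet_box hle) ?_
  rw [lintegral_add_right _ hΨm, lintegral_const_mul' _ _ ENNReal.ofReal_ne_top]
  refine ENNReal.add_lt_top.mpr
    ⟨ENNReal.mul_lt_top ENNReal.ofReal_lt_top lintegral_box_rpow_lt_top, ?_⟩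
  refine lt_of_le_of_lt (setLIntegral_le_lintegral _ _) ?_
  rw [lintegral_eq_lintegral_complex _ hΨm]
  have hle2 : ∀ z ∈ {z : ℂ | 0 < z.im}, ENNReal.ofReal (1 / z.im ^ 2) * Ψ (ofComplex z) ≤
      4 * (lowBox y).indicator
        (fun z => ENNReal.ofReal |Real.log ‖((f ∣[k] σ) ∘ ofComplex) z‖|) z := by
    intro z hz
    simp only [hΨ]
    rw [ofComplex_apply_of_im_pos hz, UpperHalfPlane.coe_mk]
    by_cases hmem : z ∈ lowBox y
    · refine mul_le_mul_left ?_ _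
      rw [show (4 : ℝ≥0∞) = ENNReal.ofReal 4 by simp]
      refine ENNReal.ofReal_le_ofReal ?_
      have h1 := hmem.2.1
      rw [div_le_iff₀ (pow_pos hz 2)]
      nlinarith
    · rw [Set.indicator_of_notMem hmem]
      simp
  refine lt_of_le_of_lt (setLIntegral_mono' isOpen_upperHalfPlaneSet.measurableSet hle2) ?_
  refine lt_of_le_of_lt (setLIntegral_le_lintegral _ _) ?_
  rw [lintegral_const_mul' _ _ ENNReal.ofNat_ne_top,
    lintegral_indicator (isCompact_lowBox y).measurableSet]
  refine ENNReal.mul_lt_top ENNReal.ofNat_lt_top ?_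
  exact (hf.integrableOn_lowBox hN hcusp σ y).abs.lintegral_lt_top

/-- `log (v^(k/2) |f|)` is integrable on a fundamental domain. -/
lemma integrableOn_logAbs (hf : IsMeromorphicModularForm N k f) (hN : 1 ≤ N)
    (hcusp : ∀ σ : SL(2, ℤ), cuspOrder N k f σ = 0) (hF : IsClosedFundamentalDomain N F) :
    IntegrableOn (logAbs k f) F := by
  obtain ⟨J, hJ⟩ := hF.exists_lintegral_le hN
  refine ⟨hf.measurable_logAbs.aestronglyMeasurable, ?_⟩
  rw [hasFiniteIntegral_iff_norm]
  refine lt_of_le_of_lt (hJ (fun τ => ENNReal.ofReal ‖logAbs k f τ‖)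
    hf.measurable_logAbs.norm.ennreal_ofReal fun γ hγ τ => by rw [logAbs_smul_of_mem hf hγ]) ?_
  exact ENNReal.sum_lt_top.mpr fun j _ => hf.lintegral_box_lt_top hN hcusp j

end IsMeromorphicModularForm

lemma volume_box_lt_top : volume box < ⊤ := by
  have h : ∀ τ ∈ box, (1 : ℝ≥0∞) ≤ ENNReal.ofReal 2 * ENNReal.ofReal (τ.im ^ (1 / 2 : ℝ)) := by
    intro τ hτ
    rw [← ENNReal.ofReal_mul (by norm_num), ENNReal.one_le_ofReal]
    have h1 : (τ.im ^ (1 / 2 : ℝ)) * (τ.im ^ (1 / 2 : ℝ)) = τ.im := by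
      rw [← Real.rpow_add τ.im_pos]; norm_num
    have h2 : 0 < τ.im ^ (1 / 2 : ℝ) := Real.rpow_pos_of_pos τ.im_pos _
    have h3 := hτ.2
    nlinarith
  calc volume box = ∫⁻ _ in box, 1 := by simp
    _ ≤ ∫⁻ τ in box, ENNReal.ofReal 2 * ENNReal.ofReal (τ.im ^ (1 / 2 : ℝ)) :=
        setLIntegral_mono' measurableSet_box h
    _ = ENNReal.ofReal 2 * ∫⁻ τ in box, ENNReal.ofReal (τ.im ^ (1 / 2 : ℝ)) :=
        lintegral_const_mul' _ _ ENNReal.ofReal_ne_top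
    _ < ⊤ := ENNReal.mul_lt_top ENNReal.ofReal_lt_top lintegral_box_rpow_lt_top

lemma IsClosedFundamentalDomain.volume_lt_top {N : ℕ} {F : Set ℍ}
    (hF : IsClosedFundamentalDomain N F) (hN : 1 ≤ N) : volume F < ⊤ := by
  obtain ⟨J, hJ⟩ := hF.exists_lintegral_le hN
  have h := hJ (fun _ => 1) measurable_const fun _ _ _ => rfl
  simp only [lintegral_const, Measure.restrict_apply_univ, one_mul] at h
  exact lt_of_le_of_lt h (ENNReal.sum_lt_top.mpr fun j _ => volume_box_lt_top)

/-! ### The regularized inner product -/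

lemma isOpen_horoball (ρ : OnePoint ℚ) (y : ℝ) : IsOpen (horoball ρ y) := by
  have h : horoball ρ y = ⋃ σ ∈ {σ : SL(2, ℤ) |
      Matrix.SpecialLinearGroup.mapGL ℚ σ • (OnePoint.infty : OnePoint ℚ) = ρ},
      {τ : ℍ | y < (σ⁻¹ • τ).im} := by
    ext τ
    simp only [horoball, Set.mem_ofPred_eq, Set.mem_iUnion, exists_prop]
  rw [h]
  exact isOpen_biUnion fun σ _ => isOpen_lt continuous_const
    (UpperHalfPlane.continuous_im.comp (continuous_smul_SL σ⁻¹))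

lemma notMem_horoball {ρ : OnePoint ℚ} {y : ℝ} {τ : ℍ} (h : max τ.im (1 / τ.im) ≤ y) :
    τ ∉ horoball ρ y := by
  rintro ⟨σ, -, hσ⟩
  exact absurd (im_smul_le_max σ⁻¹ τ) (not_le.mpr (lt_of_le_of_lt h hσ))

lemma isOpen_disc (z : ℍ) (ε : ℝ) : IsOpen {τ : ℍ | ‖(τ : ℂ) - (z : ℂ)‖ < ε} :=
  isOpen_lt (by fun_prop) continuous_const

/-- The regularized integral of an integrable function is its integral. -/
lemma hasRegularizedInnerProduct_of_integrableOn {F : Set ℍ} (hFm : MeasurableSet F)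
    {φ ψ : ℍ → ℂ} (hfin : (singularPoints F φ ψ).Finite)
    (hinteg : IntegrableOn (fun τ => φ τ * conj (ψ τ)) F) :
    HasRegularizedInnerProduct F φ ψ (∫ τ in F, φ τ * conj (ψ τ)) := by
  set Z := singularPoints F φ ψ with hZ
  set G : ℍ → ℂ := fun τ => φ τ * conj (ψ τ) with hG
  set D : ℝ → Set ℍ := fun ε => ⋃ z ∈ Z, {τ : ℍ | ‖(τ : ℂ) - (z : ℂ)‖ < ε} with hD
  have hDm : ∀ ε, MeasurableSet (D ε) := fun ε =>
    (isOpen_biUnion fun z _ => isOpen_disc z ε).measurableSet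
  have hpm : ∀ ε y, MeasurableSet (puncturedDomain F Z ε y) := fun ε y =>
    hFm.diff ((hDm ε).union (isOpen_biUnion fun ρ _ => isOpen_horoball ρ y).measurableSet)
  have hinteg' : Integrable (F.indicator G) := (integrable_indicator_iff hFm).mpr hinteg
  -- Both limits are dominated convergence with majorant ‖G‖ on F: each point leaves all horoballs
  -- once y ≥ max(v, 1/v), and each point outside the finite, hence null, set Z leaves all discs for
  -- small ε.
  refine ⟨hfin, fun ε => ∫ τ in F \ D ε, G τ, Eventually.of_forall fun ε => ⟨?_, ?_⟩, ?_⟩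
  · exact Eventually.of_forall fun y => hinteg.mono_set Set.sdiff_subset
  · change Tendsto (fun y => ∫ τ in puncturedDomain F Z ε y, G τ) atTop (𝓝 (∫ τ in F \ D ε, G τ))
    rw [← integral_indicator (hFm.diff (hDm ε)),
      funext fun y => (integral_indicator (f := G) (μ := volume) (hpm ε y)).symm]
    refine tendsto_integral_filter_of_dominated_convergence (fun τ => ‖F.indicator G τ‖)
      (Eventually.of_forall fun y => ?_) (Eventually.of_forall fun y => ae_of_all _ fun τ => ?_)
      hinteg'.norm (ae_of_all _ fun τ => ?_)
    · exact ((integrable_indicator_iff (hpm ε y)).mpr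
        (hinteg.mono_set Set.sdiff_subset)).aestronglyMeasurable
    · exact norm_indicator_le_of_subset Set.sdiff_subset _ _
    · refine tendsto_const_nhds.congr' ?_
      filter_upwards [eventually_ge_atTop (max τ.im (1 / τ.im))] with y hy
      have : τ ∈ puncturedDomain F Z ε y ↔ τ ∈ F \ D ε := by
        rw [puncturedDomain, Set.mem_sdiff, Set.mem_sdiff, Set.mem_union, not_or]
        have h2 : τ ∉ ⋃ ρ ∈ cuspsOf F, horoball ρ y := by
          simp only [Set.mem_iUnion, not_exists]
          exact fun ρ _ => notMem_horoball hy
        tauto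
      by_cases h : τ ∈ F \ D ε
      · rw [Set.indicator_of_mem h, Set.indicator_of_mem (this.mpr h)]
      · rw [Set.indicator_of_notMem h, Set.indicator_of_notMem (mt this.mp h)]
  · simp_rw [← integral_indicator (hFm.diff (hDm _)), ← integral_indicator hFm]
    refine tendsto_integral_filter_of_dominated_convergence (fun τ => ‖F.indicator G τ‖)
      (Eventually.of_forall fun ε => ?_) (Eventually.of_forall fun ε => ae_of_all _ fun τ => ?_)
      hinteg'.norm ?_
    · exact ((integrable_indicator_iff (hFm.diff (hDm ε))).mpr
        (hinteg.mono_set Set.sdiff_subset)).aestronglyMeasurable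
    · exact norm_indicator_le_of_subset Set.sdiff_subset _ _
    · have hnull : volume Z = 0 := by
        have : volume.comap UpperHalfPlane.coe Z = 0 := by
          rw [measurableEmbedding_coe.comap_apply]
          exact (hfin.image _).measure_zero _
        rw [volume_def]
        exact withDensity_absolutelyContinuous _ _ this
      filter_upwards [measure_eq_zero_iff_ae_notMem.mp hnull] with τ hτ
      refine tendsto_const_nhds.congr' ?_
      have hev : ∀ᶠ ε in 𝓝[>] (0 : ℝ), ∀ z ∈ Z, ε ≤ ‖(τ : ℂ) - (z : ℂ)‖ := by
        rw [Set.Finite.eventually_all hfin]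
        intro z hz
        refine nhdsWithin_le_nhds (eventually_le_nhds ?_)
        rw [norm_pos_iff, sub_ne_zero]
        rintro h
        exact hτ (UpperHalfPlane.ext h ▸ hz)
      filter_upwards [hev] with ε hε
      have hD' : τ ∉ D ε := by
        simp only [hD, Set.mem_iUnion, not_exists]
        intro z hz
        exact not_lt.mpr (hε z hz)
      by_cases h : τ ∈ F
      · rw [Set.indicator_of_mem h, Set.indicator_of_mem (show τ ∈ F \ D ε from ⟨h, hD'⟩)]
      · rw [Set.indicator_of_notMem h, Set.indicator_of_notMem (fun h' => h h'.1)]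

namespace IsMeromorphicModularForm

variable {N : ℕ} {k : ℤ} {f : ℍ → ℂ} {F : Set ℍ}

lemma contDiffAt_logNorm (hf : IsMeromorphicModularForm N k f) {z : ℍ} (hz : f z ≠ 0) :
    ContDiffAt ℝ ∞ (logNorm k f ∘ ofComplex) (z : ℂ) := by
  have h1 : ContDiffAt ℝ ∞ (f ∘ ofComplex) (z : ℂ) :=
    ((hf.analyticAt_of_ne_zero hz).contDiffAt).restrict_scalars ℝ
  have hz' : (f ∘ ofComplex) (z : ℂ) ≠ 0 := by simpa using hz
  have h2 : ContDiffAt ℝ ∞ (fun w : ℂ => w.im ^ ((k : ℝ) / 2)) (z : ℂ) :=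
    ContDiffAt.rpow_const_of_ne Complex.imCLM.contDiff.contDiffAt z.im_ne_zero
  have h3 : ContDiffAt ℝ ∞ (fun w : ℂ => ((Real.log (w.im ^ ((k : ℝ) / 2) *
      ‖(f ∘ ofComplex) w‖) : ℝ) : ℂ)) (z : ℂ) := by
    refine Complex.ofRealCLM.contDiff.contDiffAt.comp (z : ℂ) (ContDiffAt.log ?_ ?_)
    · exact h2.mul (h1.norm ℝ hz')
    · exact mul_ne_zero (Real.rpow_pos_of_pos z.im_pos _).ne' (norm_ne_zero_iff.mpr hz')
  refine h3.congr_of_eventuallyEq ?_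
  filter_upwards [isOpen_upperHalfPlaneSet.mem_nhds z.im_pos] with w hw
  simp only [Function.comp_apply, logNorm]
  rw [ofComplex_apply_of_im_pos hw]
  rfl

/-- The regularized inner product of `1` and `log (v^(k/2) |f|)` is a convergent integral. -/
lemma hasRegularizedInnerProduct (hf : IsMeromorphicModularForm N k f) (hN : 1 ≤ N)
    (hcusp : ∀ σ : SL(2, ℤ), cuspOrder N k f σ = 0) (hF : IsClosedFundamentalDomain N F) :
    HasRegularizedInnerProduct F (fun _ => 1) (logNorm k f)
      ((∫ τ in F, logAbs k f τ : ℝ) : ℂ) := by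
  have hfin : (singularPoints F (fun _ => 1) (logNorm k f)).Finite := by
    refine (hf.finite_zeros_inter hN hcusp hF).subset ?_
    rintro z ⟨hzF, hz⟩
    refine ⟨hzF, ?_⟩
    by_contra hne
    rcases hz with hz | hz
    · exact hz contDiffAt_const
    · exact hz (hf.contDiffAt_logNorm hne)
  have e : (fun τ => (1 : ℂ) * conj (logNorm k f τ)) = fun τ => (logAbs k f τ : ℂ) := by
    funext τ
    rw [logNorm_eq, Complex.conj_ofReal, one_mul]
  have h := hasRegularizedInnerProduct_of_integrableOn hF.measurableSet hfin
    (by rw [e]; exact (hf.integrableOn_logAbs hN hcusp hF).ofReal)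
  rw [e, integral_complex_ofReal] at h
  exact h

end IsMeromorphicModularForm

open scoped ENNReal

/-! ### Jensen's formula on horizontal segments -/

lemma cuspWidth_one (N : ℕ) : cuspWidth N 1 = 1 := by
  refine le_antisymm (Nat.sInf_le ⟨one_pos, ?_⟩) ?_
  · simp
  · have hne : {l : ℕ | 0 < l ∧ (1 : SL(2, ℤ)) * ModularGroup.T ^ l * 1⁻¹ ∈ Gamma0 N}.Nonempty :=
      ⟨1, one_pos, by simp⟩
    exact (Nat.sInf_mem hne).1

/-- The distance of `w` above the horizontal line of height `v`, for `w` in the strip, summed over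
an orbit. -/
def heightSum (N : ℕ) (z : ℍ) (v : ℝ) : ℝ≥0∞ :=
  ∑' w : MulAction.orbit (Gamma0 N) z, stripFun (fun y => ENNReal.ofReal (y - v)) w

namespace IsMeromorphicModularForm

variable {N : ℕ} {k : ℤ} {f : ℍ → ℂ} {F : Set ℍ}

lemma expansion_comp_qParam (hf : IsMeromorphicModularForm N k f) (hN : 1 ≤ N) :
    expansionAtCusp N k f 1 ∘ Function.Periodic.qParam 1 = f ∘ ofComplex := by
  funext z
  have h := hf.periodic_slash hN 1
  rw [cuspWidth_one, SlashAction.slash_one] at h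
  rw [Function.comp_apply, expansionAtCusp, cuspWidth_one, SlashAction.slash_one, Nat.cast_one]
  exact Function.Periodic.eq_cuspFunction one_ne_zero (by simpa using h) z

lemma deriv_qParam_ne_zero (z : ℂ) : deriv (Function.Periodic.qParam 1) z ≠ 0 := by
  have h : HasDerivAt (Function.Periodic.qParam 1)
      (Complex.exp (2 * Real.pi * Complex.I * z / (1 : ℝ)) * (2 * Real.pi * Complex.I / (1 : ℝ)))
      z := by
    have := (((hasDerivAt_id z).const_mul (2 * Real.pi * Complex.I)).div_const ((1 : ℝ) : ℂ)).cexp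
    rw [mul_one] at this
    exact this
  rw [h.deriv]
  refine mul_ne_zero (Complex.exp_ne_zero _) ?_
  simp [Real.pi_ne_zero]

lemma analyticAt_qParam (z : ℂ) : AnalyticAt ℂ (Function.Periodic.qParam 1) z :=
  (Function.Periodic.differentiable_qParam (h := 1)).analyticAt z

lemma meromorphicAt_expansion (hf : IsMeromorphicModularForm N k f) (hN : 1 ≤ N) (z : ℍ) :
    MeromorphicAt (expansionAtCusp N k f 1) (Function.Periodic.qParam 1 (z : ℂ)) := by
  rw [← meromorphicAt_comp_iff_of_deriv_ne_zero (analyticAt_qParam _) (deriv_qParam_ne_zero _),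
    hf.expansion_comp_qParam hN]
  exact hf.meromorphicAt z

/-- The map to q has nowhere vanishing derivative, so it preserves orders and the divisor in the
punctured disc is that of f in a strip of width one. -/
lemma meromorphicOrderAt_expansion (hf : IsMeromorphicModularForm N k f) (hN : 1 ≤ N) (z : ℍ) :
    meromorphicOrderAt (expansionAtCusp N k f 1) (Function.Periodic.qParam 1 (z : ℂ)) =
      meromorphicOrderAt (f ∘ ofComplex) z := by
  rw [← meromorphicOrderAt_comp_of_deriv_ne_zero (analyticAt_qParam _) (deriv_qParam_ne_zero _),
    hf.expansion_comp_qParam hN]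

lemma exists_strip_qParam {q : ℂ} (h0 : q ≠ 0) (h1 : ‖q‖ < 1) :
    ∃ z : ℍ, (0 ≤ z.re ∧ z.re < 1) ∧ Function.Periodic.qParam 1 (z : ℂ) = q := by
  have him := Function.Periodic.im_invQParam_pos_of_norm_lt_one one_pos h1 h0
  set z₀ : ℍ := ⟨Function.Periodic.invQParam 1 q, him⟩ with hz₀
  refine ⟨((-⌊z₀.re⌋ : ℤ) : ℝ) +ᵥ z₀, ?_, ?_⟩
  · have h1 := Int.floor_le z₀.re
    have h2 := Int.lt_floor_add_one z₀.re
    simp only [vadd_re]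
    push_cast
    constructor <;> linarith
  · rw [← Function.Periodic.qParam_right_inv one_ne_zero h0]
    simp only [Function.Periodic.qParam, coe_vadd]
    rw [Complex.exp_eq_exp_iff_exists_int]
    refine ⟨-⌊z₀.re⌋, ?_⟩
    simp [hz₀]
    ring

lemma qParam_injOn_strip {z w : ℍ} (hz : 0 ≤ z.re ∧ z.re < 1) (hw : 0 ≤ w.re ∧ w.re < 1)
    (h : Function.Periodic.qParam 1 (z : ℂ) = Function.Periodic.qParam 1 (w : ℂ)) : z = w := by
  simp only [Function.Periodic.qParam, Complex.ofReal_one, div_one] at h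
  rw [Complex.exp_eq_exp_iff_exists_int] at h
  obtain ⟨n, hn⟩ := h
  have hpi : (2 * Real.pi * Complex.I : ℂ) ≠ 0 := by simp [Real.pi_ne_zero]
  have h2 : (z : ℂ) = w + n := mul_left_cancel₀ hpi (by linear_combination hn)
  have h3 : z.re = w.re + n := by simpa using congrArg Complex.re h2
  have h4 : n = 0 := by
    have h5 : (n : ℝ) < 1 := by linarith [hz.2, hw.1]
    have h6 : (-1 : ℝ) < n := by linarith [hz.1, hw.2]
    have h7 : n < 1 := by exact_mod_cast h5
    have h8 : -1 < n := by exact_mod_cast h6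
    omega
  refine UpperHalfPlane.ext ?_
  rw [h2, h4]
  simp

lemma norm_qParam_one (z : ℂ) :
    ‖Function.Periodic.qParam 1 z‖ = Real.exp (-2 * Real.pi * z.im) := by
  rw [Function.Periodic.norm_qParam, div_one]

lemma mem_orbit_out_iff (o : MulAction.orbitRel.Quotient (Gamma0 N) ℍ) (w : ℍ) :
    w ∈ MulAction.orbit (Gamma0 N) o.out ↔
      (Quotient.mk _ w : MulAction.orbitRel.Quotient (Gamma0 N) ℍ) = o := by
  conv_rhs => rw [← Quotient.out_eq o, Quotient.eq]
  rfl

lemma ordAt_mk_out (hf : IsMeromorphicModularForm N k f) (w : ℍ) :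
    ordAt f (Quotient.mk _ w : MulAction.orbitRel.Quotient (Gamma0 N) ℍ).out = ordAt f w := by
  obtain ⟨γ, hγ⟩ := (mem_orbit_out_iff (N := N) _ w).mpr rfl
  have := hf.ordAt_smul γ.2 (Quotient.mk _ w : MulAction.orbitRel.Quotient (Gamma0 N) ℍ).out
  rw [← this]
  exact congrArg _ hγ

lemma circleMap_exp_eq_qParam (u v : ℝ) :
    circleMap 0 (Real.exp (-2 * Real.pi * v)) (2 * Real.pi * u) =
      Function.Periodic.qParam 1 (u + v * Complex.I) := by
  rw [circleMap, zero_add, Complex.ofReal_exp, ← Complex.exp_add, Function.Periodic.qParam]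
  congr 1
  push_cast
  linear_combination (-2 * Real.pi * v : ℂ) * Complex.I_sq

lemma exp_lt_one_of_pos {v : ℝ} (hv : 0 < v) : Real.exp (-2 * Real.pi * v) < 1 := by
  rw [Real.exp_lt_one_iff]
  nlinarith [Real.pi_pos]

lemma meromorphicOn_expansion (hf : IsMeromorphicModularForm N k f) (hN : 1 ≤ N) {v : ℝ}
    (hv : 0 < v) :
    MeromorphicOn (expansionAtCusp N k f 1)
      (Metric.closedBall 0 |Real.exp (-2 * Real.pi * v)|) := by
  intro q hq
  rw [abs_of_pos (Real.exp_pos _), mem_closedBall_zero_iff] at hq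
  by_cases hq0 : q = 0
  · rw [hq0]; exact hf.meromorphic_cusps 1
  · obtain ⟨z, -, rfl⟩ := exists_strip_qParam hq0 (lt_of_le_of_lt hq (exp_lt_one_of_pos hv))
    exact hf.meromorphicAt_expansion hN z

lemma circleAverage_expansion (hf : IsMeromorphicModularForm N k f) (hN : 1 ≤ N) (v : ℝ) :
    Real.circleAverage (fun q => Real.log ‖expansionAtCusp N k f 1 q‖) 0
      (Real.exp (-2 * Real.pi * v)) =
      ∫ u in (0 : ℝ)..1, Real.log ‖f (ofComplex (u + v * Complex.I))‖ := by
  have hpi : (2 * Real.pi) ≠ 0 := by positivity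
  have h := intervalIntegral.integral_comp_mul_left (a := 0) (b := 1)
    (fun θ => Real.log ‖expansionAtCusp N k f 1
      (circleMap 0 (Real.exp (-2 * Real.pi * v)) θ)‖) hpi
  rw [mul_zero, mul_one] at h
  rw [Real.circleAverage, ← h]
  refine intervalIntegral.integral_congr fun u _ => ?_
  rw [circleMap_exp_eq_qParam]
  exact congrArg (fun w => Real.log ‖w‖) (congrFun (hf.expansion_comp_qParam hN) _)

/-- Jensen's formula for the mean value of `log |f|` on a horizontal segment. -/
lemma integral_log_norm (hf : IsMeromorphicModularForm N k f) (hN : 1 ≤ N)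
    (hcusp : ∀ σ : SL(2, ℤ), cuspOrder N k f σ = 0) {c : ℂ}
    (hlim : Tendsto (expansionAtCusp N k f 1) (𝓝[≠] 0) (𝓝 c)) {v : ℝ} (hv : 0 < v) :
    (∀ o ∈ (hf.finite_orbits hN hcusp).toFinset, heightSum N o.out v ≠ ⊤) ∧
    ∫ u in (0 : ℝ)..1, Real.log ‖f (ofComplex (u + v * Complex.I))‖ =
      Real.log ‖c‖ + 2 * Real.pi * ∑ o ∈ (hf.finite_orbits hN hcusp).toFinset,
        (ordAt f o.out : ℝ) * (heightSum N o.out v).toReal := by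
  classical
  set G := expansionAtCusp N k f 1 with hG
  set R : ℝ := Real.exp (-2 * Real.pi * v) with hR
  have hRpos : 0 < R := Real.exp_pos _
  have hR1 : R < 1 := exp_lt_one_of_pos hv
  have habs : |R| = R := abs_of_pos hRpos
  have hG0 : MeromorphicAt G 0 := hf.meromorphic_cusps 1
  have hord0 : meromorphicOrderAt G 0 = 0 := hcusp 1
  have hmer : MeromorphicOn G (Metric.closedBall 0 |R|) := hf.meromorphicOn_expansion hN hv
  have hjen := MeromorphicOn.circleAverage_log_norm hRpos.ne' hmer
  set D := MeromorphicOn.divisor G (Metric.closedBall 0 |R|) with hD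
  -- Since f has neither zero nor pole at i∞, the centre contributes no multiple of log R to
  -- Jensen's formula, and the trailing coefficient is the limit c.
  have hD0 : D 0 = 0 := by
    rw [hD, MeromorphicOn.divisor_apply hmer (by simp), hord0]
    rfl
  have htrail : meromorphicTrailingCoeffAt G 0 = c := by
    have h := hG0.tendsto_nhds_meromorphicTrailingCoeffAt
    rw [hord0] at h
    refine tendsto_nhds_unique (h.congr fun q => ?_) hlim
    simp
  rw [hf.circleAverage_expansion hN v, hD0, htrail] at hjen
  have hmemball : ∀ z : ℍ, Function.Periodic.qParam 1 (z : ℂ) ∈ Metric.closedBall (0 : ℂ) |R| ↔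
      v ≤ z.im := by
    intro z
    rw [habs, mem_closedBall_zero_iff, norm_qParam_one, hR, Real.exp_le_exp, neg_mul, neg_mul,
      neg_mul, neg_le_neg_iff]
    exact mul_le_mul_iff_right₀ (by positivity)
  have hDq : ∀ z : ℍ, v ≤ z.im → D (Function.Periodic.qParam 1 (z : ℂ)) = ordAt f z := by
    intro z hz
    rw [hD, MeromorphicOn.divisor_apply hmer ((hmemball z).mpr hz),
      hf.meromorphicOrderAt_expansion hN, ordAt]
  have hDfin := D.finiteSupport (isCompact_closedBall 0 |R|)
  have hAfin : {z : ℍ | (0 ≤ z.re ∧ z.re < 1) ∧ v ≤ z.im ∧ f z = 0}.Finite := by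
    refine Set.Finite.of_finite_image
      (f := fun z : ℍ => Function.Periodic.qParam 1 (z : ℂ)) (hDfin.subset ?_) ?_
    · rintro _ ⟨z, ⟨-, hz, hz0⟩, rfl⟩
      rw [Function.mem_support, hDq z hz]
      exact fun h => (hf.ordAt_eq_zero_iff hN hcusp z).mp h hz0
    · intro z hz w hw h
      exact qParam_injOn_strip hz.1 hw.1 h
  set A := hAfin.toFinset with hA
  have hmemA : ∀ z, z ∈ A ↔ (0 ≤ z.re ∧ z.re < 1) ∧ v ≤ z.im ∧ f z = 0 := fun z => by
    rw [hA, Set.Finite.mem_toFinset]; rfl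
  -- With R = exp(-2πv) and |q| = exp(-2π Im z), the Jensen weight log(R/|q|) is 2π times the height
  -- of z above the line.
  have hsum : ∑ᶠ q, (D q : ℝ) * Real.log (R * ‖0 - q‖⁻¹) =
      ∑ z ∈ A, (ordAt f z : ℝ) * (2 * Real.pi * (z.im - v)) := by
    rw [finsum_eq_sum_of_support_subset (s := A.image fun z : ℍ => Function.Periodic.qParam 1 (z : ℂ)),
      Finset.sum_image]
    · refine Finset.sum_congr rfl fun z hz => ?_
      rw [hDq z ((hmemA z).mp hz).2.1, zero_sub, norm_neg, norm_qParam_one, hR, ← Real.exp_neg,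
        ← Real.exp_add, Real.log_exp]
      change _ * (-2 * Real.pi * v + -(-2 * Real.pi * z.im)) = _
      ring
    · intro z hz w hw h
      exact qParam_injOn_strip ((hmemA z).mp hz).1 ((hmemA w).mp hw).1 h
    · intro q hq
      have hDq0 : D q ≠ 0 := fun h => hq (by simp [h])
      have hqmem := D.supportWithinDomain hDq0
      have hq0 : q ≠ 0 := fun h => hDq0 (h ▸ hD0)
      have hq1 : ‖q‖ < 1 := by
        rw [habs, mem_closedBall_zero_iff] at hqmem
        exact lt_of_le_of_lt hqmem hR1
      obtain ⟨z, hz, rfl⟩ := exists_strip_qParam hq0 hq1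
      have hzv := (hmemball z).mp hqmem
      rw [hDq z hzv, ne_eq, hf.ordAt_eq_zero_iff hN hcusp, not_not] at hDq0
      exact Finset.mem_coe.mpr (Finset.mem_image.mpr ⟨z, (hmemA z).mpr ⟨hz, hzv, hDq0⟩, rfl⟩)
  -- `ENNReal.ofReal` gives 0 for orbit points below the line, so the infinite orbit sum only sees
  -- the finite set A.
  have hfib : ∀ o ∈ (hf.finite_orbits hN hcusp).toFinset, heightSum N o.out v =
      ∑ z ∈ A with (Quotient.mk _ z : MulAction.orbitRel.Quotient (Gamma0 N) ℍ) = o,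
        ENNReal.ofReal (z.im - v) := by
    intro o ho
    rw [Set.Finite.mem_toFinset, Set.mem_ofPred_eq] at ho
    rw [heightSum, tsum_subtype (MulAction.orbit (Gamma0 N) o.out)
      (stripFun fun y => ENNReal.ofReal (y - v)), tsum_eq_sum (s := A.filter
        fun z => (Quotient.mk _ z : MulAction.orbitRel.Quotient (Gamma0 N) ℍ) = o)]
    · refine Finset.sum_congr rfl fun z hz => ?_
      rw [Finset.mem_filter, hmemA] at hz
      rw [Set.indicator_of_mem ((mem_orbit_out_iff o z).mpr hz.2), stripFun, if_pos hz.1.1]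
    · intro z hz
      by_cases horb : z ∈ MulAction.orbit (Gamma0 N) o.out
      · rw [Set.indicator_of_mem horb, stripFun]
        split_ifs with hstrip
        · rw [ENNReal.ofReal_eq_zero]
          by_contra hcon
          push Not at hcon
          have hmk := (mem_orbit_out_iff o z).mp horb
          refine hz (Finset.mem_filter.mpr ⟨(hmemA z).mpr ⟨hstrip, by linarith, ?_⟩, hmk⟩)
          rw [← hmk, hf.ordAt_mk_out, ne_eq, hf.ordAt_eq_zero_iff hN hcusp, not_not] at ho
          exact ho
        · rfl
      · rw [Set.indicator_of_notMem horb]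
  refine ⟨fun o ho => ?_, ?_⟩
  · rw [hfib o ho]
    exact ENNReal.sum_ne_top.mpr fun _ _ => ENNReal.ofReal_ne_top
  · rw [hjen, hsum]
    have hmaps : ∀ z ∈ A, (Quotient.mk _ z : MulAction.orbitRel.Quotient (Gamma0 N) ℍ) ∈
        (hf.finite_orbits hN hcusp).toFinset := by
      intro z hz
      rw [Set.Finite.mem_toFinset, Set.mem_ofPred_eq, hf.ordAt_mk_out]
      exact fun h => (hf.ordAt_eq_zero_iff hN hcusp z).mp h ((hmemA z).mp hz).2.2
    rw [← Finset.sum_fiberwise_of_maps_to hmaps, Finset.mul_sum]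
    simp only [Int.cast_zero, zero_mul, add_zero]
    rw [add_comm]
    congr 1
    refine Finset.sum_congr rfl fun o ho => ?_
    rw [hfib o ho, ENNReal.toReal_sum fun _ _ => ENNReal.ofReal_ne_top, Finset.mul_sum,
      Finset.mul_sum]
    refine Finset.sum_congr rfl fun z hz => ?_
    rw [Finset.mem_filter, hmemA] at hz
    rw [ENNReal.toReal_ofReal (by linarith [hz.1.2.1]), ← hz.2, hf.ordAt_mk_out]
    ring

end IsMeromorphicModularForm

open scoped ENNReal

/-! ### A uniform bound for truncated Eisenstein series -/

/-- The function `v^s`, cut off at height `T`. -/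
def cutPow (T s v : ℝ) : ℝ≥0∞ := if v ≤ T then ENNReal.ofReal (v ^ s) else 0

lemma measurable_cutPow (T s : ℝ) : Measurable (cutPow T s) :=
  Measurable.ite measurableSet_Iic (measurable_id.pow_const s).ennreal_ofReal measurable_const

/-- The truncated Eisenstein series. -/
def eisTrunc (N : ℕ) (T s : ℝ) (τ : ℍ) : ℝ≥0∞ :=
  ∑' c : Coset N, cutPow T s ((c.out : SL(2, ℤ)) • τ).im

lemma tsum_cutPow (N : ℕ) (T s : ℝ) (τ : ℍ) :
    ∑' γ : Gamma0 N, stripFun (cutPow T s) ((γ : SL(2, ℤ)) • τ) = 2 * eisTrunc N T s τ :=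
  tsum_stripFun _ _

lemma lintegral_inv_sq_add_sq {A : ℝ} (hA : 0 < A) (x : ℝ) :
    ∫⁻ t : ℝ, ENNReal.ofReal (1 / (A ^ 2 + (x + t) ^ 2)) = ENNReal.ofReal (Real.pi / A) := by
  have e : ∀ t : ℝ, 1 / (A ^ 2 + (x + t) ^ 2) =
      (fun t => (A ^ 2)⁻¹ * (1 + (A⁻¹ * t) ^ 2)⁻¹) (x + t) := by
    intro t
    field_simp
  have hinteg : Integrable fun t : ℝ => (A ^ 2)⁻¹ * (1 + (A⁻¹ * t) ^ 2)⁻¹ :=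
    ((integrable_comp_mul_left_iff (fun t : ℝ => (1 + t ^ 2)⁻¹) (inv_ne_zero hA.ne')).mpr
      integrable_inv_one_add_sq).const_mul _
  simp_rw [e]
  rw [lintegral_add_left_eq_self (μ := volume)
    (fun t => ENNReal.ofReal ((A ^ 2)⁻¹ * (1 + (A⁻¹ * t) ^ 2)⁻¹)) x,
    ← ofReal_integral_eq_lintegral_ofReal hinteg (ae_of_all _ fun t => by positivity),
    integral_const_mul, Measure.integral_comp_mul_left (fun t : ℝ => (1 + t ^ 2)⁻¹),
    integral_univ_inv_one_add_sq, inv_inv, abs_of_pos hA, smul_eq_mul]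
  congr 1
  field_simp

/-- Each term is compared with an integral over [n, n+1). For t there, A² + (x+t)² ≤ A² + 2(x+n)² +
2, and 2 ≤ 8A² since A ≥ 1/2; hence the 9. -/
lemma tsum_inv_sq_add_sq_le {A : ℝ} (hA : 1 / 2 ≤ A) (x : ℝ) :
    ∑' n : ℤ, ENNReal.ofReal (1 / (A ^ 2 + (x + n) ^ 2)) ≤ ENNReal.ofReal (9 * Real.pi / A) := by
  have hA0 : 0 < A := by linarith
  have h1 : ∀ n : ℤ, ENNReal.ofReal (1 / (A ^ 2 + (x + n) ^ 2)) ≤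
      ∫⁻ t in Set.Ico (n : ℝ) (n + 1), ENNReal.ofReal 9 *
        ENNReal.ofReal (1 / (A ^ 2 + (x + t) ^ 2)) := by
    intro n
    calc ENNReal.ofReal (1 / (A ^ 2 + (x + n) ^ 2))
        = ∫⁻ _ in Set.Ico (n : ℝ) (n + 1), ENNReal.ofReal (1 / (A ^ 2 + (x + n) ^ 2)) := by
          rw [setLIntegral_const, Real.volume_Ico]
          simp
      _ ≤ _ := by
          refine setLIntegral_mono' measurableSet_Ico fun t ht => ?_
          rw [← ENNReal.ofReal_mul (by norm_num)]
          refine ENNReal.ofReal_le_ofReal ?_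
          rw [mul_one_div, div_le_div_iff₀ (by positivity) (by positivity)]
          have h2 := ht.1
          have h3 := ht.2
          have h4 : (t - n) ^ 2 ≤ 1 := by nlinarith
          nlinarith [sq_nonneg (x + n - (t - n)), sq_nonneg (x + (n : ℝ)), sq_nonneg (t - n)]
  calc ∑' n : ℤ, ENNReal.ofReal (1 / (A ^ 2 + (x + n) ^ 2))
      ≤ ∑' n : ℤ, ∫⁻ t in Set.Ico (n : ℝ) (n + 1), ENNReal.ofReal 9 *
        ENNReal.ofReal (1 / (A ^ 2 + (x + t) ^ 2)) := ENNReal.tsum_le_tsum h1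
    _ = ∫⁻ t, ENNReal.ofReal 9 * ENNReal.ofReal (1 / (A ^ 2 + (x + t) ^ 2)) := by
        rw [← lintegral_iUnion (fun n => measurableSet_Ico) (Set.pairwise_disjoint_Ico_intCast ℝ),
          iUnion_Ico_intCast, setLIntegral_univ]
    _ = ENNReal.ofReal (9 * Real.pi / A) := by
        rw [lintegral_const_mul' _ _ ENNReal.ofReal_ne_top, lintegral_inv_sq_add_sq hA0,
          ← ENNReal.ofReal_mul (by norm_num)]
        congr 1
        ring

/-- As B ≥ A² and s > 1, B^(-s) ≤ A^(2-2s) B^(-1), which reduces the row to the case s = 1. The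
remaining v^(1-s) is at most 2 because v ≥ 1/2 and s ≤ 2. -/
lemma tsum_row_le {v s : ℝ} (u : ℝ) (hv : 1 / 2 ≤ v) (hs : 1 < s) (hs2 : s ≤ 2) {c : ℤ}
    (hc : c ≠ 0) :
    ∑' d : ℤ, ENNReal.ofReal ((v / ((c * u + d) ^ 2 + (c * v) ^ 2)) ^ s) ≤
      ENNReal.ofReal (18 * Real.pi * |(c : ℝ)| ^ (1 - 2 * s)) := by
  have hv0 : 0 < v := by linarith
  have hc1 : (1 : ℝ) ≤ |(c : ℝ)| := by exact_mod_cast Int.one_le_abs hc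
  have hc0 : 0 < |(c : ℝ)| := by linarith
  set A : ℝ := |(c : ℝ)| * v with hA
  have hAv : 1 / 2 ≤ A := hv.trans (le_mul_of_one_le_left hv0.le hc1)
  have hA0 : 0 < A := by linarith
  have hA2 : A ^ 2 = (c * v) ^ 2 := by rw [hA, mul_pow, sq_abs, mul_pow]
  have h1 : ∀ d : ℤ, (v / ((c * u + d) ^ 2 + (c * v) ^ 2)) ^ s ≤
      v ^ s * A ^ (2 - 2 * s) * (1 / (A ^ 2 + (c * u + d) ^ 2)) := by
    intro d
    set B : ℝ := A ^ 2 + (c * u + d) ^ 2 with hB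
    have hBA : A ^ 2 ≤ B := by nlinarith [sq_nonneg (c * u + d)]
    have hB0 : 0 < B := lt_of_lt_of_le (by positivity) hBA
    have e1 : (c * u + d) ^ 2 + (c * v) ^ 2 = B := by rw [hB, hA2]; ring
    rw [e1, Real.div_rpow hv0.le hB0.le, mul_assoc, div_eq_mul_inv]
    refine mul_le_mul_of_nonneg_left ?_ (Real.rpow_nonneg hv0.le _)
    have e2 : (B ^ s)⁻¹ = B ^ (1 - s) * (1 / B) := by
      rw [Real.rpow_sub hB0, Real.rpow_one]
      field_simp
    rw [e2]
    refine mul_le_mul_of_nonneg_right ?_ (by positivity)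
    have e3 : A ^ (2 - 2 * s) = (A ^ 2) ^ (1 - s) := by
      rw [← Real.rpow_natCast, ← Real.rpow_mul hA0.le]
      congr 1
      push_cast
      ring
    rw [e3]
    exact Real.rpow_le_rpow_of_nonpos (by positivity) hBA (by linarith)
  have hnn : 0 ≤ v ^ s * A ^ (2 - 2 * s) := by positivity
  calc ∑' d : ℤ, ENNReal.ofReal ((v / ((c * u + d) ^ 2 + (c * v) ^ 2)) ^ s)
      ≤ ∑' d : ℤ, ENNReal.ofReal (v ^ s * A ^ (2 - 2 * s)) *
          ENNReal.ofReal (1 / (A ^ 2 + (c * u + d) ^ 2)) := by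
        refine ENNReal.tsum_le_tsum fun d => ?_
        rw [← ENNReal.ofReal_mul hnn]
        exact ENNReal.ofReal_le_ofReal (h1 d)
    _ ≤ ENNReal.ofReal (v ^ s * A ^ (2 - 2 * s)) * ENNReal.ofReal (9 * Real.pi / A) := by
        rw [ENNReal.tsum_mul_left]
        exact mul_le_mul_right (tsum_inv_sq_add_sq_le hAv _) _
    _ ≤ ENNReal.ofReal (18 * Real.pi * |(c : ℝ)| ^ (1 - 2 * s)) := by
        rw [← ENNReal.ofReal_mul hnn]
        refine ENNReal.ofReal_le_ofReal ?_
        have e4 : v ^ s * A ^ (2 - 2 * s) * (9 * Real.pi / A) =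
            9 * Real.pi * (v ^ (1 - s) * |(c : ℝ)| ^ (1 - 2 * s)) := by
          have e5 : A ^ (2 - 2 * s) / A = A ^ (1 - 2 * s) := by
            rw [show (1 - 2 * s : ℝ) = (2 - 2 * s) - 1 by ring, Real.rpow_sub_one hA0.ne']
          have e6 : v ^ s * v ^ (1 - 2 * s) = v ^ (1 - s) := by
            rw [← Real.rpow_add hv0]
            congr 1
            ring
          calc v ^ s * A ^ (2 - 2 * s) * (9 * Real.pi / A)
              = 9 * Real.pi * (v ^ s * (A ^ (2 - 2 * s) / A)) := by ring
            _ = _ := by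
              rw [e5, hA, Real.mul_rpow hc0.le hv0.le, ← e6]
              ring
        rw [e4]
        have h2 : v ^ (1 - s) ≤ 2 := by
          calc v ^ (1 - s) ≤ (1 / 2 : ℝ) ^ (1 - s) :=
                Real.rpow_le_rpow_of_nonpos (by norm_num) hv (by linarith)
            _ = 2 ^ (s - 1) := by
                rw [one_div, Real.inv_rpow (by norm_num), ← Real.rpow_neg (by norm_num)]
                congr 1
                ring
            _ ≤ 2 ^ (1 : ℝ) := Real.rpow_le_rpow_of_exponent_le (by norm_num) (by linarith)
            _ = 2 := by norm_num
        have h3 : 0 ≤ |(c : ℝ)| ^ (1 - 2 * s) := by positivity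
        have h4 := mul_le_mul_of_nonneg_right h2 h3
        nlinarith [Real.pi_pos]

lemma tsum_abs_rpow_le {s : ℝ} (hs : 1 < s) :
    ∑' c : ℤ, ENNReal.ofReal (|(c : ℝ)| ^ (1 - 2 * s)) ≤
      2 * ENNReal.ofReal (∑' n : ℕ, 1 / (n : ℝ) ^ (2 * s - 1)) := by
  have hnat : ∑' n : ℕ, ENNReal.ofReal (|((n : ℤ) : ℝ)| ^ (1 - 2 * s)) =
      ENNReal.ofReal (∑' n : ℕ, 1 / (n : ℝ) ^ (2 * s - 1)) := by
    rw [ENNReal.ofReal_tsum_of_nonneg (fun n => by positivity)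
      (Real.summable_one_div_nat_rpow.mpr (by linarith))]
    refine tsum_congr fun n => ?_
    congr 1
    rw [Int.cast_natCast, abs_of_nonneg (Nat.cast_nonneg n), one_div, ← Real.rpow_neg
      (Nat.cast_nonneg n)]
    congr 1
    ring
  rw [(ENNReal.summable.hasSum.of_nat_of_neg_add_one ENNReal.summable.hasSum).tsum_eq,
    two_mul (ENNReal.ofReal _), ← hnat]
  refine add_le_add le_rfl ?_
  have h := ENNReal.tsum_comp_le_tsum_of_injective (Nat.succ_injective)
    (fun n : ℕ => ENNReal.ofReal (|((n : ℤ) : ℝ)| ^ (1 - 2 * s)))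
  refine le_trans (ENNReal.tsum_le_tsum fun n => le_of_eq ?_) h
  congr 2
  push_cast
  rw [← abs_neg]
  congr 1
  ring

/-- Truncation matters only for the rows (0, ±1), whose term v^s would be unbounded in τ; cut off,
it is at most T². For c ≠ 0 both the truncation and the coprimality condition are dropped. -/
lemma tsum_level_one_le {T s : ℝ} (hs : 1 < s) (hs2 : s ≤ 2) (hT : 1 ≤ T) {τ : ℍ}
    (hτ : 1 / 2 ≤ τ.im) :
    ∑' γ : Gamma0 1, stripFun (cutPow T s) ((γ : SL(2, ℤ)) • τ) ≤
      ENNReal.ofReal (2 * T ^ 2) + ENNReal.ofReal (18 * Real.pi) *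
        (2 * ENNReal.ofReal (∑' n : ℕ, 1 / (n : ℝ) ^ (2 * s - 1))) := by
  have hn : ∀ c d : ℤ, Complex.normSq ((c : ℂ) * τ + (d : ℂ)) =
      ((c : ℝ) * τ.re + d) ^ 2 + (c * τ.im) ^ 2 := by
    intro c d
    simp [Complex.normSq_apply]
    ring
  set a : ℤ × ℤ → ℝ≥0∞ := fun p => if p = (0, 1) ∨ p = (0, -1) then ENNReal.ofReal (T ^ 2) else 0
    with ha
  set b : ℤ × ℤ → ℝ≥0∞ := fun p => if p.1 = 0 then 0 else
    ENNReal.ofReal ((τ.im / ((p.1 * τ.re + p.2) ^ 2 + (p.1 * τ.im) ^ 2)) ^ s) with hb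
  rw [tsum_stripFun_eq_row]
  have hle : ∀ p : BottomRow 1, cutPow T s (τ.im / Complex.normSq (p.1.1 * τ + p.1.2)) ≤
      a p.1 + b p.1 := by
    intro p
    rw [hn]
    by_cases hc : p.1.1 = 0
    · refine le_trans ?_ le_self_add
      have hcop := p.2.1
      rw [hc, isCoprime_zero_left, Int.isUnit_iff] at hcop
      have hp : p.1 = (0, 1) ∨ p.1 = (0, -1) := by
        rcases hcop with h | h
        · exact Or.inl (Prod.ext hc h)
        · exact Or.inr (Prod.ext hc h)
      simp only [ha, if_pos hp]
      have hd : (p.1.2 : ℝ) ^ 2 = 1 := by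
        rcases hcop with h | h <;> rw [h] <;> norm_num
      rw [hc]
      simp only [Int.cast_zero, zero_mul, zero_add, hd, ne_eq, OfNat.ofNat_ne_zero,
        not_false_eq_true, zero_pow, add_zero, div_one]
      rw [cutPow]
      split_ifs with h
      · refine ENNReal.ofReal_le_ofReal ?_
        calc τ.im ^ s ≤ T ^ s := Real.rpow_le_rpow τ.im_pos.le h (by linarith)
          _ ≤ T ^ (2 : ℝ) := Real.rpow_le_rpow_of_exponent_le hT hs2
          _ = T ^ 2 := by norm_num
      · exact zero_le
    · refine le_trans ?_ le_add_self
      simp only [hb, if_neg hc]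
      rw [cutPow]
      split_ifs
      · exact le_rfl
      · exact zero_le
  refine (ENNReal.tsum_le_tsum hle).trans ?_
  refine (ENNReal.tsum_comp_le_tsum_of_injective Subtype.val_injective (fun p => a p + b p)).trans ?_
  rw [ENNReal.tsum_add]
  refine add_le_add ?_ ?_
  · rw [tsum_eq_sum (s := {(0, 1), (0, -1)})]
    · rw [Finset.sum_pair (by simp)]
      have e1 : a (0, 1) = ENNReal.ofReal (T ^ 2) := if_pos (Or.inl rfl)
      have e2 : a (0, -1) = ENNReal.ofReal (T ^ 2) := if_pos (Or.inr rfl)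
      rw [e1, e2, ← ENNReal.ofReal_add (by positivity) (by positivity), two_mul]
    · intro p hp
      simp only [Finset.mem_insert, Finset.mem_singleton] at hp
      simp only [ha, if_neg hp]
  · rw [ENNReal.tsum_prod']
    refine le_trans ?_ (mul_le_mul_right (tsum_abs_rpow_le hs) _)
    rw [← ENNReal.tsum_mul_left]
    refine ENNReal.tsum_le_tsum fun c => ?_
    by_cases hc : c = 0
    · simp [hb, hc]
    · simp only [hb, if_neg hc]
      refine (tsum_row_le τ.re hτ hs hs2 hc).trans_eq ?_
      rw [ENNReal.ofReal_mul (by positivity)]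

/-- A bound for the truncated Eisenstein series, uniform near `s = 1`. -/
lemma exists_bound_eisTrunc (N : ℕ) {T : ℝ} (hT : 1 ≤ T) :
    ∃ C : ℝ, ∀ᶠ s in 𝓝[>] (1 : ℝ), ∀ τ : ℍ,
      eisTrunc N T s τ ≠ ⊤ ∧ (s - 1) * (eisTrunc N T s τ).toReal ≤ C := by
  have hlim : Tendsto (fun s : ℝ => 2 * s - 1) (𝓝[>] 1) (𝓝[>] 1) := by
    refine tendsto_nhdsWithin_iff.mpr ⟨?_, ?_⟩
    · have : Tendsto (fun s : ℝ => 2 * s - 1) (𝓝 1) (𝓝 (2 * 1 - 1)) := by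
        apply Continuous.tendsto; fun_prop
      norm_num at this
      exact this.mono_left nhdsWithin_le_nhds
    · filter_upwards [self_mem_nhdsWithin] with s hs
      rw [Set.mem_Ioi] at *
      linarith
  -- 2(s-1) ∑ n^(-(2s-1)) tends to 1, so it is eventually at most 2; this makes (s-1)Z at most 1
  -- below.
  have hz := (tendsto_sub_mul_tsum_nat_rpow.comp hlim).eventually_le_const
    (show (1 : ℝ) < 2 by norm_num)
  have h2 : ∀ᶠ s in 𝓝[>] (1 : ℝ), s ≤ 2 :=
    nhdsWithin_le_nhds (eventually_le_nhds (by norm_num))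
  refine ⟨T ^ 2 + 18 * Real.pi, ?_⟩
  filter_upwards [hz, h2, self_mem_nhdsWithin] with s hzs hs2 hs τ
  rw [Set.mem_Ioi] at hs
  set Z := ∑' n : ℕ, 1 / (n : ℝ) ^ (2 * s - 1) with hZ
  have hZ0 : 0 ≤ Z := tsum_nonneg fun n => by positivity
  have hZs : (s - 1) * Z ≤ 1 := by
    have : (2 * s - 1 - 1) * Z ≤ 2 := hzs
    nlinarith
  -- The level-one sum dominates the sum of level N and is invariant under the full modular group,
  -- so τ may be moved into the box, where the heights are at least 1/2.
  obtain ⟨g, hg⟩ := IsMeromorphicModularForm.exists_smul_mem_box τ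
  have hmem : ∀ g : SL(2, ℤ), g ∈ Gamma0 1 := fun g => mem_Gamma0_iff_dvd.mpr (by simp)
  have h1 : 2 * eisTrunc N T s τ ≤ ENNReal.ofReal (2 * T ^ 2 + 36 * Real.pi * Z) := by
    rw [← tsum_cutPow]
    calc ∑' γ : Gamma0 N, stripFun (cutPow T s) ((γ : SL(2, ℤ)) • τ)
        ≤ ∑' γ : Gamma0 1, stripFun (cutPow T s) ((γ : SL(2, ℤ)) • τ) := by
          exact ENNReal.tsum_comp_le_tsum_of_injective
            (f := fun γ : Gamma0 N => (⟨γ.1, hmem γ.1⟩ : Gamma0 1))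
            (fun a b h => Subtype.ext (congrArg (fun x : Gamma0 1 => (x : SL(2, ℤ))) h))
            (fun γ : Gamma0 1 => stripFun (cutPow T s) ((γ : SL(2, ℤ)) • τ))
      _ = ∑' γ : Gamma0 1, stripFun (cutPow T s) ((γ : SL(2, ℤ)) • (g • τ)) := by
          rw [← (Equiv.mulRight (⟨g, hmem g⟩ : Gamma0 1)).tsum_eq]
          refine tsum_congr fun γ => ?_
          rw [smul_smul]
          rfl
      _ ≤ _ := tsum_level_one_le hs hs2 hT hg.2
      _ = ENNReal.ofReal (2 * T ^ 2 + 36 * Real.pi * Z) := by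
          rw [ENNReal.ofReal_add (by positivity) (by positivity),
            show (2 : ℝ≥0∞) = ENNReal.ofReal 2 by simp, ← ENNReal.ofReal_mul (by norm_num),
            ← ENNReal.ofReal_mul (by positivity)]
          congr 2
          ring
  have hne : eisTrunc N T s τ ≠ ⊤ := by
    intro h
    rw [h] at h1
    simp at h1
  refine ⟨hne, ?_⟩
  have h3 := ENNReal.toReal_mono ENNReal.ofReal_ne_top h1
  rw [ENNReal.toReal_mul, ENNReal.toReal_ofReal (by positivity)] at h3
  simp only [ENNReal.toReal_ofNat] at h3
  have h4 : (eisTrunc N T s τ).toReal ≤ T ^ 2 + 18 * Real.pi * Z := by linarith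
  calc (s - 1) * (eisTrunc N T s τ).toReal ≤ (s - 1) * (T ^ 2 + 18 * Real.pi * Z) :=
        mul_le_mul_of_nonneg_left h4 (by linarith)
    _ = (s - 1) * T ^ 2 + 18 * Real.pi * ((s - 1) * Z) := by ring
    _ ≤ T ^ 2 + 18 * Real.pi := by
        have h5 : (s - 1) * T ^ 2 ≤ T ^ 2 := by nlinarith [sq_nonneg T]
        nlinarith [Real.pi_pos]

open scoped ENNReal

/-! ### Elementary integrals -/

lemma integrableOn_rpow_Ioc {a : ℝ} (ha : 0 < a) (T : ℝ) :
    IntegrableOn (fun v : ℝ => v ^ (a - 1)) (Set.Ioc 0 T) :=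
  (intervalIntegral.intervalIntegrable_rpow' (a := 0) (b := T) (by linarith)).1

lemma integral_rpow_Ioc {a T : ℝ} (ha : 0 < a) (hT : 0 ≤ T) :
    ∫ v in Set.Ioc 0 T, v ^ (a - 1) = T ^ a / a := by
  rw [← intervalIntegral.integral_of_le hT, integral_rpow (Or.inl (by linarith)), sub_add_cancel,
    Real.zero_rpow ha.ne', sub_zero]

lemma integral_rpow_mul_log {a T : ℝ} (ha : 0 < a) (hT : 0 < T) :
    IntegrableOn (fun v : ℝ => v ^ (a - 1) * (Real.log T - Real.log v)) (Set.Ioc 0 T) ∧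
      ∫ v in Set.Ioc 0 T, v ^ (a - 1) * (Real.log T - Real.log v) = T ^ a / a ^ 2 := by
  -- A primitive vanishing at 0 and equal to T^a/a² at T. The integrand is non-negative, so
  -- integrability at 0 follows from the continuity of g.
  set g : ℝ → ℝ := fun v => v ^ a * (Real.log T - Real.log v) / a + v ^ a / a ^ 2 with hg
  have hderiv : ∀ v ∈ Set.Ioo 0 T,
      HasDerivAt g (v ^ (a - 1) * (Real.log T - Real.log v)) v := by
    intro v hv
    have hv0 : v ≠ 0 := hv.1.ne'
    have h1 := Real.hasDerivAt_rpow_const (p := a) (Or.inl hv0)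
    have h2 := (Real.hasDerivAt_log hv0).const_sub (Real.log T)
    refine (((h1.mul h2).div_const a).add (h1.div_const (a ^ 2))).congr_deriv ?_
    have h3 : v ^ a = v ^ (a - 1) * v := by
      rw [Real.rpow_sub_one hv0]
      field_simp
    rw [h3]
    field_simp
    ring
  have hcont : ContinuousOn g (Set.Icc 0 T) := by
    have h1 : Continuous fun v : ℝ => v ^ a :=
      Real.continuous_rpow_const ha.le
    have h2 : Continuous fun v : ℝ => v ^ a * Real.log v := by
      refine continuous_iff_continuousAt.mpr fun v => ?_
      by_cases hv : v = 0
      · subst hv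
        -- The two-sided limit reduces to the one from the right: `Real.log` depends only on |v|,
        -- and the real power satisfies |v^a| ≤ |v|^a also for negative v.
        have h3 : Tendsto (fun v : ℝ => v ^ a * Real.log |v|) (𝓝[≠] 0) (𝓝 0) := by
          have h4 : Tendsto (fun v : ℝ => |v| ^ a * Real.log |v|) (𝓝[≠] 0) (𝓝 0) := by
            have h5 := tendsto_log_mul_rpow_nhdsGT_zero ha
            have h6 : Tendsto (fun v : ℝ => |v|) (𝓝[≠] 0) (𝓝[>] 0) := tendsto_abs_nhdsNE_zero
            exact (h5.comp h6).congr fun v => mul_comm _ _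
          refine squeeze_zero_norm (fun v => ?_) (h4.norm.trans (by simp))
          rw [norm_mul, norm_mul]
          refine mul_le_mul_of_nonneg_right ?_ (norm_nonneg _)
          rw [Real.norm_eq_abs, Real.norm_of_nonneg (by positivity)]
          exact Real.abs_rpow_le_abs_rpow v a
        rw [continuousAt_iff_punctured_nhds]
        simpa [Real.log_abs] using h3
      · exact (Real.continuousAt_rpow_const v a (Or.inl hv)).mul (Real.continuousAt_log hv)
    have h3 : g = fun v => (v ^ a * Real.log T - v ^ a * Real.log v) / a + v ^ a / a ^ 2 := by
      funext v
      simp only [hg]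
      ring
    rw [h3]
    exact ((((h1.mul_const _).sub h2).div_const _).add (h1.div_const _)).continuousOn
  have hnn : ∀ v ∈ Set.Ioo 0 T, 0 ≤ v ^ (a - 1) * (Real.log T - Real.log v) := fun v hv =>
    mul_nonneg (Real.rpow_nonneg hv.1.le _)
      (sub_nonneg.mpr (Real.log_le_log hv.1 hv.2.le))
  have hinteg := intervalIntegral.integrableOn_deriv_of_nonneg hcont hderiv hnn
  refine ⟨hinteg, ?_⟩
  rw [← intervalIntegral.integral_of_le hT.le,
    intervalIntegral.integral_eq_sub_of_hasDerivAt_of_le hT.le hcont hderiv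
      ((intervalIntegrable_iff_integrableOn_Ioc_of_le hT.le).mpr hinteg)]
  simp [hg, Real.zero_rpow ha.ne']

/-- The second factor vanishes above y, so T drops out; the rest is y^s (1/(s-1) - 1/s). This
converts Jensen weights into terms of the Eisenstein series. -/
lemma lintegral_rpow_mul_sub {s T y : ℝ} (hs : 1 < s) (hy : 0 < y) (hyT : y ≤ T) :
    ∫⁻ v in Set.Ioc 0 T, ENNReal.ofReal (v ^ (s - 2)) * ENNReal.ofReal (y - v) =
      ENNReal.ofReal (1 / (s * (s - 1))) * ENNReal.ofReal (y ^ s) := by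
  have h1 : ∫⁻ v in Set.Ioc 0 T, ENNReal.ofReal (v ^ (s - 2)) * ENNReal.ofReal (y - v) =
      ∫⁻ v in Set.Ioc 0 y, ENNReal.ofReal (v ^ (s - 2) * (y - v)) := by
    rw [← lintegral_indicator measurableSet_Ioc, ← lintegral_indicator measurableSet_Ioc]
    refine lintegral_congr fun v => ?_
    by_cases hv : v ∈ Set.Ioc 0 y
    · rw [Set.indicator_of_mem hv, Set.indicator_of_mem (show v ∈ Set.Ioc 0 T from
        ⟨hv.1, hv.2.trans hyT⟩), ENNReal.ofReal_mul (Real.rpow_nonneg hv.1.le _)]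
    · rw [Set.indicator_of_notMem hv]
      by_cases hv2 : v ∈ Set.Ioc 0 T
      · rw [Set.indicator_of_mem hv2, ENNReal.ofReal_of_nonpos (p := y - v), mul_zero]
        by_contra hcon
        exact hv ⟨hv2.1, by linarith⟩
      · rw [Set.indicator_of_notMem hv2]
  have e : ∀ v ∈ Set.Ioc 0 y, v ^ (s - 2) * (y - v) = y * v ^ (s - 1 - 1) - v ^ (s - 1) := by
    intro v hv
    have h3 : v ^ (s - 1) = v ^ (s - 2) * v := by
      rw [show s - 1 = s - 2 + 1 by ring, Real.rpow_add_one hv.1.ne']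
    rw [h3, show s - 1 - 1 = s - 2 by ring]
    ring
  have hi1 := (integrableOn_rpow_Ioc (a := s - 1) (by linarith) y).const_mul y
  have hi2 : IntegrableOn (fun v : ℝ => v ^ (s - 1)) (Set.Ioc 0 y) :=
    integrableOn_rpow_Ioc (by linarith) y
  have hi : IntegrableOn (fun v : ℝ => v ^ (s - 2) * (y - v)) (Set.Ioc 0 y) :=
    IntegrableOn.congr_fun (f := fun v : ℝ => y * v ^ (s - 1 - 1) - v ^ (s - 1)) (hi1.sub hi2)
      (fun v hv => (e v hv).symm) measurableSet_Ioc
  rw [h1, ← ofReal_integral_eq_lintegral_ofReal hi]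
  · rw [setIntegral_congr_fun measurableSet_Ioc e, integral_sub hi1 hi2, integral_const_mul,
      integral_rpow_Ioc (by linarith) hy.le, integral_rpow_Ioc (by linarith) hy.le,
      ← ENNReal.ofReal_mul (by apply div_nonneg zero_le_one; nlinarith)]
    congr 1
    have h3 : y * y ^ (s - 1) = y ^ s := by
      rw [Real.rpow_sub_one hy.ne']
      field_simp
    have h4 : s ≠ 0 := by linarith
    have h5 : s - 1 ≠ 0 := by linarith
    rw [← mul_div_assoc, h3]
    field_simp
    ring
  · refine (ae_restrict_iff' measurableSet_Ioc).mpr (ae_of_all _ fun v hv => ?_)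
    exact mul_nonneg (Real.rpow_nonneg hv.1.le _) (sub_nonneg.mpr hv.2)

/-! ### Unfolding against truncated Eisenstein series -/

instance countable_coset (N : ℕ) : Countable (Coset N) :=
  inferInstanceAs (Countable (Quotient _))

lemma measurable_eisTrunc (N : ℕ) (T s : ℝ) : Measurable (eisTrunc N T s) := by
  refine Measurable.tsum fun c => (measurable_cutPow T s).comp ?_
  exact UpperHalfPlane.continuous_im.measurable.comp
    (measurePreserving_smul_SL (c.out : SL(2, ℤ))).measurable

lemma integral_mul_stripFun {φ : ℍ → ℝ} {T s : ℝ}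
    (hφ : Integrable fun τ => φ τ * (stripFun (cutPow T s) τ).toReal) :
    ∫ τ, φ τ * (stripFun (cutPow T s) τ).toReal =
      ∫ v in Set.Ioc 0 T, v ^ (s - 2) * ∫ u in (0 : ℝ)..1, φ (ofComplex (u + v * Complex.I)) := by
  rw [integral_eq_integral_integral hφ]
  have e : ∀ v ∈ Set.Ioi (0 : ℝ), 1 / v ^ 2 * ∫ u : ℝ, φ (ofComplex (u + v * Complex.I)) *
      (stripFun (cutPow T s) (ofComplex (u + v * Complex.I))).toReal =
      (Set.Iic T).indicator (fun v => v ^ (s - 2) *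
        ∫ u in (0 : ℝ)..1, φ (ofComplex (u + v * Complex.I))) v := by
    intro v hv
    rw [Set.mem_Ioi] at hv
    have h1 : ∀ u : ℝ, φ (ofComplex (u + v * Complex.I)) *
        (stripFun (cutPow T s) (ofComplex (u + v * Complex.I))).toReal =
        (Set.Ico (0 : ℝ) 1).indicator (fun u => (cutPow T s v).toReal *
          φ (ofComplex (u + v * Complex.I))) u := by
      intro u
      have h := imRe_ofComplex (p := (v, u)) hv
      have h1 : (ofComplex (u + v * Complex.I)).im = v := congrArg Prod.fst h
      have h2 : (ofComplex (u + v * Complex.I)).re = u := congrArg Prod.snd h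
      rw [stripFun, h1, h2]
      by_cases hu : 0 ≤ u ∧ u < 1
      · rw [if_pos hu, Set.indicator_of_mem (show u ∈ Set.Ico (0 : ℝ) 1 from hu), mul_comm]
      · rw [if_neg hu, Set.indicator_of_notMem (show u ∉ Set.Ico (0 : ℝ) 1 from hu)]
        simp
    simp_rw [h1]
    rw [integral_indicator measurableSet_Ico, integral_const_mul, integral_Ico_eq_integral_Ioc,
      ← intervalIntegral.integral_of_le zero_le_one, ← mul_assoc]
    by_cases hvT : v ≤ T
    · rw [Set.indicator_of_mem (show v ∈ Set.Iic T from hvT), cutPow, if_pos hvT,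
        ENNReal.toReal_ofReal (Real.rpow_nonneg hv.le _)]
      congr 1
      rw [Real.rpow_sub hv, Real.rpow_ofNat]
      ring
    · rw [Set.indicator_of_notMem (show v ∉ Set.Iic T from hvT), cutPow, if_neg hvT]
      simp
  rw [setIntegral_congr_fun measurableSet_Ioi e, setIntegral_indicator measurableSet_Iic]
  rfl

namespace IsClosedFundamentalDomain

variable {N : ℕ} {F : Set ℍ}

/-- Unfolding against a truncated Eisenstein series. -/
lemma integral_mul_eisTrunc (hF : IsClosedFundamentalDomain N F) {φ : ℍ → ℝ} (hφ : Measurable φ)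
    (hinv : ∀ γ ∈ Gamma0 N, ∀ τ, φ (γ • τ) = φ τ) (hinteg : IntegrableOn φ F) {T s C : ℝ}
    (hs : 1 < s) (hC : ∀ τ, eisTrunc N T s τ ≠ ⊤ ∧ (s - 1) * (eisTrunc N T s τ).toReal ≤ C) :
    ∫ τ in F, φ τ * (eisTrunc N T s τ).toReal =
      ∫ v in Set.Ioc 0 T, v ^ (s - 2) * ∫ u in (0 : ℝ)..1, φ (ofComplex (u + v * Complex.I)) := by
  have e : ∀ τ, φ τ * (∑' γ : Gamma0 N, stripFun (cutPow T s) ((γ : SL(2, ℤ)) • τ)).toReal =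
      2 * (φ τ * (eisTrunc N T s τ).toReal) := by
    intro τ
    rw [tsum_cutPow, ENNReal.toReal_mul, ENNReal.toReal_ofNat]
    ring
  have hi : IntegrableOn (fun τ => φ τ * (eisTrunc N T s τ).toReal) F := by
    refine Integrable.mul_bdd (c := C / (s - 1)) hinteg
      (measurable_eisTrunc N T s).ennreal_toReal.aestronglyMeasurable (ae_of_all _ fun τ => ?_)
    rw [Real.norm_of_nonneg ENNReal.toReal_nonneg, le_div_iff₀ (by linarith), mul_comm]
    exact (hC τ).2
  have h := hF.integral_mul_tsum hφ (measurable_stripFun (measurable_cutPow T s)) hinv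
    (fun τ => by
      rw [tsum_cutPow]
      exact ENNReal.mul_ne_top ENNReal.ofNat_ne_top (hC τ).1)
    (by simp_rw [e]; exact hi.const_mul 2)
  simp_rw [e] at h
  rw [integral_const_mul, integral_mul_stripFun h.1] at h
  linarith [h.2]

end IsClosedFundamentalDomain

/-! ### The limit at `s = 1` -/

lemma tsum_ofReal_im_eq_eisTrunc {N : ℕ} {T : ℝ} {τ : ℍ} (hT : max τ.im (1 / τ.im) ≤ T) (s : ℝ) :
    ∑' c : Coset N, ENNReal.ofReal (((c.out : SL(2, ℤ)) • τ).im ^ s) = eisTrunc N T s τ :=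
  tsum_congr fun _ => (if_pos ((im_smul_le_max _ τ).trans hT)).symm

/-- With T above all heights in the orbit of τ, the full series coincides with its truncation, whose
finiteness provides the summability. -/
lemma eventually_ofReal_eisReal (N : ℕ) (τ : ℍ) : ∀ᶠ s in 𝓝[>] (1 : ℝ),
    ∑' c : Coset N, ENNReal.ofReal (((c.out : SL(2, ℤ)) • τ).im ^ s) =
      ENNReal.ofReal (eisReal N τ s) := by
  obtain ⟨C, hC⟩ := exists_bound_eisTrunc N (T := max 1 (max τ.im (1 / τ.im))) (le_max_left _ _)
  filter_upwards [hC] with s hs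
  have h := (hs τ).1
  rw [← tsum_ofReal_im_eq_eisTrunc (le_max_right _ _) s] at h
  rw [eisReal, ENNReal.ofReal_tsum_of_nonneg fun _ => Real.rpow_nonneg (im_pos _).le _]
  refine (ENNReal.summable_toReal h).congr fun c => ?_
  rw [ENNReal.toReal_ofReal (Real.rpow_nonneg (im_pos _).le _)]

lemma eisReal_nonneg (N : ℕ) (τ : ℍ) (s : ℝ) : 0 ≤ eisReal N τ s :=
  tsum_nonneg fun _ => Real.rpow_nonneg (im_pos _).le _

/-- A discarded term exceeds height T ≥ 1, so it is at least 1; a convergent series has finitely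
many such terms. Their sum is continuous in s and is killed by the factor s - 1. -/
lemma tendsto_eisTrunc {N : ℕ} (hN : 1 ≤ N) {T : ℝ} (hT : 1 ≤ T) (τ : ℍ) :
    Tendsto (fun s : ℝ => (s - 1) * (eisTrunc N T s τ).toReal) (𝓝[>] 1) (𝓝 (eisRes N).re) := by
  have hev := eventually_ofReal_eisReal N τ
  have hfin : {c : Coset N | T < ((c.out : SL(2, ℤ)) • τ).im}.Finite := by
    obtain ⟨s, hs, hs1⟩ := (hev.and self_mem_nhdsWithin).exists
    have hs0 : (0 : ℝ) ≤ s := zero_le_one.trans (le_of_lt hs1)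
    refine (ENNReal.finite_const_le_of_tsum_ne_top (hs ▸ ENNReal.ofReal_ne_top)
      one_ne_zero).subset fun c hc => ?_
    rw [Set.mem_ofPred_eq] at hc
    exact ENNReal.one_le_ofReal.mpr (Real.one_le_rpow (hT.trans hc.le) hs0)
  have hsplit : ∀ᶠ s in 𝓝[>] (1 : ℝ), (s - 1) * eisReal N τ s -
      (s - 1) * ∑ c ∈ hfin.toFinset, ((c.out : SL(2, ℤ)) • τ).im ^ s =
      (s - 1) * (eisTrunc N T s τ).toReal := by
    filter_upwards [hev] with s hs
    have h1 : ENNReal.ofReal (eisReal N τ s) = eisTrunc N T s τ +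
        ENNReal.ofReal (∑ c ∈ hfin.toFinset, ((c.out : SL(2, ℤ)) • τ).im ^ s) := by
      rw [ENNReal.ofReal_sum_of_nonneg fun c _ => Real.rpow_nonneg (im_pos _).le _, ← hs, eisTrunc,
        ← Finset.tsum_subtype' , tsum_subtype _
          (fun c : Coset N => ENNReal.ofReal (((c.out : SL(2, ℤ)) • τ).im ^ s)),
        ← ENNReal.tsum_add]
      refine tsum_congr fun c => ?_
      by_cases hc : T < ((c.out : SL(2, ℤ)) • τ).im
      · rw [Set.indicator_of_mem (by simpa using hc), cutPow, if_neg (not_le.mpr hc), zero_add]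
      · rw [Set.indicator_of_notMem (by simpa using hc), cutPow, if_pos (not_lt.mp hc), add_zero]
    have hne : eisTrunc N T s τ ≠ ⊤ := fun h => by
      rw [h, top_add] at h1
      exact ENNReal.ofReal_ne_top h1
    have h2 := congrArg ENNReal.toReal h1
    rw [ENNReal.toReal_add hne ENNReal.ofReal_ne_top, ENNReal.toReal_ofReal (eisReal_nonneg _ _ _),
      ENNReal.toReal_ofReal (Finset.sum_nonneg fun c _ => Real.rpow_nonneg (im_pos _).le _)] at h2
    rw [h2]
    ring
  have hzero : Tendsto (fun s : ℝ => (s - 1) *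
      ∑ c ∈ hfin.toFinset, ((c.out : SL(2, ℤ)) • τ).im ^ s) (𝓝[>] 1) (𝓝 0) := by
    have hc : Continuous fun s : ℝ => (s - 1) *
        ∑ c ∈ hfin.toFinset, ((c.out : SL(2, ℤ)) • τ).im ^ s := by
      refine (continuous_id.sub continuous_const).mul (continuous_finsetSum _ fun c _ => ?_)
      exact Real.continuous_const_rpow (im_pos _).ne'
    have := hc.tendsto 1
    rw [sub_self, zero_mul] at this
    exact this.mono_left nhdsWithin_le_nhds
  have h := (tendsto_eisReal hN τ).sub hzero
  rw [sub_zero] at h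
  exact h.congr' hsplit

lemma tendsto_integral_eisTrunc {N : ℕ} (hN : 1 ≤ N) {F : Set ℍ} {φ : ℍ → ℝ}
    (hinteg : IntegrableOn φ F) {T : ℝ} (hT : 1 ≤ T) :
    Tendsto (fun s : ℝ => (s - 1) * ∫ τ in F, φ τ * (eisTrunc N T s τ).toReal) (𝓝[>] 1)
      (𝓝 ((eisRes N).re * ∫ τ in F, φ τ)) := by
  obtain ⟨C, hC⟩ := exists_bound_eisTrunc N hT
  rw [← integral_const_mul]
  simp_rw [← integral_const_mul]
  refine tendsto_integral_filter_of_dominated_convergence (fun τ => C * ‖φ τ‖) ?_ ?_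
    (hinteg.norm.const_mul C) (ae_of_all _ fun τ => ?_)
  · exact Eventually.of_forall fun s => (hinteg.aestronglyMeasurable.mul
      (measurable_eisTrunc N T s).ennreal_toReal.aestronglyMeasurable).const_mul _
  · filter_upwards [hC, self_mem_nhdsWithin] with s hs h1
    refine ae_of_all _ fun τ => ?_
    rw [Set.mem_Ioi] at h1
    rw [mul_left_comm, norm_mul, mul_comm C, Real.norm_of_nonneg
      (mul_nonneg (by linarith) ENNReal.toReal_nonneg)]
    exact mul_le_mul_of_nonneg_left (hs τ).2 (norm_nonneg _)
  · refine ((tendsto_eisTrunc hN hT τ).mul_const (φ τ)).congr fun s => ?_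
    ring

/-- The residue of the Eisenstein series is the inverse of the volume. -/
lemma IsClosedFundamentalDomain.eisRes_mul_volume {N : ℕ} {F : Set ℍ}
    (hF : IsClosedFundamentalDomain N F) (hN : 1 ≤ N) :
    (eisRes N).re * (volume F).toReal = 1 := by
  have hinteg : IntegrableOn (fun _ : ℍ => (1 : ℝ)) F :=
    integrableOn_const (hF.volume_lt_top hN).ne
  -- For the constant function 1 and T = 1, the unfolded integral is ∫₀¹ v^(s-2) dv = 1/(s-1), so
  -- the quantity tending to residue times volume is constantly 1.
  have h := tendsto_integral_eisTrunc hN hinteg le_rfl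
  obtain ⟨C, hC⟩ := exists_bound_eisTrunc N (T := 1) le_rfl
  have h1 : (∫ _ in F, (1 : ℝ)) = (volume F).toReal := by
    rw [setIntegral_const, smul_eq_mul, mul_one]
    rfl
  rw [h1] at h
  refine tendsto_nhds_unique h (tendsto_const_nhds.congr' ?_)
  filter_upwards [hC, self_mem_nhdsWithin] with s hs h1
  rw [Set.mem_Ioi] at h1
  rw [hF.integral_mul_eisTrunc measurable_const (fun _ _ _ => rfl) hinteg h1 hs]
  simp only [intervalIntegral.integral_const, sub_zero, smul_eq_mul, mul_one]
  rw [show s - 2 = s - 1 - 1 by ring, integral_rpow_Ioc (by linarith) zero_le_one, Real.one_rpow]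
  field_simp [sub_ne_zero.mpr h1.ne']

open scoped ENNReal

/-! ### The unfolded integral -/

instance countable_orbit (N : ℕ) (z : ℍ) : Countable (MulAction.orbit (Gamma0 N) z) :=
  (Set.countable_range _).to_subtype

/-- By Tonelli each orbit point w of the strip contributes (Im w)^s / (s(s-1)), and
`ellipticOrder_mul_tsum_orbit` reassembles these into the Eisenstein series divided by ω_z. -/
lemma lintegral_heightSum {N : ℕ} {F : Set ℍ} (hF : IsClosedFundamentalDomain N F) {z : ℍ}
    {s T : ℝ} (hs : 1 < s) (hT : ∀ w ∈ MulAction.orbit (Gamma0 N) z, w.im ≤ T)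
    (hsum : ∑' c : Coset N, ENNReal.ofReal (((c.out : SL(2, ℤ)) • z).im ^ s) =
      ENNReal.ofReal (eisReal N z s)) :
    ∫⁻ v in Set.Ioc 0 T, ENNReal.ofReal (v ^ (s - 2)) * heightSum N z v =
      ENNReal.ofReal (1 / (s * (s - 1)) * (eisReal N z s / ellipticOrder N z)) := by
  have hm : ∀ w : ℍ, Measurable fun v : ℝ => stripFun (fun y => ENNReal.ofReal (y - v)) w := by
    intro w
    unfold stripFun
    split_ifs
    · fun_prop
    · exact measurable_const
  have hω := ellipticOrder_ne_zero hF z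
  have horb := ellipticOrder_mul_tsum_orbit hF (fun y => ENNReal.ofReal (y ^ s)) z
  rw [hsum] at horb
  have hnn : 0 ≤ 1 / (s * (s - 1)) := by
    apply div_nonneg zero_le_one
    nlinarith
  simp_rw [heightSum, ← ENNReal.tsum_mul_left]
  have hm' : ∀ w : MulAction.orbit (Gamma0 N) z, AEMeasurable (fun v => ENNReal.ofReal
      (v ^ (s - 2)) * stripFun (fun y => ENNReal.ofReal (y - v)) (w : ℍ))
      (volume.restrict (Set.Ioc 0 T)) := fun w =>
    (Measurable.mul (by fun_prop) (hm (w : ℍ))).aemeasurable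
  rw [lintegral_tsum hm']
  have e : ∀ w : MulAction.orbit (Gamma0 N) z, ∫⁻ v in Set.Ioc 0 T, ENNReal.ofReal (v ^ (s - 2)) *
      stripFun (fun y => ENNReal.ofReal (y - v)) w =
      ENNReal.ofReal (1 / (s * (s - 1))) * stripFun (fun y => ENNReal.ofReal (y ^ s)) w := by
    intro w
    unfold stripFun
    split_ifs
    · exact lintegral_rpow_mul_sub hs (w : ℍ).im_pos (hT w w.2)
    · simp
  simp_rw [e]
  rw [ENNReal.tsum_mul_left, ENNReal.ofReal_mul hnn, ENNReal.ofReal_div_of_pos (x := eisReal N z s)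
    (by exact_mod_cast Nat.pos_of_ne_zero hω), ← horb, ENNReal.ofReal_natCast]
  congr 1
  rw [mul_comm, ENNReal.mul_div_cancel_right (by exact_mod_cast hω) (ENNReal.natCast_ne_top _)]

lemma integral_heightSum {N : ℕ} {F : Set ℍ} (hF : IsClosedFundamentalDomain N F) {z : ℍ}
    {s T : ℝ} (hs : 1 < s) (hT : ∀ w ∈ MulAction.orbit (Gamma0 N) z, w.im ≤ T)
    (hsum : ∑' c : Coset N, ENNReal.ofReal (((c.out : SL(2, ℤ)) • z).im ^ s) =
      ENNReal.ofReal (eisReal N z s)) :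
    IntegrableOn (fun v => v ^ (s - 2) * (heightSum N z v).toReal) (Set.Ioc 0 T) ∧
      ∫ v in Set.Ioc 0 T, v ^ (s - 2) * (heightSum N z v).toReal =
        1 / (s * (s - 1)) * (eisReal N z s / ellipticOrder N z) := by
  have h := lintegral_heightSum hF hs hT hsum
  have hm : Measurable fun v : ℝ => ENNReal.ofReal (v ^ (s - 2)) * heightSum N z v := by
    refine Measurable.mul (by fun_prop) (Measurable.tsum fun w => ?_)
    unfold stripFun
    split_ifs
    · fun_prop
    · exact measurable_const
  have hne : ∫⁻ v in Set.Ioc 0 T, ENNReal.ofReal (v ^ (s - 2)) * heightSum N z v ≠ ⊤ := by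
    rw [h]; exact ENNReal.ofReal_ne_top
  have e : ∀ v ∈ Set.Ioc 0 T, (ENNReal.ofReal (v ^ (s - 2)) * heightSum N z v).toReal =
      v ^ (s - 2) * (heightSum N z v).toReal := fun v hv => by
    rw [ENNReal.toReal_mul, ENNReal.toReal_ofReal (Real.rpow_nonneg hv.1.le _)]
  have hnn : 0 ≤ 1 / (s * (s - 1)) := by
    apply div_nonneg zero_le_one
    nlinarith
  refine ⟨IntegrableOn.congr_fun (integrable_toReal_of_lintegral_ne_top hm.aemeasurable hne) e
    measurableSet_Ioc, ?_⟩
  rw [← setIntegral_congr_fun measurableSet_Ioc e, integral_toReal hm.aemeasurable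
    (ae_lt_top hm hne), h, ENNReal.toReal_ofReal]
  exact mul_nonneg hnn (div_nonneg (eisReal_nonneg _ _ _) (Nat.cast_nonneg _))

namespace IsMeromorphicModularForm

variable {N : ℕ} {k : ℤ} {f : ℍ → ℂ} {F : Set ℍ}

lemma intervalIntegrable_log_norm (hf : IsMeromorphicModularForm N k f) (hN : 1 ≤ N) {v : ℝ}
    (hv : 0 < v) :
    IntervalIntegrable (fun u : ℝ => Real.log ‖f (ofComplex (u + v * Complex.I))‖) volume 0 1 := by
  have h : CircleIntegrable (fun q => Real.log ‖expansionAtCusp N k f 1 q‖) 0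
      (Real.exp (-2 * Real.pi * v)) :=
    MeromorphicOn.circleIntegrable_log_norm
      ((hf.meromorphicOn_expansion hN hv).mono_set Metric.sphere_subset_closedBall)
  have hpi : (2 * Real.pi) ≠ 0 := by positivity
  have h2 := IntervalIntegrable.comp_mul_left (c := 2 * Real.pi) h
  rw [zero_div, div_self hpi] at h2
  refine h2.congr fun u _ => ?_
  simp only
  rw [circleMap_exp_eq_qParam]
  exact congrArg (fun w => Real.log ‖w‖) (congrFun (hf.expansion_comp_qParam hN) _)

lemma integral_logAbs (hf : IsMeromorphicModularForm N k f) (hN : 1 ≤ N)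
    (hcusp : ∀ σ : SL(2, ℤ), cuspOrder N k f σ = 0) {v : ℝ} (hv : 0 < v) :
    ∫ u in (0 : ℝ)..1, logAbs k f (ofComplex (u + v * Complex.I)) = (k : ℝ) / 2 * Real.log v +
      ∫ u in (0 : ℝ)..1, Real.log ‖f (ofComplex (u + v * Complex.I))‖ := by
  have him : ∀ u : ℝ, (ofComplex (u + v * Complex.I)).im = v := fun u =>
    congrArg Prod.fst (imRe_ofComplex (p := (v, u)) hv)
  have hre : ∀ u : ℝ, (ofComplex (u + v * Complex.I)).re = u := fun u =>
    congrArg Prod.snd (imRe_ofComplex (p := (v, u)) hv)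
  -- Where f takes the value 0, `Real.log 0 = 0` makes the left side 0 while the right keeps (k/2)
  -- log v. Such points are countable, hence negligible.
  have hcount : {u : ℝ | f (ofComplex (u + v * Complex.I)) = 0}.Countable := by
    refine Set.Countable.preimage_of_injOn (f := fun u : ℝ => ofComplex (u + v * Complex.I))
      (hf.countable_zeros hN hcusp) fun a _ b _ h => ?_
    rw [← hre a, ← hre b]
    exact congrArg _ h
  have hae : ∀ᵐ u : ℝ, logAbs k f (ofComplex (u + v * Complex.I)) =
      (k : ℝ) / 2 * Real.log v + Real.log ‖f (ofComplex (u + v * Complex.I))‖ := by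
    filter_upwards [measure_eq_zero_iff_ae_notMem.mp (hcount.measure_zero volume)] with u hu
    rw [logAbs_eq hu, him]
  rw [intervalIntegral.integral_congr_ae (hae.mono fun u hu _ => hu),
    intervalIntegral.integral_add intervalIntegrable_const (hf.intervalIntegrable_log_norm hN hv),
    intervalIntegral.integral_const]
  simp

/-- The integral of `log (v^(k/2) |f|)` against a truncated Eisenstein series. -/
lemma integral_logAbs_mul_eisTrunc (hf : IsMeromorphicModularForm N k f) (hN : 1 ≤ N)
    (hcusp : ∀ σ : SL(2, ℤ), cuspOrder N k f σ = 0) (hF : IsClosedFundamentalDomain N F) {c : ℂ}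
    (hlim : Tendsto (expansionAtCusp N k f 1) (𝓝[≠] 0) (𝓝 c)) {T : ℝ} (hT : 1 ≤ T)
    (hzero : ∀ τ : ℍ, T ≤ τ.im → f τ ≠ 0) :
    ∀ᶠ s in 𝓝[>] (1 : ℝ), ∫ τ in F, logAbs k f τ * (eisTrunc N T s τ).toReal =
      ((k : ℝ) / 2 * Real.log T + Real.log ‖c‖) * (T ^ (s - 1) / (s - 1)) -
        (k : ℝ) / 2 * (T ^ (s - 1) / (s - 1) ^ 2) +
        2 * Real.pi * ∑ o ∈ (hf.finite_orbits hN hcusp).toFinset, (ordAt f o.out : ℝ) *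
          (1 / (s * (s - 1)) * (eisReal N o.out s / ellipticOrder N o.out)) := by
  obtain ⟨C, hC⟩ := exists_bound_eisTrunc N hT
  have hev : ∀ᶠ s in 𝓝[>] (1 : ℝ), ∀ o ∈ (hf.finite_orbits hN hcusp).toFinset,
      ∑' c : Coset N, ENNReal.ofReal (((c.out : SL(2, ℤ)) • o.out).im ^ s) =
        ENNReal.ofReal (eisReal N o.out s) :=
    (Finset.eventually_all _).mpr fun o _ => eventually_ofReal_eisReal N o.out
  have hTpos : 0 < T := by linarith
  filter_upwards [hC, hev, self_mem_nhdsWithin] with s hCs hsum hs1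
  have hs : 1 < s := hs1
  -- T lies above all zeros and poles, so each of their orbits stays within the range of integration
  -- and the full Eisenstein series appears.
  have hheight : ∀ o ∈ (hf.finite_orbits hN hcusp).toFinset,
      ∀ w ∈ MulAction.orbit (Gamma0 N) o.out, w.im ≤ T := by
    intro o ho w hw
    rw [Set.Finite.mem_toFinset, Set.mem_ofPred_eq, ← (mem_orbit_out_iff o w).mp hw,
      hf.ordAt_mk_out, ne_eq, hf.ordAt_eq_zero_iff hN hcusp, not_not] at ho
    by_contra hcon
    exact hzero w (not_le.mp hcon).le ho
  rw [hF.integral_mul_eisTrunc hf.measurable_logAbs (fun γ hγ τ => logAbs_smul_of_mem hf hγ τ)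
    (hf.integrableOn_logAbs hN hcusp hF) hs hCs]
  -- log v is written as log T - (log T - log v), so that the logarithmic integrand has a constant
  -- sign on (0, T].
  have e : ∀ v ∈ Set.Ioc 0 T, v ^ (s - 2) *
      ∫ u in (0 : ℝ)..1, logAbs k f (ofComplex (u + v * Complex.I)) =
      ((k : ℝ) / 2 * Real.log T + Real.log ‖c‖) * v ^ (s - 1 - 1) -
        (k : ℝ) / 2 * (v ^ (s - 1 - 1) * (Real.log T - Real.log v)) +
        ∑ o ∈ (hf.finite_orbits hN hcusp).toFinset, 2 * Real.pi * (ordAt f o.out : ℝ) *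
          (v ^ (s - 2) * (heightSum N o.out v).toReal) := by
    intro v hv
    rw [hf.integral_logAbs hN hcusp hv.1, (hf.integral_log_norm hN hcusp hlim hv.1).2,
      show s - 1 - 1 = s - 2 by ring]
    have : ∑ o ∈ (hf.finite_orbits hN hcusp).toFinset, 2 * Real.pi * (ordAt f o.out : ℝ) *
        (v ^ (s - 2) * (heightSum N o.out v).toReal) = v ^ (s - 2) * (2 * Real.pi *
        ∑ o ∈ (hf.finite_orbits hN hcusp).toFinset,
          (ordAt f o.out : ℝ) * (heightSum N o.out v).toReal) := by
      rw [Finset.mul_sum, Finset.mul_sum]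
      exact Finset.sum_congr rfl fun o _ => by ring
    rw [this]
    ring
  have hlog := integral_rpow_mul_log (a := s - 1) (by linarith) hTpos
  have hi1 := (integrableOn_rpow_Ioc (a := s - 1) (by linarith) T).const_mul
    ((k : ℝ) / 2 * Real.log T + Real.log ‖c‖)
  have hi2 := hlog.1.const_mul ((k : ℝ) / 2)
  have hi3 := fun o ho => ((integral_heightSum hF hs (hheight o ho) (hsum o ho)).1.const_mul
    (2 * Real.pi * (ordAt f o.out : ℝ)))
  have hi12 : Integrable (fun v => ((k : ℝ) / 2 * Real.log T + Real.log ‖c‖) * v ^ (s - 1 - 1) -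
      (k : ℝ) / 2 * (v ^ (s - 1 - 1) * (Real.log T - Real.log v)))
      (volume.restrict (Set.Ioc 0 T)) := hi1.sub hi2
  rw [setIntegral_congr_fun measurableSet_Ioc e, integral_add hi12
    (integrable_finsetSum _ hi3), integral_sub hi1 hi2, integral_finsetSum _ hi3,
    integral_const_mul, integral_const_mul, integral_rpow_Ioc (by linarith) hTpos.le, hlog.2,
    Finset.mul_sum]
  congr 1
  refine Finset.sum_congr rfl fun o ho => ?_
  rw [integral_const_mul, (integral_heightSum hF hs (hheight o ho) (hsum o ho)).2]
  ring

end IsMeromorphicModularForm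

/-! ### Passage to the limit -/

lemma tendsto_slope_inv_sub_rpow {T : ℝ} (hT : 0 < T) :
    Tendsto (fun s : ℝ => (1 / s - T ^ (s - 1)) / (s - 1)) (𝓝[>] 1) (𝓝 (-1 - Real.log T)) := by
  have h : HasDerivAt (fun s : ℝ => 1 / s - T ^ (s - 1)) (-1 - Real.log T) 1 := by
    have h1 : HasDerivAt (fun s : ℝ => 1 / s) (-1) 1 := by
      have := hasDerivAt_inv (one_ne_zero (α := ℝ))
      simpa using this
    have h2 : HasDerivAt (fun s : ℝ => T ^ (s - 1)) (Real.log T) 1 := by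
      have := ((hasDerivAt_id (1 : ℝ)).sub_const 1).const_rpow hT
      simpa using this
    exact h1.sub h2
  have h2 := h.tendsto_slope.mono_left (nhdsWithin_mono _ fun s hs => ne_of_gt hs :
    𝓝[>] (1 : ℝ) ≤ 𝓝[≠] 1)
  refine h2.congr fun s => ?_
  rw [slope_def_field]
  simp

/-- Comparison of the asymptotics of both sides of an unfolding identity as `s` tends to `1`; the
vanishing of the polar part comes for free. -/
lemma eq_of_asymptotics {ι : Type*} (O : Finset ι) (m e : ι → ℝ) (E : ι → ℝ → ℝ) (I : ℝ → ℝ)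
    {R κ c T P : ℝ} (hT : 0 < T)
    (hE : ∀ i, Tendsto (fun s => E i s - R / (s - 1)) (𝓝[>] 1) (𝓝 (e i)))
    (hI : Tendsto (fun s => (s - 1) * I s) (𝓝[>] 1) (𝓝 P))
    (heq : ∀ᶠ s in 𝓝[>] (1 : ℝ), I s = (κ * Real.log T + c) * (T ^ (s - 1) / (s - 1)) -
      κ * (T ^ (s - 1) / (s - 1) ^ 2) +
      2 * Real.pi * ∑ i ∈ O, m i * (1 / (s * (s - 1)) * E i s)) :
    P = c - κ + 2 * Real.pi * ∑ i ∈ O, m i * e i := by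
  set M := ∑ i ∈ O, m i with hM
  set X : ℝ → ℝ := fun s => ∑ i ∈ O, m i * (E i s - R / (s - 1)) with hX
  have hXlim : Tendsto X (𝓝[>] 1) (𝓝 (∑ i ∈ O, m i * e i)) :=
    tendsto_finsetSum _ fun i _ => (hE i).const_mul _
  -- B collects the double-pole terms multiplied by s - 1: one from the poles of the E i, one from
  -- the weight.
  set B : ℝ → ℝ := fun s => (2 * Real.pi * R * M / s - κ * T ^ (s - 1)) / (s - 1) with hB
  have hid : Tendsto (fun s : ℝ => s) (𝓝[>] 1) (𝓝 1) := nhdsWithin_le_nhds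
  have hTlim : Tendsto (fun s : ℝ => T ^ (s - 1)) (𝓝[>] 1) (𝓝 1) := by
    have h : Continuous fun s : ℝ => T ^ (s - 1) :=
      (Real.continuous_const_rpow hT.ne').comp (continuous_id.sub continuous_const)
    have := h.tendsto 1
    simp only [sub_self, Real.rpow_zero] at this
    exact this.mono_left nhdsWithin_le_nhds
  have hBeq : ∀ᶠ s in 𝓝[>] (1 : ℝ), (s - 1) * I s - (κ * Real.log T + c) * T ^ (s - 1) -
      2 * Real.pi * (X s / s) = B s := by
    filter_upwards [heq, self_mem_nhdsWithin] with s hs h1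
    have h1' : s - 1 ≠ 0 := sub_ne_zero.mpr (ne_of_gt h1)
    have h0 : s ≠ 0 := (zero_lt_one.trans h1).ne'
    have hsum : ∑ i ∈ O, m i * (1 / (s * (s - 1)) * E i s) =
        1 / (s * (s - 1)) * (X s + M * (R / (s - 1))) := by
      rw [hX, hM, Finset.sum_mul, ← Finset.sum_add_distrib, Finset.mul_sum]
      exact Finset.sum_congr rfl fun i _ => by ring
    rw [hs, hsum]
    simp only [hB]
    field_simp
    ring
  have hBlim := ((hI.sub (hTlim.const_mul (κ * Real.log T + c))).sub
    ((hXlim.div hid one_ne_zero).const_mul (2 * Real.pi))).congr' hBeq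
  -- B has a finite limit because everything else does, so its numerator vanishes at s = 1. With R =
  -- 1/vol, M = ∑ ord/ω and κ = k/2 this is the valence formula.
  have hnum : 2 * Real.pi * R * M = κ := by
    have h1 : Tendsto (fun s : ℝ => (s - 1) * B s) (𝓝[>] 1) (𝓝 0) := by
      have h2 := (hid.sub_const 1).mul hBlim
      rw [sub_self, zero_mul] at h2
      exact h2
    have h3 : Tendsto (fun s : ℝ => 2 * Real.pi * R * M / s - κ * T ^ (s - 1)) (𝓝[>] 1)
        (𝓝 (2 * Real.pi * R * M / 1 - κ * 1)) :=
      (tendsto_const_nhds.div hid one_ne_zero).sub (hTlim.const_mul κ)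
    have h4 : (fun s : ℝ => (s - 1) * B s) =ᶠ[𝓝[>] 1]
        fun s => 2 * Real.pi * R * M / s - κ * T ^ (s - 1) := by
      filter_upwards [self_mem_nhdsWithin] with s h1
      simp only [hB]
      rw [mul_div_cancel₀ _ (sub_ne_zero.mpr (ne_of_gt h1))]
    have := tendsto_nhds_unique (h1.congr' h4) h3
    linarith
  -- Once κ factors out, B is κ times a difference quotient of 1/s - T^(s-1) at 1. Its -κ log T
  -- cancels the κ log T of the main term, so the result does not depend on T.
  have hBlim2 : Tendsto B (𝓝[>] 1) (𝓝 (κ * (-1 - Real.log T))) := by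
    refine ((tendsto_slope_inv_sub_rpow hT).const_mul κ).congr fun s => ?_
    simp only [hB]
    rw [hnum]
    ring
  have := tendsto_nhds_unique hBlim hBlim2
  linarith

lemma tendsto_eisReal_sub_re {N : ℕ} (hN : 1 ≤ N) (τ : ℍ) :
    Tendsto (fun s : ℝ => eisReal N τ s - (eisRes N).re / (s - 1)) (𝓝[>] 1)
      (𝓝 (eisConst N τ).re) :=
  (Complex.continuous_re.tendsto _).comp (tendsto_eisReal_sub hN τ)

namespace IsMeromorphicModularForm

variable {N : ℕ} {k : ℤ} {f : ℍ → ℂ} {F : Set ℍ}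

/-- The Rohrlich–Jensen formula in terms of the constant term of the Eisenstein series. -/
lemma eisRes_mul_integral_logAbs (hf : IsMeromorphicModularForm N k f) (hN : 1 ≤ N)
    (hcusp : ∀ σ : SL(2, ℤ), cuspOrder N k f σ = 0) (hF : IsClosedFundamentalDomain N F) {c : ℂ}
    (hlim : Tendsto (expansionAtCusp N k f 1) (𝓝[≠] 0) (𝓝 c)) :
    (eisRes N).re * ∫ τ in F, logAbs k f τ = Real.log ‖c‖ - (k : ℝ) / 2 +
      2 * Real.pi * ∑ o ∈ (hf.finite_orbits hN hcusp).toFinset,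
        (ordAt f o.out : ℝ) / ellipticOrder N o.out * (eisConst N o.out).re := by
  obtain ⟨T, C, hT, hTz⟩ := hf.exists_bound_slash hN hcusp 1
  rw [SlashAction.slash_one] at hTz
  refine eq_of_asymptotics (hf.finite_orbits hN hcusp).toFinset
    (fun o => (ordAt f o.out : ℝ) / ellipticOrder N o.out) (fun o => (eisConst N o.out).re)
    (fun o => eisReal N o.out) _ (zero_lt_one.trans_le hT)
    (fun o => tendsto_eisReal_sub_re hN o.out)
    (tendsto_integral_eisTrunc hN (hf.integrableOn_logAbs hN hcusp hF) hT) ?_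
  filter_upwards [hf.integral_logAbs_mul_eisTrunc hN hcusp hF hlim hT
    fun τ hτ => (hTz τ hτ).1] with s hs
  rw [hs]
  congr 2
  exact Finset.sum_congr rfl fun o _ => by ring

end IsMeromorphicModularForm

end Rohrlich

end

/-! ### The theorem -/

open Rohrlich in
theorem mainTheorem3 (N : ℕ) (hN : 1 ≤ N) (k : ℤ) (f : ℍ → ℂ)
    (hf : IsMeromorphicModularForm N k f)
    (hcusp : ∀ σ : SL(2, ℤ), cuspOrder N k f σ = 0)
    (F : Set ℍ) (hF : IsClosedFundamentalDomain N F) :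
    -- the Eisenstein series of weight 2 is holomorphic at `s = 1`, that of weight 0 meromorphic
    (∀ τ : ℍ, ∃ a : ℤ → ℂ, HasLaurentExpansionAtOne (eisenstein N 2 τ) a ∧ a (-1) = 0) ∧
    (∀ τ : ℍ, ∃ a : ℤ → ℂ, HasLaurentExpansionAtOne (eisenstein N 0 τ) a) ∧
    -- `ξ₂ g` is the constant term of the Eisenstein series of weight 0
    (∀ τ : ℍ, DifferentiableAt ℝ (gFun N ∘ ofComplex) (τ : ℂ) ∧
      xi 2 (gFun N) τ = laurentCoeffAtOne (eisenstein N 0 τ) 0) ∧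
    -- the sum over `Γ₀(N) \ ℍ` is finite
    {z : MulAction.orbitRel.Quotient (Gamma0 N) ℍ | ordAt f z.out ≠ 0}.Finite ∧
    -- `finfty` is `f(i∞)`, and `P` is the regularized inner product `⟨1, log (v^(k/2) |f|)⟩`
    ∃ finfty : ℂ, finfty ≠ 0 ∧ Tendsto f atImInfty (𝓝 finfty) ∧
    ∃ P : ℂ, HasRegularizedInnerProduct F (fun _ => 1) (logNorm k f) P ∧
      -(1 / (quotientVolume F : ℂ)) * P =
        -2 * (Real.pi : ℂ) *
            (∑ᶠ z : MulAction.orbitRel.Quotient (Gamma0 N) ℍ,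
              (ordAt f z.out : ℂ) / (ellipticOrder N z.out : ℂ) * xi 2 (gFun N) z.out)
          + (k : ℂ) / 2 - (Real.log ‖finfty‖ : ℂ) := by
  refine ⟨fun τ => ?_, fun τ => ?_, fun τ => ⟨(xi_gFun hN τ).1, ?_⟩, hf.finite_orbits hN hcusp, ?_⟩
  · obtain ⟨a, h, h1, -⟩ := exists_laurent_two hN τ
    exact ⟨a, h, h1⟩
  · obtain ⟨a, h, -⟩ := exists_laurent_zero hN τ
    exact ⟨a, h⟩
  · rw [(xi_gFun hN τ).2, laurentCoeff_eisenstein_zero hN]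
  obtain ⟨c, hc, hexp, hlim⟩ := hf.tendsto_slash hN 1 (hcusp 1)
  rw [SlashAction.slash_one] at hlim
  refine ⟨c, hc, hlim, _, hf.hasRegularizedInnerProduct hN hcusp hF, ?_⟩
  have hvol := hF.eisRes_mul_volume hN
  have hvol0 : (volume F).toReal ≠ 0 := right_ne_zero_of_mul_eq_one hvol
  have hmain := hf.eisRes_mul_integral_logAbs hN hcusp hF hexp
  -- The residue of the weight-zero series is replaced by the inverse volume, which produces the
  -- normalization of the inner product.
  rw [eq_one_div_of_mul_eq_one_left hvol] at hmain
  rw [finsum_eq_sum_of_support_subset (s := (hf.finite_orbits hN hcusp).toFinset)]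
  · have hsum : ∑ o ∈ (hf.finite_orbits hN hcusp).toFinset,
        (ordAt f o.out : ℂ) / (ellipticOrder N o.out : ℂ) * xi 2 (gFun N) o.out =
        ((∑ o ∈ (hf.finite_orbits hN hcusp).toFinset,
          (ordAt f o.out : ℝ) / ellipticOrder N o.out * (eisConst N o.out).re : ℝ) : ℂ) := by
      push_cast
      refine Finset.sum_congr rfl fun o _ => ?_
      rw [(xi_gFun hN o.out).2, Complex.conj_eq_iff_re.mp (conj_eisConst hN o.out)]
    rw [hsum, quotientVolume]
    have hmain' := congrArg Complex.ofReal hmain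
    rw [Complex.ofReal_mul] at hmain'
    simp only [Complex.ofReal_add, Complex.ofReal_sub, Complex.ofReal_mul, Complex.ofReal_div,
      Complex.ofReal_one, Complex.ofReal_ofNat, Complex.ofReal_intCast] at hmain'
    linear_combination -hmain'
  · intro o ho
    rw [Set.Finite.coe_toFinset, Set.mem_ofPred_eq]
    intro h
    exact ho (by simp only [h, Int.cast_zero, zero_div, zero_mul])
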